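/- Let $K$ be a field of characteristic $p>0$ and let $a\ge 1$. For a graded ring $R=K[X,Y,Z]$ or $R=K[X,Y,Z]/(F)$ with $F$ homogeneous, and for $c\ge 1$, $m\in\mathbb{Z}$, let $\mathrm{Syz}(X^c,Y^c,Z^c)(m)$ be the kernel of $(X^c,Y^c,Z^c)\colon \mathcal{O}(m-c)^{\oplus 3}\to\mathcal{O}(m)$ on $\mathrm{Proj}\,R$. A locally free sheaf $E$ on $\mathbb{P}^2$ or on a smooth projective curve is semistable if $\deg(T)/\mathrm{rk}(T)\le\deg(E)/\mathrm{rk}(E)$ for every nonzero coherent subsheaf $T\subseteq E$ (on $\mathbb{P}^2$ the degree is taken with respect to $\mathcal{O}(1)$), and strongly semistable if all pull-backs $F^{e*}E$, $e\ge 0$, under the iterated absolute Frobenius morphism are semistable. (1) The syzygy bundle $\mathrm{Syz}(X^a,Y^a,Z^a)$ on $\mathbb{P}^2=\mathrm{Proj}\,K[X,Y,Z]$ is strongly semistable. (2) It is not true that its restriction to all smooth plane curves of sufficiently high degree is strongly semistable: there is no $d_1$ such that for every $d\ge d_1$ and every nonzero homogeneous $F$ of degree $d$ defining a smooth (integral)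 curve $C=V_+(F)\subset\mathbb{P}^2$ the restriction $\mathrm{Syz}(X^a,Y^a,Z^a)|_C$ is strongly semistable. (3) More precisely, for every $d_0$ there are $d\ge d_0$ and $e\ge 1$ with $p\nmid d$ and $ap^{e-1}<d<\tfrac32 ap^{e-1}$ such that, with $q=p^e$, $k=dp-aq$, and $C$ the Fermat curve $X^d+Y^d+Z^d=0$, the following hold: $C$ is smooth over $K$ and integral; $F^{e*}(\mathrm{Syz}(X^a,Y^a,Z^a)|_C)\cong\mathrm{Syz}(X^{aq},Y^{aq},Z^{aq})$ on $C$; the bundle $\mathrm{Syz}(X^{aq},Y^{aq},Z^{aq})(dp)$ on $C$ has negative degree, and yet $(X^k,Y^k,Z^k)$ is a nonzero global section of it; and $F^{e*}(\mathrm{Syz}(X^a,Y^a,Z^a)|_C)$ is not semistable. -/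

import Mathlib

open CategoryTheory AlgebraicGeometry TopologicalSpace Opposite

universe u

noncomputable section

namespace SyzBundle

section Twist
variable {A σ : Type u} [CommRing A] [SetLike σ A] [AddSubgroupClass σ A]
variable (𝒜 : ℕ → σ) [GradedRing 𝒜]

/-- The localization of the graded ring at the homogeneous prime of a point. -/
abbrev LocAt (x : ProjectiveSpectrum 𝒜) : Type u :=
  Localization.AtPrime x.asHomogeneousIdeal.toIdeal

/-- The function `f` is given on `U` by one fraction `r / s` of homogeneous elements with
`deg r - deg s = n`. -/
def IsTwistFraction (n : ℤ) {U : Opens (ProjectiveSpectrum 𝒜)}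
    (f : ∀ x : U, LocAt 𝒜 x.1) : Prop :=
  ∃ (i j : ℕ) (_ : (i : ℤ) = j + n) (r s : A) (_ : r ∈ 𝒜 i) (_ : s ∈ 𝒜 j)
    (hs : ∀ x : U, s ∈ x.1.asHomogeneousIdeal.toIdeal.primeCompl),
    ∀ x : U, f x = Localization.mk r ⟨s, hs x⟩

/-- Being locally a homogeneous fraction of degree `n`. -/
def isLocallyTwistFraction (n : ℤ) :
    TopCat.LocalPredicate (X := ProjectiveSpectrum.top 𝒜)
      fun x : ProjectiveSpectrum 𝒜 => LocAt 𝒜 x :=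
  TopCat.PrelocalPredicate.sheafify
    { pred := fun f => IsTwistFraction 𝒜 n f
      res := by
        rintro V U i f ⟨a, b, hab, r, s, hr, hs, hx, h⟩
        exact ⟨a, b, hab, r, s, hr, hs, fun x => hx ⟨x.1, i.le x.2⟩,
          fun x => h ⟨x.1, i.le x.2⟩⟩ }

lemma exists_homogeneous_notMem (x : ProjectiveSpectrum 𝒜) (n : ℕ) :
    ∃ (j : ℕ) (s : A), n ≤ j ∧ s ∈ 𝒜 j ∧ s ∉ x.asHomogeneousIdeal.toIdeal := by
  have h := x.not_irrelevant_le
  rw [HomogeneousIdeal.irrelevant_le] at h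
  push Not at h
  obtain ⟨i, hi, hx⟩ := h
  obtain ⟨s, hs, hsx⟩ := SetLike.not_le_iff_exists.mp hx
  refine ⟨n • i, s ^ n, ?_, SetLike.pow_mem_graded n hs, fun h => hsx ?_⟩
  · simpa using Nat.le_mul_of_pos_right n hi
  · exact x.isPrime.mem_of_pow_mem n h

/-- Local homogeneous fractions of degree `n` form a group. -/
def twistSections (n : ℤ) (U : Opens (ProjectiveSpectrum 𝒜)) :
    AddSubgroup (∀ x : U, LocAt 𝒜 x.1) where
  carrier := {f | (isLocallyTwistFraction 𝒜 n).pred f}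
  zero_mem' := by
    intro x
    obtain ⟨j, s, hj, hs, hsx⟩ := exists_homogeneous_notMem 𝒜 x.1 (-n).toNat
    refine ⟨U ⊓ ProjectiveSpectrum.basicOpen 𝒜 s, ⟨x.2, hsx⟩, Opens.infLELeft _ _,
      (j + n).toNat, j, by omega, 0, s, zero_mem _, hs, fun y => y.2.2, fun y => ?_⟩
    exact (Localization.mk_zero _).symm
  add_mem' := by
    intro f g hf hg x
    obtain ⟨V, hV, iV, a, b, hab, r, s, hr, hs, hx, h⟩ := hf x
    obtain ⟨V', hV', iV', a', b', hab', r', s', hr', hs', hx', h'⟩ := hg x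
    refine ⟨V ⊓ V', ⟨hV, hV'⟩, Opens.infLELeft _ _ ≫ iV, a + b', b + b', by push_cast; omega,
      s * r' + s' * r, s * s', ?_, SetLike.mul_mem_graded hs hs',
      fun y => mul_mem (hx ⟨y.1, y.2.1⟩) (hx' ⟨y.1, y.2.2⟩), fun y => ?_⟩
    · have h1 : b + a' = a + b' := by omega
      have h2 : b' + a = a + b' := by omega
      exact add_mem (h1 ▸ SetLike.mul_mem_graded hs hr') (h2 ▸ SetLike.mul_mem_graded hs' hr)
    · have e1 := h ⟨y.1, y.2.1⟩
      have e2 := h' ⟨y.1, y.2.2⟩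
      exact (congrArg₂ (· + ·) e1 e2).trans (Localization.add_mk _ _ _ _)
  neg_mem' := by
    intro f hf x
    obtain ⟨V, hV, iV, a, b, hab, r, s, hr, hs, hx, h⟩ := hf x
    exact ⟨V, hV, iV, a, b, hab, -r, s, neg_mem hr, hs, hx,
      fun y => (congrArg Neg.neg (h y)).trans (Localization.neg_mk _ _)⟩

/-- The sheaf of local homogeneous fractions of degree `n`, as a sheaf of sets. -/
def twistInType (n : ℤ) : TopCat.Sheaf (Type u) (ProjectiveSpectrum.top 𝒜) :=
  TopCat.subsheafToTypes (isLocallyTwistFraction 𝒜 n)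

/-- The sheaf of local homogeneous fractions of degree `n`, as a presheaf of abelian groups. -/
def twistInAb (n : ℤ) : TopCat.Presheaf AddCommGrpCat.{u} (ProjectiveSpectrum.top 𝒜) where
  obj U := AddCommGrpCat.of (twistSections 𝒜 n U.unop)
  map i := AddCommGrpCat.ofHom
    { toFun := fun f => ⟨fun x => f.1 ⟨x.1, i.unop.le x.2⟩,
        (isLocallyTwistFraction 𝒜 n).res i.unop f.1 f.2⟩
      map_zero' := rfl
      map_add' := fun _ _ => rfl }

lemma twist_smul_mem (n : ℤ) (U : Opens (ProjectiveSpectrum 𝒜))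
    (c : (ProjectiveSpectrum.Proj.structureSheaf 𝒜).1.obj (op U)) (f : twistSections 𝒜 n U) :
    (fun x : U => (c.1 x).val * f.1 x) ∈ twistSections 𝒜 n U := by
  intro x
  obtain ⟨V, hV, iV, d, ⟨r, hr⟩, ⟨s, hs⟩, hx, h⟩ := c.2 x
  obtain ⟨V', hV', iV', a', b', hab', r', s', hr', hs', hx', h'⟩ := f.2 x
  refine ⟨V ⊓ V', ⟨hV, hV'⟩, Opens.infLELeft _ _ ≫ iV, d + a', d + b', by push_cast; omega,
      r * r', s * s', SetLike.mul_mem_graded hr hr', SetLike.mul_mem_graded hs hs',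
      fun y => mul_mem (hx ⟨y.1, y.2.1⟩) (hx' ⟨y.1, y.2.2⟩), fun y => ?_⟩
  have e1 := congrArg HomogeneousLocalization.val (h ⟨y.1, y.2.1⟩)
  have e2 := h' ⟨y.1, y.2.2⟩
  exact (congrArg₂ (· * ·) e1 e2).trans (Localization.mk_mul _ _ _ _)

/-- Sections of the structure sheaf (local fractions of degree `0`) act by multiplication. -/
instance twistModule (n : ℤ) (U : (Opens (Proj 𝒜))ᵒᵖ) :
    Module ((Proj 𝒜).ringCatSheaf.obj.obj U) ((twistInAb 𝒜 n).obj U) where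
  smul c f := ⟨fun x => ((show (ProjectiveSpectrum.Proj.structureSheaf 𝒜).1.obj U from c).1 x).val
    * f.1 x, twist_smul_mem 𝒜 n U.unop c f⟩
  one_smul f := Subtype.ext (funext fun x => by
    refine Eq.trans ?_ (one_mul (f.1 x))
    exact congrArg (· * f.1 x) (HomogeneousLocalization.val_one ..))
  mul_smul c d f := Subtype.ext (funext fun x => by
    refine Eq.trans ?_ (mul_assoc _ _ _)
    exact congrArg (· * _) (HomogeneousLocalization.val_mul ..))
  smul_zero c := Subtype.ext (funext fun x => mul_zero _)
  smul_add c f g := Subtype.ext (funext fun x => mul_add _ _ _)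
  add_smul c d f := Subtype.ext (funext fun x => by
    refine Eq.trans ?_ (add_mul _ _ _)
    exact congrArg (· * _) (HomogeneousLocalization.val_add ..))
  zero_smul f := Subtype.ext (funext fun x => by
    refine Eq.trans ?_ (zero_mul (f.1 x))
    exact congrArg (· * f.1 x) (HomogeneousLocalization.val_zero ..))

/-- Serre's twisting sheaf `𝒪(n)` on `Proj 𝒜`: the sheaf associated with the shifted graded
module `A(n)`. -/
def twist (n : ℤ) : (Proj 𝒜).Modules where
  val := PresheafOfModules.ofPresheaf (R := (Proj 𝒜).ringCatSheaf.obj) (twistInAb 𝒜 n)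
    (fun _ _ _ _ _ => Subtype.ext (funext fun _ => rfl))
  isSheaf := (TopCat.Presheaf.isSheaf_iff_isSheaf_comp (forget AddCommGrpCat) _).2
    (twistInType 𝒜 n).2

lemma twist_mul_mem {m n : ℤ} {k : ℕ} (h : n = m + k) {g : A} (hg : g ∈ 𝒜 k)
    (U : Opens (ProjectiveSpectrum 𝒜)) (f : twistSections 𝒜 m U) :
    (fun x : U => algebraMap A (LocAt 𝒜 x.1) g * f.1 x) ∈ twistSections 𝒜 n U := by
  intro x
  obtain ⟨V', hV', iV', a', b', hab', r', s', hr', hs', hx', h'⟩ := f.2 x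
  refine ⟨V', hV', iV', k + a', b', by push_cast; omega,
      g * r', s', SetLike.mul_mem_graded hg hr', hs', hx', fun y => ?_⟩
  refine (congrArg (algebraMap A (LocAt 𝒜 y.1) g * ·) (h' y)).trans ?_
  rw [← Localization.mk_one_eq_algebraMap]
  refine (Localization.mk_mul _ _ _ _).trans ?_
  rw [one_mul]

/-- Multiplication `𝒪(m) ⟶ 𝒪(n)` by a homogeneous element of degree `k = n - m`. -/
def twistMul {m n : ℤ} {k : ℕ} (h : n = m + k) {g : A} (hg : g ∈ 𝒜 k) :
    twist 𝒜 m ⟶ twist 𝒜 n where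
  val := PresheafOfModules.homMk (M₁ := (twist 𝒜 m).val) (M₂ := (twist 𝒜 n).val)
    { app U := AddCommGrpCat.ofHom (X := twistSections 𝒜 m U.unop)
        (Y := twistSections 𝒜 n U.unop)
        { toFun := fun f => ⟨fun x => algebraMap A (LocAt 𝒜 x.1) g * f.1 x,
            twist_mul_mem 𝒜 h hg U.unop f⟩
          map_zero' := Subtype.ext (funext fun _ => mul_zero _)
          map_add' := fun _ _ => Subtype.ext (funext fun _ => mul_add _ _ _) }
      naturality := fun _ _ _ => rfl }
    (fun _ _ _ => Subtype.ext (funext fun _ => mul_left_comm _ _ _))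

lemma twistSection_mem {n : ℤ} {k : ℕ} (h : (k : ℤ) = n) {g : A} (hg : g ∈ 𝒜 k)
    (U : Opens (ProjectiveSpectrum 𝒜)) :
    (fun x : U => algebraMap A (LocAt 𝒜 x.1) g) ∈ twistSections 𝒜 n U := by
  intro x
  refine ⟨U, x.2, 𝟙 _, k, 0, by push_cast; omega, g, 1, hg, SetLike.one_mem_graded _,
    fun y => one_mem _, fun y => ?_⟩
  exact (Localization.mk_one_eq_algebraMap g).symm

/-- The global section of `𝒪(n)` given by a homogeneous element of degree `n`. -/
def twistSection {n : ℤ} {k : ℕ} (h : (k : ℤ) = n) {g : A} (hg : g ∈ 𝒜 k) :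
    Γ(twist 𝒜 n, ⊤) :=
  show twistSections 𝒜 n ⊤ from ⟨_, twistSection_mem 𝒜 h hg ⊤⟩

instance modulesHasFiniteBiproducts (X : Scheme.{u}) : Limits.HasFiniteBiproducts X.Modules :=
  Abelian.hasFiniteBiproducts

/-- The syzygy sheaf `Syz(f₁,…,f_r)(m)` of homogeneous elements `f_i` of degree `c`: the kernel of
`(f₁,…,f_r) : ⨁ 𝒪(m - c) ⟶ 𝒪(m)`. -/
def syz {ι : Type} [Fintype ι] {c : ℕ} (f : ι → A) (hf : ∀ i, f i ∈ 𝒜 c) (m : ℤ) :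
    (Proj 𝒜).Modules :=
  Limits.kernel (Limits.biproduct.desc (f := fun _ : ι => twist 𝒜 (m - c))
    fun i => twistMul 𝒜 (m := m - c) (n := m) (by ring) (hf i))

/-- The `i`-th component `Syz(f₁,…,f_r)(m) ⟶ 𝒪(m - c)` of the inclusion in `⨁ 𝒪(m - c)`. -/
def syzι {ι : Type} [Fintype ι] {c : ℕ} (f : ι → A) (hf : ∀ i, f i ∈ 𝒜 c) (m : ℤ) (i : ι) :
    syz 𝒜 f hf m ⟶ twist 𝒜 (m - c) :=
  Limits.kernel.ι _ ≫ Limits.biproduct.π (fun _ : ι => twist 𝒜 (m - c)) i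

end Twist

section Quot
variable {K A : Type u} [CommRing K] [CommRing A] [Algebra K A]
variable {𝒜 : ℕ → Submodule K A} [GradedAlgebra 𝒜]

/-- The induced grading on the quotient by a homogeneous ideal. -/
def quotGrading (I : HomogeneousIdeal 𝒜) (n : ℕ) : Submodule K (A ⧸ I.toIdeal) :=
  (𝒜 n).map (Ideal.Quotient.mkₐ K I.toIdeal).toLinearMap

instance (I : HomogeneousIdeal 𝒜) : SetLike.GradedMonoid (quotGrading I) where
  one_mem := ⟨1, SetLike.one_mem_graded _, rfl⟩
  mul_mem := by
    rintro i j _ _ ⟨a, ha, rfl⟩ ⟨b, hb, rfl⟩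
    exact ⟨a * b, SetLike.mul_mem_graded ha hb, map_mul (Ideal.Quotient.mkₐ K I.toIdeal) _ _⟩

/-- The classes of the homogeneous components of an element. -/
def quotComponents (I : HomogeneousIdeal 𝒜) :
    A →+ DirectSum ℕ (fun n => quotGrading I n) :=
  (DirectSum.map fun n => (((Ideal.Quotient.mkₐ K I.toIdeal).toLinearMap.submoduleMap
    (𝒜 n)).toAddMonoidHom : 𝒜 n →+ quotGrading I n)).comp
      (DirectSum.decomposeAddEquiv 𝒜).toAddMonoidHom

lemma quotComponents_apply (I : HomogeneousIdeal 𝒜) (a : A) (n : ℕ) :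
    (quotComponents I a n : A ⧸ I.toIdeal) = Ideal.Quotient.mk I.toIdeal
      (DirectSum.decompose 𝒜 a n) := by
  simp only [quotComponents]
  rfl

lemma quotComponents_coe (I : HomogeneousIdeal 𝒜) {n : ℕ} (a : 𝒜 n) :
    quotComponents I a = DirectSum.of (fun n => quotGrading I n) n
      ⟨Ideal.Quotient.mk I.toIdeal a, a, a.2, rfl⟩ := by
  change DirectSum.map _ (DirectSum.decompose 𝒜 (a : A)) = _
  rw [DirectSum.decompose_coe, DirectSum.map_of]
  rfl

/-- The homogeneous components of a class. -/
def quotDecompose (I : HomogeneousIdeal 𝒜) :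
    (A ⧸ I.toIdeal) →+ DirectSum ℕ (fun n => quotGrading I n) :=
  QuotientAddGroup.lift I.toIdeal.toAddSubgroup (quotComponents I) (by
    intro a ha
    refine DFinsupp.ext fun n => Subtype.ext ?_
    refine (quotComponents_apply I a n).trans ?_
    exact Ideal.Quotient.eq_zero_iff_mem.mpr (I.is_homogeneous' n ha))

instance quotGradedAlgebra (I : HomogeneousIdeal 𝒜) : GradedAlgebra (quotGrading I) where
  toDecomposition := DirectSum.Decomposition.ofAddHom (quotGrading I) (quotDecompose I)
    (by
      refine AddMonoidHom.ext fun x => ?_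
      obtain ⟨a, rfl⟩ := Ideal.Quotient.mk_surjective x
      change DirectSum.coeAddMonoidHom (quotGrading I) (quotComponents I a) = _
      induction a using DirectSum.Decomposition.inductionOn 𝒜 with
      | zero => simp
      | add a b ha hb => simp [map_add, ha, hb] 
      | homogeneous a => 
        rw [quotComponents_coe, DirectSum.coeAddMonoidHom_of]
        rfl)
    (by
      refine DirectSum.addHom_ext fun n y => ?_
      obtain ⟨_, a, ha, rfl⟩ := y
      simp only [AddMonoidHom.comp_apply, DirectSum.coeAddMonoidHom_of, AddMonoidHom.id_apply]
      change quotComponents I a = _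
      lift a to 𝒜 n using ha
      exact quotComponents_coe I a)

/-- The quotient map as a graded homomorphism. -/
def quotMap (I : HomogeneousIdeal 𝒜) : 𝒜 →+*ᵍ quotGrading I where
  __ := Ideal.Quotient.mk I.toIdeal
  map_mem ha := ⟨_, ha, rfl⟩

lemma quotMap_irrelevant (I : HomogeneousIdeal 𝒜) :
    HomogeneousIdeal.irrelevant (quotGrading I) ≤
      (HomogeneousIdeal.irrelevant 𝒜).map (quotMap I) := by
  rw [HomogeneousIdeal.irrelevant_le]
  rintro n hn _ ⟨a, ha, rfl⟩
  refine Ideal.mem_map_of_mem (quotMap I) ?_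
  exact HomogeneousIdeal.mem_irrelevant_of_mem _ hn ha

/-- The closed immersion `Proj (A ⧸ I) ⟶ Proj A`. -/
def quotIncl (I : HomogeneousIdeal 𝒜) : Proj (quotGrading I) ⟶ Proj 𝒜 :=
  Proj.map (quotMap I) (quotMap_irrelevant I)

end Quot

section ProjInstances
variable {K A : Type u} [CommRing K] [CommRing A] [Algebra K A]
variable (𝒜 : ℕ → Submodule K A) [GradedAlgebra 𝒜]

/-- The structure morphism of `Proj 𝒜` over the base ring. -/
def projToSpec : Proj 𝒜 ⟶ Spec (.of K) :=
  Proj.toSpecZero 𝒜 ≫ Spec.map (CommRingCat.ofHom (algebraMap K (𝒜 0)))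

lemma isLocallyNoetherian_proj [IsNoetherianRing K] [Algebra.FiniteType K A] :
    IsLocallyNoetherian (Proj 𝒜) := by
  have : IsNoetherianRing A := Algebra.FiniteType.isNoetherianRing K A
  have : IsNoetherianRing (𝒜 0) := isNoetherianRing_of_surjective A (𝒜 0)
    (GradedRing.projZeroRingHom' 𝒜) (GradedRing.projZeroRingHom'_surjective 𝒜)
  have : IsScalarTower K (𝒜 0) A :=
    ⟨fun a b c => smul_mul_assoc a (b : A) c⟩
  have : Algebra.FiniteType (𝒜 0) A := Algebra.FiniteType.of_restrictScalars_finiteType K (𝒜 0) A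
  exact LocallyOfFiniteType.isLocallyNoetherian (Proj.toSpecZero 𝒜)

lemma isIntegral_proj [IsDomain A] {n : ℕ} (hn : 0 < n) {g : A} (hg : g ∈ 𝒜 n) (h0 : g ≠ 0) :
    IsIntegral (Proj 𝒜) := by
  let η : ProjectiveSpectrum 𝒜 :=
    ⟨⊥, by simpa using Ideal.isPrime_bot, fun h => h0
      (h (HomogeneousIdeal.mem_irrelevant_of_mem _ hn hg) : g ∈ (⊥ : Ideal A))⟩
  have hη : IsGenericPoint η (Set.univ : Set (ProjectiveSpectrum 𝒜)) := by
    refine Set.eq_univ_of_forall fun x => ?_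
    rw [← ProjectiveSpectrum.le_iff_mem_closure]
    exact (bot_le : (⊥ : HomogeneousIdeal 𝒜) ≤ x.asHomogeneousIdeal)
  have h1 : IrreducibleSpace (Proj 𝒜) := by
    have : PreirreducibleSpace (Proj 𝒜) := ⟨hη.isIrreducible.isPreirreducible⟩
    exact ⟨⟨η⟩⟩
  have h2 : ∀ x : Proj 𝒜, _root_.IsReduced ((Proj 𝒜).presheaf.stalk x) := fun x => by
    let y : ProjectiveSpectrum 𝒜 := x
    have : IsDomain (Localization.AtPrime y.asHomogeneousIdeal.toIdeal) :=
      IsLocalization.isDomain_localization y.asHomogeneousIdeal.toIdeal.primeCompl_le_nonZeroDivisors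
    let φ := (algebraMap (HomogeneousLocalization.AtPrime 𝒜 y.asHomogeneousIdeal.toIdeal)
      (Localization.AtPrime y.asHomogeneousIdeal.toIdeal)).comp
        (Proj.stalkIso' 𝒜 y).toRingHom
    exact isReduced_of_injective φ
      ((HomogeneousLocalization.val_injective _).comp (Proj.stalkIso' 𝒜 y).injective)
  have : IsReduced (Proj 𝒜) := isReduced_of_isReduced_stalk _
  exact isIntegral_of_irreducibleSpace_of_isReduced _

end ProjInstances

section Frob
variable {K : Type u} [Field K] (p : ℕ) [Fact p.Prime] [CharP K p] {X : Scheme.{u}}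
  (f : X ⟶ Spec (.of K))

/-- The ring homomorphism through which constants act on sections. -/
def constants (U : X.Opens) : K →+* Γ(X, U) :=
  ((Scheme.ΓSpecIso (.of K)).inv ≫ f.appTop ≫ X.presheaf.map (homOfLE le_top).op).hom

/-- The ring endomorphism `r ↦ r ^ (p ^ e)` of a ring of characteristic `p` (or zero ring). -/
def ringFrob (e : ℕ) (R : Type u) [CommRing R] (φ : K →+* R) : R →+* R where
  toFun r := r ^ p ^ e
  map_one' := one_pow _
  map_mul' _ _ := mul_pow _ _ _
  map_zero' := zero_pow (pow_ne_zero _ (Fact.out : p.Prime).ne_zero)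
  map_add' x y := by
    cases subsingleton_or_nontrivial R
    · exact Subsingleton.elim _ _
    · have := charP_of_injective_ringHom φ.injective p
      exact add_pow_char_pow x y p e


/-- The `e`-th absolute Frobenius as a morphism of ringed spaces: the identity on points and
`r ↦ r ^ (p ^ e)` on sections. -/
def frobSheafed (e : ℕ) : X.toPresheafedSpace ⟶ X.toPresheafedSpace where
  base := 𝟙 _
  c := { app U := CommRingCat.ofHom (ringFrob p e Γ(X, U.unop) (constants f U.unop))
         naturality := by
              intro U V i
              ext x
              exact (map_pow (X.presheaf.map i).hom x (p ^ e)).symm }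

lemma frobSheafed_stalk (e : ℕ) (x : X) (a : X.presheaf.stalk x) :
    ((frobSheafed p f e).stalkMap x).hom a = a ^ p ^ e := by
  obtain ⟨U, hx, s, rfl⟩ := TopCat.Presheaf.exists_germ_eq _ a
  refine (PresheafedSpace.stalkMap_germ_apply (frobSheafed p f e) U x hx s).trans ?_
  exact map_pow (X.presheaf.germ U x hx).hom s (p ^ e)

/-- The `e`-th absolute Frobenius morphism `X ⟶ X` of a scheme over a field of characteristic `p`:
the identity on points and `r ↦ r ^ (p ^ e)` on sections. The structure morphism `f` only serves
to know that `p = 0` on `X`. -/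
def frob (e : ℕ) : X ⟶ X where
  __ := frobSheafed p f e
  prop x := ⟨fun a ha => by
    have h : IsUnit (show X.presheaf.stalk x from a ^ p ^ e) :=
      (frobSheafed_stalk p f e x a).subst (motive := fun b => IsUnit b) ha
    exact (isUnit_pow_iff (pow_ne_zero _ (Fact.out : p.Prime).ne_zero)).mp h⟩
  
end Frob

section Stab

/-- The degree `[κ(x) : K]` of a point `x` of a scheme over `K`. -/
def residueDegree {K : Type u} [Field K] {X : Scheme.{u}} (f : X ⟶ Spec (.of K)) (x : X) : ℕ :=
  @Module.finrank K (X.residueField x) _ _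
    ((X.evaluation ⊤ x trivial).hom.comp (constants f ⊤)).toModule

variable {X : Scheme.{u}}

/-- The stalk of a sheaf of modules is a module over the local ring. -/
instance stalkModule (M : X.Modules) (x : X) :
    Module (X.presheaf.stalk x) (M.presheaf.stalk x) :=
  PresheafOfModules.instModuleCarrierStalkCommRingCatCarrierAbPresheafOpensCarrier
    (R := X.presheaf) M.val x

variable [IsIntegral X]

/-- The stalk at the generic point. -/
abbrev genStalk (M : X.Modules) := M.presheaf.stalk (genericPoint X)

/-- The generic stalk is a vector space over the function field. -/
instance genStalkModule (M : X.Modules) : Module X.functionField (genStalk M) :=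
  stalkModule M (genericPoint X)

/-- The rank: the dimension of the generic stalk over the function field. -/
def rank (M : X.Modules) : ℕ := Module.finrank X.functionField (genStalk M)

/-- The specialization map from the stalk at `x` to the generic stalk. -/
def toGenStalk (M : X.Modules) (x : X) : M.presheaf.stalk x →+ genStalk M :=
  (M.presheaf.stalkSpecializes ((genericPoint_spec X).specializes trivial)).hom

/-- The basis `b` of the generic stalk is an `𝒪_x`-basis of (the image of) the stalk at `x`: the
elements coming from the stalk at `x` are those with coordinates in `𝒪_x`. -/
def IsLocalBasis (M : X.Modules) (x : X) {n : ℕ}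
    (b : Module.Basis (Fin n) X.functionField (genStalk M)) : Prop :=
  ∀ m : genStalk M, m ∈ (toGenStalk M x).range ↔
    ∀ i, b.repr m i ∈ (algebraMap (X.presheaf.stalk x) X.functionField).range

variable [IsLocallyNoetherian X]

open Order in
/-- `M` has degree `δ`: it is the degree of `det M`, computed as the degree of the divisor of the
nonzero rational section `e₁ ∧ … ∧ e_n` of `det M`, where `e` is a basis of the generic stalk of
`M` over the function field. The multiplicity of this divisor at a point `x` of codimension one is
the order at `x` of the determinant of `e` with respect to an `𝒪_x`-basis `b` of the stalk at `x`
(it does not depend on `b`), and `w x` is the degree of the prime divisor with generic point `x`.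
To be used for torsion-free coherent sheaves on smooth varieties, where such bases exist, and for
functions `w` for which principal divisors have degree zero, so that `e` does not matter. -/
def HasDegree (w : X → ℕ) (M : X.Modules) (δ : ℤ) : Prop :=
  ∃ (n : ℕ) (e : Module.Basis (Fin n) X.functionField (genStalk M)) (D : X →₀ ℤ),
    (∀ x, coheight x ≠ 1 → D x = 0) ∧
    (∀ x, coheight x = 1 → ∃ b : Module.Basis (Fin n) X.functionField (genStalk M),
      IsLocalBasis M x b ∧ D x = X.ord (b.det e) x) ∧
    δ = D.sum fun x k => k * (w x : ℤ)

/-- `E` is semistable with respect to the degree function `w` of prime divisors: every coherent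
subsheaf `T ⊆ E` of positive rank satisfies `μ(T) ≤ μ(E)`, where `μ = deg / rank`. It is meant for
locally free `E`; a subsheaf of such an `E` is torsion-free, and it is nonzero if and only if its
rank is positive. Coherent means of finite presentation, as `X` is locally Noetherian. -/
def IsSemistable (w : X → ℕ) (E : X.Modules) : Prop :=
  ∀ (T : X.Modules) (j : T ⟶ E), Mono j →
    SheafOfModules.IsFinitePresentation (R := X.ringCatSheaf) T → 0 < rank T →
    ∀ t s : ℤ, HasDegree w T t → HasDegree w E s →
      (t : ℚ) / rank T ≤ (s : ℚ) / rank E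

/-- `E` is strongly semistable: all its pull-backs under the iterates of the absolute Frobenius
morphism are semistable. -/
def IsStronglySemistable {K : Type u} [Field K] (p : ℕ) [Fact p.Prime] [CharP K p]
    (f : X ⟶ Spec (.of K)) (w : X → ℕ) (E : X.Modules) : Prop :=
  ∀ e : ℕ, IsSemistable w ((Scheme.Modules.pullback (frob p f e)).obj E)

end Stab

section Plane
variable (K : Type u) [Field K]

/-- The standard grading of `K[X, Y, Z]`. -/
abbrev planeGrading : ℕ → Submodule K (MvPolynomial (Fin 3) K) :=
  MvPolynomial.homogeneousSubmodule (Fin 3) K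

instance planeGradedAlgebra : GradedAlgebra (planeGrading K) := MvPolynomial.gradedAlgebra

/-- The projective plane `Proj K[X, Y, Z]`. -/
abbrev Plane : Scheme.{u} := Proj (planeGrading K)

/-- The structure morphism of the projective plane. -/
abbrev planeToSpec : Plane K ⟶ Spec (.of K) := projToSpec (planeGrading K)

instance : IsLocallyNoetherian (Plane K) := isLocallyNoetherian_proj _

instance : IsIntegral (Plane K) :=
  isIntegral_proj (planeGrading K) one_pos (MvPolynomial.isHomogeneous_X K (0 : Fin 3))
    (MvPolynomial.X_ne_zero 0)

variable {K}

/-- The degree, with respect to `𝒪(1)`, of the prime divisor of the projective plane whose generic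
point is `x`: the degree of a homogeneous polynomial generating the prime ideal. -/
def planeDivisorDegree (x : Plane K) : ℕ :=
  sInf {n | ∃ f : MvPolynomial (Fin 3) K, f.IsHomogeneous n ∧
    (show ProjectiveSpectrum (planeGrading K) from x).asHomogeneousIdeal.toIdeal = Ideal.span {f}}

/-- The powers `X ^ c, Y ^ c, Z ^ c`. -/
def varPow (K : Type u) [Field K] (c : ℕ) (i : Fin 3) : MvPolynomial (Fin 3) K :=
  MvPolynomial.X i ^ c

lemma varPow_mem (c : ℕ) (i : Fin 3) : varPow K c i ∈ planeGrading K c :=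
  MvPolynomial.isHomogeneous_X_pow i c

/-- The sheaf `Syz(X ^ c, Y ^ c, Z ^ c)(m)` on the projective plane. -/
def planeSyz (K : Type u) [Field K] (c : ℕ) (m : ℤ) : (Plane K).Modules :=
  syz (planeGrading K) (varPow K c) (varPow_mem c) m

variable {d : ℕ} (F : MvPolynomial (Fin 3) K) (hF : F.IsHomogeneous d)

/-- The homogeneous ideal generated by a homogeneous polynomial. -/
def curveIdeal : HomogeneousIdeal (planeGrading K) where
  toSubmodule := Ideal.span {F}
  is_homogeneous' := Ideal.homogeneous_span _ _ (by rintro _ rfl; exact ⟨d, hF⟩)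

/-- The grading of `K[X, Y, Z] / (F)`. -/
abbrev curveGrading : ℕ → Submodule K (MvPolynomial (Fin 3) K ⧸ (curveIdeal F hF).toIdeal) :=
  quotGrading (curveIdeal F hF)

/-- The plane curve `F = 0`, as the scheme `Proj K[X, Y, Z] / (F)`. -/
abbrev PlaneCurve : Scheme.{u} := Proj (curveGrading F hF)

/-- The structure morphism of the curve `F = 0`. -/
abbrev curveToSpec : PlaneCurve F hF ⟶ Spec (.of K) := projToSpec (curveGrading F hF)

/-- The inclusion of the curve `F = 0` in the projective plane. -/
def curveIncl : PlaneCurve F hF ⟶ Plane K := quotIncl (curveIdeal F hF)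

instance : IsLocallyNoetherian (PlaneCurve F hF) := isLocallyNoetherian_proj _

/-- The class of `X_i ^ c` in `K[X, Y, Z] / (F)`. -/
def curvePow (c : ℕ) (i : Fin 3) : MvPolynomial (Fin 3) K ⧸ (curveIdeal F hF).toIdeal :=
  Ideal.Quotient.mk _ (varPow K c i)

lemma curvePow_mem (c : ℕ) (i : Fin 3) : curvePow F hF c i ∈ curveGrading F hF c :=
  ⟨_, varPow_mem c i, rfl⟩

/-- The sheaf `Syz(X ^ c, Y ^ c, Z ^ c)(m)` on the curve `F = 0`. -/
def curveSyz (c : ℕ) (m : ℤ) : (PlaneCurve F hF).Modules :=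
  syz (curveGrading F hF) (curvePow F hF c) (curvePow_mem F hF c) m

/-- The `i`-th component `Syz(X ^ c, Y ^ c, Z ^ c)(m) ⟶ 𝒪(m - c)` of the inclusion in
`⨁ 𝒪(m - c)`. -/
def curveSyzι (c : ℕ) (m : ℤ) (i : Fin 3) :
    curveSyz F hF c m ⟶ twist (curveGrading F hF) (m - c) :=
  syzι (curveGrading F hF) (curvePow F hF c) (curvePow_mem F hF c) m i

/-- The global section `X_i ^ k` of `𝒪(k)` on the curve `F = 0`. -/
def curveSection {k : ℕ} {n : ℤ} (h : (k : ℤ) = n) (i : Fin 3) :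
    Γ(twist (curveGrading F hF) n, ⊤) :=
  twistSection (curveGrading F hF) h (curvePow_mem F hF k i)

/-- The degree function of the closed points of the curve `F = 0`. -/
abbrev curvePointDegree : PlaneCurve F hF → ℕ := residueDegree (curveToSpec F hF)

/-- The restriction to the curve `F = 0` of the sheaf `Syz(X ^ c, Y ^ c, Z ^ c)`. -/
def restrictedSyz (c : ℕ) : (PlaneCurve F hF).Modules :=
  (Scheme.Modules.pullback (curveIncl F hF)).obj (planeSyz K c 0)

end Plane

end SyzBundle

end

/-! Frobenius pull-back and restriction to a curve turn syzygy bundles into syzygy bundles. Both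
morphisms come from a ring homomorphism `Φ` that multiplies degrees by some `q` and sends each
coordinate to the `q`-th power of a coordinate (`IsInducedBy`). Where the coordinate `x i` is
invertible, `Syz(x₀^c, x₁^c, x₂^c)(m)` is free on two Koszul syzygies, and `Φ` carries these to the
Koszul syzygies for the exponent `q * c`. A morphism to a push-forward that matches local bases
exhibits a pull-back (`isIso_pullback_of_isSectionBasis`), so the `e`-th Frobenius pull-back
replaces the exponent `a` by `a * p ^ e` (`IsInducedBy.nonempty_pullback_syz_iso`).

On the plane it therefore suffices that `Syz(X^n, Y^n, Z^n)` is semistable for every `n`. It has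
rank 2 and degree `-3n`, read off the transition determinants of the Koszul bases (`hasDegree_syz`).
A rational generator of a subsheaf of rank one is a tuple `g • G / B`, where `G` is a homogeneous
syzygy of degree `m` without common factor. Comparing coefficients gives `m ≥ n`
(`le_of_sum_X_pow_mul_eq_zero`), and since `G` vanishes in codimension at least two the degree is at
most `deg g - deg B = -(m + n) ≤ -2n ≤ -3n/2` (`le_of_rank_one`). A subsheaf of rank two is compared
by determinants (`HasDegree.le_of_injective`), which uses that principal divisors on the plane have
degree zero.

On the Fermat curve the `p`-th power of the equation reads `X^(dp) + Y^(dp) + Z^(dp) = 0`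
(`sum_curvePow_mul`). With `c = a * p ^ e` and `k = dp - c` this says that `(X^k, Y^k, Z^k)` is a
syzygy of `(X^c, Y^c, Z^c)`, which gives a monomorphism from `𝒪(-dp)` to `Syz(X^c, Y^c, Z^c)`. If
`h` is the degree of a line section, the slopes are `-dp * h` and `-3c/2 * h`, so `2dp < 3c`
contradicts semistability as soon as `h > 0` (`not_isSemistable_fermatSyz`). Only the sign of `h`
matters, and as a single violating pair of degrees refutes semistability, nothing about principal
divisors on the curve is needed. The choice `d = a * p ^ (e - 1) + 1`, with `k = p` and `e` large,
satisfies all numerical conditions and is prime to `p`, so the curve is smooth and integral. These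
curves occur in arbitrarily high degree, which refutes the restriction statement. -/

noncomputable section

namespace SyzBundle

open Scheme.Modules

/-! ### Local bases of sections and recognition of pull-backs. -/

section SectionBasis
variable {X Y : Scheme.{u}}

/-- Restriction of sections. -/
def res (M : X.Modules) {U V : X.Opens} (h : V ≤ U) (m : Γ(M, U)) : Γ(M, V) :=
  M.presheaf.map (homOfLE h).op m

/-- Restriction of functions. -/
def fres {U V : X.Opens} (h : V ≤ U) (m : Γ(X, U)) : Γ(X, V) :=
  X.presheaf.map (homOfLE h).op m

lemma res_add (M : X.Modules) {U V : X.Opens} (h : V ≤ U) (m n : Γ(M, U)) :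
    res M h (m + n) = res M h m + res M h n := map_add _ _ _

lemma res_sum (M : X.Modules) {U V : X.Opens} (h : V ≤ U) {ι : Type*} (t : Finset ι)
    (m : ι → Γ(M, U)) : res M h (∑ j ∈ t, m j) = ∑ j ∈ t, res M h (m j) := map_sum _ _ _

lemma res_res (M : X.Modules) {U V W : X.Opens} (h : V ≤ U) (h' : W ≤ V) (m : Γ(M, U)) :
    res M h' (res M h m) = res M (h'.trans h) m := by
  simp only [res, ← ConcreteCategory.comp_apply, ← Functor.map_comp]
  rfl

lemma res_smul (M : X.Modules) {U V : X.Opens} (h : V ≤ U) (r : Γ(X, U)) (m : Γ(M, U)) :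
    res M h (r • m) = fres h r • res M h m :=
  Scheme.Modules.map_smul M (homOfLE h) r m

lemma app_res {M N : X.Modules} (φ : M ⟶ N) {U V : X.Opens} (h : V ≤ U) (m : Γ(M, U)) :
    φ.app V (res M h m) = res N h (φ.app U m) :=
  congr($(φ.mapPresheaf.naturality (homOfLE h).op) m)

lemma eq_of_res_eq (M : X.Modules) {ι : Type*} {V : X.Opens} (U : ι → X.Opens) (hU : ∀ i, U i ≤ V)
    (hV : V ≤ ⨆ i, U i) (m n : Γ(M, V)) (h : ∀ i, res M (hU i) m = res M (hU i) n) : m = n :=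
  TopCat.Sheaf.eq_of_locally_eq' ⟨M.presheaf, M.isSheaf⟩ U V (fun i => homOfLE (hU i)) hV m n h

lemma exists_glue (M : X.Modules) {ι : Type u} {V : X.Opens} (U : ι → X.Opens) (hU : ∀ i, U i ≤ V)
    (hV : V ≤ ⨆ i, U i) (m : ∀ i, Γ(M, U i))
    (h : ∀ i j, res M inf_le_left (m i) = res M (inf_le_right : U i ⊓ U j ≤ _) (m j)) :
    ∃ n : Γ(M, V), ∀ i, res M (hU i) n = m i :=
  (TopCat.Sheaf.existsUnique_gluing' ⟨M.presheaf, M.isSheaf⟩ U V (fun i => homOfLE (hU i)) hV m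
    h).exists

/-- The sections `s` of `M` over `U` are a basis of `M` over `U`. -/
def IsSectionBasis (M : X.Modules) {U : X.Opens} {ι : Type*} [Fintype ι] (s : ι → Γ(M, U)) :
    Prop :=
  ∀ ⦃V : X.Opens⦄ (h : V ≤ U) (m : Γ(M, V)), ∃! c : ι → Γ(X, V), ∑ j, c j • res M h (s j) = m

lemma IsSectionBasis.eq {M : X.Modules} {U : X.Opens} {ι : Type*} [Fintype ι] {s : ι → Γ(M, U)}
    (hs : IsSectionBasis M s) {V : X.Opens} (h : V ≤ U) {c d : ι → Γ(X, V)}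
    (hcd : ∑ j, c j • res M h (s j) = ∑ j, d j • res M h (s j)) : c = d :=
  (hs h _).unique hcd rfl

lemma res_sum_smul (M : X.Modules) {U V W : X.Opens} {ι : Type*} [Fintype ι] (s : ι → Γ(M, U))
    (h : V ≤ U) (h' : W ≤ V) (c : ι → Γ(X, V)) :
    res M h' (∑ j, c j • res M h (s j)) = ∑ j, fres h' (c j) • res M (h'.trans h) (s j) := by
  rw [res_sum]
  refine Finset.sum_congr rfl fun j _ => ?_
  rw [← res_res M h h', ← res_smul]

lemma app_sum_smul {M N : X.Modules} (φ : M ⟶ N) {U V : X.Opens} {ι : Type*} [Fintype ι]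
    (s : ι → Γ(M, U)) (h : V ≤ U) (c : ι → Γ(X, V)) :
    φ.app V (∑ j, c j • res M h (s j)) = ∑ j, c j • res N h (φ.app U (s j)) := by
  rw [map_sum]
  refine Finset.sum_congr rfl fun j _ => ?_
  rw [Scheme.Modules.Hom.app_smul, app_res]

/-- A morphism of sheaves of modules from a family of additive, linear and natural maps. -/
def homOfSections {M N : X.Modules} (g : ∀ U : X.Opens, Γ(M, U) → Γ(N, U))
    (hadd : ∀ U m n, g U (m + n) = g U m + g U n)
    (hsmul : ∀ U (r : Γ(X, U)) m, g U (r • m) = r • g U m)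
    (hres : ∀ U V (h : V ≤ U) m, g V (res M h m) = res N h (g U m)) : M ⟶ N where
  val := PresheafOfModules.homMk (M₁ := M.val) (M₂ := N.val)
    { app U := AddCommGrpCat.ofHom (X := Γ(M, U.unop)) (Y := Γ(N, U.unop))
        (AddMonoidHom.mk' (g U.unop) (hadd U.unop))
      naturality := fun U V i => by
        ext m
        exact hres U.unop V.unop i.unop.le m }
    (fun U r m => hsmul U.unop r m)

section Pullback
variable (f : X ⟶ Y) {M : Y.Modules} {N P : X.Modules} {I : Type u} {ι : I → Type} [∀ i, Fintype (ι i)]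
  {U : I → Y.Opens} (s : ∀ i, ι i → Γ(M, U i))

/-- The action on sections of a morphism to a push-forward. -/
def pushApp (φ : M ⟶ (pushforward f).obj N) (U : Y.Opens) (m : Γ(M, U)) : Γ(N, f ⁻¹ᵁ U) :=
  φ.app U m

lemma app_pushforward_sum_smul (φ : M ⟶ (pushforward f).obj N) {U V : Y.Opens} {ι : Type}
    [Fintype ι] (s : ι → Γ(M, U)) (h : V ≤ U) (c : ι → Γ(Y, V)) :
    pushApp f φ V (∑ j, c j • res M h (s j)) =
      ∑ j, (f.app V (c j) : Γ(X, f ⁻¹ᵁ V)) • res N (f.preimage_mono h)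
        (pushApp f φ U (s j)) :=
  app_sum_smul φ s h c

/-- Relations between the images of a local basis hold for any other images. -/
lemma sum_smul_eq_of_sum_smul_eq (hs : ∀ i, IsSectionBasis M (s i))
    (ψ : M ⟶ (pushforward f).obj N) (α : M ⟶ (pushforward f).obj P)
    (ht : ∀ i, IsSectionBasis N (U := f ⁻¹ᵁ U i) fun j => pushApp f ψ (U i) (s i j))
    (i k : I) {W : X.Opens} (hi : W ≤ f ⁻¹ᵁ U i) (hk : W ≤ f ⁻¹ᵁ U k)
    (c : ι i → Γ(X, W)) (d : ι k → Γ(X, W))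
    (h : ∑ j, c j • res N hi (pushApp f ψ (U i) (s i j)) =
      ∑ j, d j • res N hk (pushApp f ψ (U k) (s k j))) :
    ∑ j, c j • res P hi (pushApp f α (U i) (s i j)) =
      ∑ j, d j • res P hk (pushApp f α (U k) (s k j)) := by
  have hW : W ≤ f ⁻¹ᵁ (U i ⊓ U k) := le_inf hi hk
  choose a ha using fun l => (hs i (inf_le_left : U i ⊓ U k ≤ U i)
    (res M inf_le_right (s k l))).exists
  -- Over `U i ⊓ U k` the `k`-th basis is expressed in the `i`-th one with coefficients on `Y`. The
  -- pulled-back transition formula holds for every `Q` and `φ`, so it turns equality of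
  -- combinations in `N` into equality of combinations in `P`.
  have key : ∀ (Q : X.Modules) (φ : M ⟶ (pushforward f).obj Q),
      ∑ j, d j • res Q hk (pushApp f φ (U k) (s k j)) =
      ∑ j, (∑ l, d l * fres hW (f.app _ (a l j))) •
        res Q hi (pushApp f φ (U i) (s i j)) := by
    intro Q φ
    have h1 : ∀ l, res Q hk (pushApp f φ (U k) (s k l)) =
        ∑ j, fres hW (f.app _ (a l j)) • res Q hi (pushApp f φ (U i) (s i j)) := by
      intro l
      have h2 := congrArg (res Q hW) (app_pushforward_sum_smul f φ (s i) inf_le_left (a l))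
      rw [ha l, res_sum_smul] at h2
      rw [← h2]
      refine Eq.trans ?_ (congrArg (res Q hW) (app_res φ _ _)).symm
      exact (res_res Q _ _ _).symm
    simp only [h1, Finset.smul_sum, Finset.sum_smul, mul_smul]
    exact Finset.sum_comm
  rw [key P α]
  rw [key N ψ] at h
  rw [(ht i).eq hi h]

variable (N) in
/-- `n` and `p` have the same coordinates with respect to the images of the local bases. -/
def SameCoords (ψ : M ⟶ (pushforward f).obj N) (α : M ⟶ (pushforward f).obj P)
    (V : X.Opens) (n : Γ(N, V)) (p : Γ(P, V)) : Prop :=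
  ∀ (i : I) (W : X.Opens) (hW : W ≤ V) (hi : W ≤ f ⁻¹ᵁ U i) (c : ι i → Γ(X, W)),
    res N hW n = ∑ j, c j • res N hi (pushApp f ψ (U i) (s i j)) →
    res P hW p = ∑ j, c j • res P hi (pushApp f α (U i) (s i j))

/-- The coordinates of `n` exist on each `V ⊓ f ⁻¹ᵁ U i`. The combinations with these coordinates in
`P` agree on overlaps by `sum_smul_eq_of_sum_smul_eq`, hence glue, and the cover leaves no other
choice. This is the universal property of the pull-back at the level of sections. -/
lemma existsUnique_sameCoords (hU : ⨆ i, U i = ⊤) (hs : ∀ i, IsSectionBasis M (s i))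
    (ψ : M ⟶ (pushforward f).obj N) (α : M ⟶ (pushforward f).obj P)
    (ht : ∀ i, IsSectionBasis N (U := f ⁻¹ᵁ U i) fun j => pushApp f ψ (U i) (s i j))
    (V : X.Opens) (n : Γ(N, V)) : ∃! p, SameCoords f N s ψ α V n p := by
  have hV : V ≤ ⨆ i, V ⊓ f ⁻¹ᵁ U i := by
    rw [← inf_iSup_eq, ← Scheme.Hom.preimage_iSup, hU]
    exact le_inf le_rfl le_top
  choose c hc using fun i => (ht i (inf_le_right : V ⊓ f ⁻¹ᵁ U i ≤ _) (res N inf_le_left n)).exists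
  refine existsUnique_of_exists_of_unique ?_ fun p q hp hq => ?_
  · obtain ⟨p, hp⟩ := exists_glue P (fun i => V ⊓ f ⁻¹ᵁ U i) (fun i => inf_le_left) hV
      (fun i => ∑ j, c i j • res P inf_le_right (pushApp f α (U i) (s i j))) (by
        intro i k
        rw [res_sum_smul, res_sum_smul]
        refine sum_smul_eq_of_sum_smul_eq f s hs ψ α ht i k _ _ _ _ ?_
        have e1 := congrArg (res N (inf_le_left : _ ⊓ (V ⊓ f ⁻¹ᵁ U k) ≤ _)) (hc i)
        have e2 := congrArg (res N (inf_le_right : (V ⊓ f ⁻¹ᵁ U i) ⊓ _ ≤ _)) (hc k)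
        rw [res_sum_smul, res_res] at e1 e2
        exact e1.trans e2.symm)
    refine ⟨p, fun i W hW hi d hd => ?_⟩
    have h1 := congrArg (res P (le_inf hW hi)) (hp i)
    have h2 := congrArg (res N (le_inf hW hi)) (hc i)
    rw [res_sum_smul, res_res] at h1 h2
    rw [h1]
    refine sum_smul_eq_of_sum_smul_eq f s hs ψ α ht i i _ _ _ _ ?_
    exact h2.trans hd
  · refine eq_of_res_eq P (fun i => V ⊓ f ⁻¹ᵁ U i) (fun i => inf_le_left) hV _ _ fun i => ?_
    rw [hp i _ inf_le_left inf_le_right (c i) (hc i).symm,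
      hq i _ inf_le_left inf_le_right (c i) (hc i).symm]

/-- A morphism `M ⟶ f_* N` which maps local bases of `M` to local bases of `N` exhibits `N` as the
pull-back of `M`. -/
theorem isIso_pullback_of_isSectionBasis (hU : ⨆ i, U i = ⊤) (hs : ∀ i, IsSectionBasis M (s i))
    (ψ : M ⟶ (pushforward f).obj N)
    (ht : ∀ i, IsSectionBasis N (U := f ⁻¹ᵁ U i) fun j => pushApp f ψ (U i) (s i j)) :
    IsIso (((pullbackPushforwardAdjunction f).homEquiv M N).symm ψ) := by
  refine isIso_of_coyoneda_map_bijective _ fun P => ?_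
  have H : Function.Bijective fun g : N ⟶ P => ψ ≫ (pushforward f).map g := by
    refine ⟨fun g g' h => ?_, fun α => ?_⟩
    · ext V n
      obtain ⟨p, hp, hp'⟩ := existsUnique_sameCoords f s hU hs ψ (ψ ≫ (pushforward f).map g) ht V n
      -- Injectivity: a morphism `k` is recovered from `ψ ≫ f_* k`, because `k n` has the
      -- coordinates of `n` with respect to the images of the basis.
      have key : ∀ k : N ⟶ P, SameCoords f N s ψ (ψ ≫ (pushforward f).map k) V n (k.app V n) := by
        intro k i W hW hi c hc
        rw [← app_res, hc]
        exact app_sum_smul k _ hi c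
      dsimp only at h
      have h1 := hp' _ (key g)
      have h2 := hp' _ (h ▸ key g')
      rw [h1, h2]
    -- Surjectivity: the preimage of `α` sends `n` to the unique section of `P` with the same
    -- coordinates. Additivity and linearity are checked in coordinates on the cover, compatibility
    -- with restriction by uniqueness.
    · choose g hg hg' using existsUnique_sameCoords f s hU hs ψ α ht
      refine ⟨homOfSections g ?_ ?_ ?_, ?_⟩
      · intro V m n
        have hV : V ≤ ⨆ i, V ⊓ f ⁻¹ᵁ U i := by
          rw [← inf_iSup_eq, ← Scheme.Hom.preimage_iSup, hU]
          exact le_inf le_rfl le_top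
        refine eq_of_res_eq P (fun i => V ⊓ f ⁻¹ᵁ U i) (fun i => inf_le_left) hV _ _ fun i => ?_
        obtain ⟨c, hc, -⟩ := ht i (inf_le_right : V ⊓ f ⁻¹ᵁ U i ≤ _) (res N inf_le_left m)
        obtain ⟨d, hd, -⟩ := ht i (inf_le_right : V ⊓ f ⁻¹ᵁ U i ≤ _) (res N inf_le_left n)
        have e1 := hg V m i _ inf_le_left inf_le_right c hc.symm
        have e2 := hg V n i _ inf_le_left inf_le_right d hd.symm
        have e3 := hg V (m + n) i _ inf_le_left inf_le_right (fun j => c j + d j) (by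
          rw [res_add, ← hc, ← hd, ← Finset.sum_add_distrib]
          simp only [add_smul])
        rw [e3, res_add, e1, e2, ← Finset.sum_add_distrib]
        simp only [add_smul]
      · intro V r m
        have hV : V ≤ ⨆ i, V ⊓ f ⁻¹ᵁ U i := by
          rw [← inf_iSup_eq, ← Scheme.Hom.preimage_iSup, hU]
          exact le_inf le_rfl le_top
        refine eq_of_res_eq P (fun i => V ⊓ f ⁻¹ᵁ U i) (fun i => inf_le_left) hV _ _ fun i => ?_
        obtain ⟨c, hc, -⟩ := ht i (inf_le_right : V ⊓ f ⁻¹ᵁ U i ≤ _) (res N inf_le_left m)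
        have e1 := hg V m i _ inf_le_left inf_le_right c hc.symm
        have e3 := hg V (r • m) i _ inf_le_left inf_le_right
          (fun j => fres inf_le_left r * c j) (by
            rw [res_smul, ← hc, Finset.smul_sum]
            simp only [mul_smul])
        rw [e3, res_smul, e1, Finset.smul_sum]
        simp only [mul_smul]
      · intro V W h m
        symm
        refine hg' W _ _ fun i W' hW hi c hc => ?_
        rw [res_res] at hc ⊢
        exact hg V m i W' _ hi c hc
      · ext V m
        change g (f ⁻¹ᵁ V) (pushApp f ψ V m) = pushApp f α V m
        symm
        refine hg' _ _ _ fun i W hW hi c hc => ?_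
        have hW' : W ≤ f ⁻¹ᵁ (V ⊓ U i) := le_inf hW hi
        obtain ⟨d, hd, -⟩ := hs i (inf_le_right : V ⊓ U i ≤ _) (res M inf_le_left m)
        have key : ∀ (Q : X.Modules) (φ : M ⟶ (pushforward f).obj Q),
            res Q hW (pushApp f φ V m) = ∑ j, fres hW' (f.app _ (d j)) •
              res Q hi (pushApp f φ (U i) (s i j)) := by
          intro Q φ
          have h2 := congrArg (res Q hW') (app_pushforward_sum_smul f φ (s i) inf_le_right d)
          rw [hd, res_sum_smul] at h2
          rw [← h2]
          refine Eq.trans ?_ (congrArg (res Q hW') (app_res φ _ _)).symm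
          exact (res_res Q _ _ _).symm
        rw [key P α]
        refine sum_smul_eq_of_sum_smul_eq f s hs ψ α ht i i hi hi _ _ ?_
        rw [← key N ψ]
        exact hc
  have e : (fun g : N ⟶ P => ((pullbackPushforwardAdjunction f).homEquiv M N).symm ψ ≫ g) =
      ((pullbackPushforwardAdjunction f).homEquiv M P).symm ∘
        fun g : N ⟶ P => ψ ≫ (pushforward f).map g := by
    funext g
    exact ((pullbackPushforwardAdjunction f).homEquiv_naturality_right_symm ψ g).symm
  rw [e]
  exact (Equiv.bijective _).comp H

end Pullback

end SectionBasis

/-! ### Sections of `𝒪(n)` as families of homogeneous fractions. -/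

section TwistSections
variable {A σ : Type u} [CommRing A] [SetLike σ A] [AddSubgroupClass σ A]
variable (𝒜 : ℕ → σ) [GradedRing 𝒜]

variable {𝒜} in
/-- The value of a section of `𝒪(n)` at a point. -/
def twistVal {n : ℤ} {U : (Proj 𝒜).Opens} (f : Γ(twist 𝒜 n, U)) (x : ProjectiveSpectrum 𝒜)
    (hx : x ∈ U) : LocAt 𝒜 x :=
  (show twistSections 𝒜 n U from f).1 ⟨x, hx⟩

variable {𝒜} in
/-- The value of a regular function at a point. -/
def funVal {U : (Proj 𝒜).Opens} (r : Γ(Proj 𝒜, U)) (x : ProjectiveSpectrum 𝒜)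
    (hx : x ∈ U) : LocAt 𝒜 x :=
  ((show (ProjectiveSpectrum.Proj.structureSheaf 𝒜).1.obj (op U) from r).1 ⟨x, hx⟩).val

variable {𝒜}
variable {n m : ℤ} {U V : (Proj 𝒜).Opens}

lemma mem_of_le {U V : (Proj 𝒜).Opens} (h : V ≤ U) {x : ProjectiveSpectrum 𝒜} (hx : x ∈ V) :
    x ∈ U := h hx

lemma notMem_of_mem_basicOpen {g : A} {x : ProjectiveSpectrum 𝒜} (hx : x ∈ Proj.basicOpen 𝒜 g) :
    g ∉ x.asHomogeneousIdeal.toIdeal := hx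

lemma twistVal_ext {f g : Γ(twist 𝒜 n, U)} (h : ∀ x hx, twistVal f x hx = twistVal g x hx) :
    f = g :=
  Subtype.ext (funext fun x => h x.1 x.2)

lemma funVal_ext {f g : Γ(Proj 𝒜, U)} (h : ∀ x hx, funVal f x hx = funVal g x hx) : f = g :=
  Subtype.ext (funext fun x => HomogeneousLocalization.val_injective _ (h x.1 x.2))

/-- Evaluation of sections as a homomorphism. -/
def twistValHom (x : ProjectiveSpectrum 𝒜) (hx : x ∈ U) : Γ(twist 𝒜 n, U) →+ LocAt 𝒜 x :=
  AddMonoidHom.mk' (twistVal · x hx) fun _ _ => rfl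

lemma twistVal_sum {ι : Type*} (t : Finset ι) (f : ι → Γ(twist 𝒜 n, U)) (x hx) :
    twistVal (∑ i ∈ t, f i) x hx = ∑ i ∈ t, twistVal (f i) x hx :=
  map_sum (twistValHom x hx) f t

lemma twistVal_smul (r : Γ(Proj 𝒜, U)) (f : Γ(twist 𝒜 n, U)) (x hx) :
    twistVal (r • f) x hx = funVal r x hx * twistVal f x hx := rfl

lemma twistVal_res (h : V ≤ U) (f : Γ(twist 𝒜 n, U)) (x hx) :
    twistVal (res _ h f) x hx = twistVal f x (mem_of_le h hx) := rfl

lemma twistVal_twistMul {k : ℕ} (h : n = m + k) {g : A} (hg : g ∈ 𝒜 k)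
    (f : Γ(twist 𝒜 m, U)) (x hx) :
    twistVal ((twistMul 𝒜 h hg).app U f) x hx = algebraMap A _ g * twistVal f x hx := rfl

lemma exists_twistVal_eq (f : ∀ x : ProjectiveSpectrum 𝒜, x ∈ U → LocAt 𝒜 x)
    (h : (isLocallyTwistFraction 𝒜 n).pred fun x : U => f x.1 x.2) :
    ∃ s : Γ(twist 𝒜 n, U), ∀ x hx, twistVal s x hx = f x hx :=
  ⟨(⟨fun x => f x.1 x.2, h⟩ : twistSections 𝒜 n U), fun _ _ => rfl⟩

/-- In degree zero the numerator and the denominator have equal degree, so each value lies in the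
homogeneous localization. Since that embeds in the full localization, the local fractions for `f`
also represent the family of lifted values. -/
lemma exists_funVal_eq (f : Γ(twist 𝒜 0, U)) :
    ∃ r : Γ(Proj 𝒜, U), ∀ x hx, funVal r x hx = twistVal f x hx := by
  have h0 : ∀ (x : ProjectiveSpectrum 𝒜) (hx : x ∈ U),
      ∃ z : HomogeneousLocalization.AtPrime 𝒜 x.asHomogeneousIdeal.toIdeal,
        z.val = twistVal f x hx := by
    intro x hx
    obtain ⟨V, hV, iV, a, b, hab, r, s, hr, hs, hx, h⟩ := (show twistSections 𝒜 0 U from f).2 ⟨x, hx⟩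
    obtain rfl : a = b := by omega
    exact ⟨.mk ⟨a, ⟨r, hr⟩, ⟨s, hs⟩, hx ⟨x, hV⟩⟩, (h ⟨x, hV⟩).symm⟩
  choose z hz using h0
  refine ⟨(⟨fun x => z x.1 x.2, fun x => ?_⟩ : (ProjectiveSpectrum.Proj.structureSheaf 𝒜).1.obj (op U)),
    fun x hx => hz x hx⟩
  obtain ⟨V, hV, iV, a, b, hab, r, s, hr, hs, hx, h⟩ := (show twistSections 𝒜 0 U from f).2 x
  obtain rfl : a = b := by omega
  refine ⟨V, hV, iV, a, ⟨r, hr⟩, ⟨s, hs⟩, hx, fun y => HomogeneousLocalization.val_injective _ ?_⟩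
  exact (hz _ _).trans (h y)

lemma exists_twistVal_mul (f : Γ(twist 𝒜 n, U)) (g : Γ(twist 𝒜 m, U)) :
    ∃ r : Γ(twist 𝒜 (n + m), U), ∀ x hx, twistVal r x hx = twistVal f x hx * twistVal g x hx := by
  refine exists_twistVal_eq (fun x hx => twistVal f x hx * twistVal g x hx) fun x => ?_
  obtain ⟨V, hV, iV, a, b, hab, r, s, hr, hs, hx, h⟩ := (show twistSections 𝒜 n U from f).2 x
  obtain ⟨V', hV', iV', a', b', hab', r', s', hr', hs', hx', h'⟩ :=
    (show twistSections 𝒜 m U from g).2 x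
  refine ⟨V ⊓ V', ⟨hV, hV'⟩, Opens.infLELeft _ _ ≫ iV, a + a', b + b', by push_cast; omega,
      r * r', s * s', SetLike.mul_mem_graded hr hr', SetLike.mul_mem_graded hs hs',
      fun y => mul_mem (hx ⟨y.1, y.2.1⟩) (hx' ⟨y.1, y.2.2⟩), fun y => ?_⟩
  exact (congrArg₂ (· * ·) (h ⟨y.1, y.2.1⟩) (h' ⟨y.1, y.2.2⟩)).trans (Localization.mk_mul _ _ _ _)

/-- The integral power `g ^ n` as an element of the localization at a point where `g ≠ 0`. -/
def locPow (x : ProjectiveSpectrum 𝒜) (g : A) (hg : g ∉ x.asHomogeneousIdeal.toIdeal) (n : ℤ) :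
    LocAt 𝒜 x :=
  ((IsLocalization.map_units (LocAt 𝒜 x)
    (⟨g, hg⟩ : x.asHomogeneousIdeal.toIdeal.primeCompl)).unit ^ n : (LocAt 𝒜 x)ˣ)

section locPow
variable {x : ProjectiveSpectrum 𝒜} {g : A} (hg : g ∉ x.asHomogeneousIdeal.toIdeal)

lemma locPow_add (n m : ℤ) : locPow x g hg (n + m) = locPow x g hg n * locPow x g hg m := by
  simp [locPow, zpow_add]

lemma locPow_zero : locPow x g hg 0 = 1 := by simp [locPow]

lemma locPow_natCast (k : ℕ) : locPow x g hg k = algebraMap A _ (g ^ k) := by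
  simp [locPow]

lemma locPow_mul_neg (n : ℤ) : locPow x g hg n * locPow x g hg (-n) = 1 := by
  rw [← locPow_add, add_neg_cancel, locPow_zero]

lemma locPow_neg_mul (n : ℤ) : locPow x g hg (-n) * locPow x g hg n = 1 := by
  rw [← locPow_add, neg_add_cancel, locPow_zero]

lemma isUnit_locPow (n : ℤ) : IsUnit (locPow x g hg n) := Units.isUnit _

/-- One of `n.toNat` and `(-n).toNat` is zero, so positive and negative powers are covered by the
same fraction. This is the shape required by `IsTwistFraction`. -/
lemma locPow_eq_mk (n : ℤ) : locPow x g hg n =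
    Localization.mk (g ^ n.toNat) (⟨g, hg⟩ ^ (-n).toNat : x.asHomogeneousIdeal.toIdeal.primeCompl) := by
  rw [Localization.mk_eq_mk', eq_comm, IsLocalization.mk'_eq_iff_eq_mul]
  have : ((⟨g, hg⟩ ^ (-n).toNat : x.asHomogeneousIdeal.toIdeal.primeCompl) : A) = g ^ (-n).toNat :=
    rfl
  rw [this, ← locPow_natCast hg, ← locPow_natCast hg, ← locPow_add]
  congr 1
  omega

end locPow

lemma exists_twistVal_eq_locPow {g : A} (hg : g ∈ 𝒜 1) (n : ℤ) :
    ∃ s : Γ(twist 𝒜 n, Proj.basicOpen 𝒜 g), ∀ x hx, twistVal s x hx = locPow x g (notMem_of_mem_basicOpen hx) n := by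
  refine exists_twistVal_eq (fun x hx => locPow x g (notMem_of_mem_basicOpen hx) n) fun x => ?_
  refine ⟨Proj.basicOpen 𝒜 g, x.2, 𝟙 _, n.toNat, (-n).toNat, by omega, g ^ n.toNat, g ^ (-n).toNat,
    ?_, ?_, fun y => pow_mem (S := y.1.asHomogeneousIdeal.toIdeal.primeCompl) y.2 _, fun y => ?_⟩
  · simpa using SetLike.pow_mem_graded n.toNat hg
  · simpa using SetLike.pow_mem_graded (-n).toNat hg
  · exact locPow_eq_mk _ _

/-- The section `g ^ n` of `𝒪(n)` over the open set `g ≠ 0`. -/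
def powSection {g : A} (hg : g ∈ 𝒜 1) (n : ℤ) : Γ(twist 𝒜 n, Proj.basicOpen 𝒜 g) :=
  (exists_twistVal_eq_locPow hg n).choose

lemma twistVal_powSection {g : A} (hg : g ∈ 𝒜 1) (n : ℤ) (x hx) :
    twistVal (powSection hg n) x hx = locPow x g (notMem_of_mem_basicOpen hx) n :=
  (exists_twistVal_eq_locPow hg n).choose_spec x hx

lemma exists_funVal_eq_mul_locPow {g : A} (hg : g ∈ 𝒜 1) (h : U ≤ Proj.basicOpen 𝒜 g)
    (f : Γ(twist 𝒜 n, U)) :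
    ∃ r : Γ(Proj 𝒜, U), ∀ x hx, funVal r x hx = twistVal f x hx * locPow x g (notMem_of_mem_basicOpen (mem_of_le h hx)) (-n) := by
  obtain ⟨s, hs⟩ := exists_twistVal_mul f (res _ h (powSection hg (-n)))
  -- The degree `n + -n` must be rewritten to `0` in the type of `s`, so `s` is generalized first.
  obtain ⟨r, hr⟩ : ∃ r : Γ(Proj 𝒜, U), ∀ x hx, funVal r x hx = twistVal s x hx := by
    revert s
    rw [add_neg_cancel]
    exact fun s _ => exists_funVal_eq s
  refine ⟨r, fun x hx => ?_⟩
  rw [hr, hs, twistVal_res, twistVal_powSection]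

/-- As `g` is invertible on this open set, the coefficient of `m` can only be `m * g ^ (-n)`, which
has degree zero and is therefore a regular function. -/
lemma isSectionBasis_powSection {g : A} (hg : g ∈ 𝒜 1) (n : ℤ) :
    IsSectionBasis (twist 𝒜 n) fun _ : Fin 1 => powSection hg n := by
  intro V h m
  obtain ⟨r, hr⟩ := exists_funVal_eq_mul_locPow hg h m
  refine ⟨fun _ => r, ?_, fun c hc => ?_⟩
  · refine twistVal_ext fun x hx => ?_
    simp only [Finset.univ_unique, Fin.default_eq_zero, Finset.sum_const, Finset.card_singleton,
      one_smul]
    rw [twistVal_smul, twistVal_res, twistVal_powSection, hr, mul_assoc, locPow_neg_mul,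
      mul_one]
  · funext i
    refine funVal_ext fun x hx => ?_
    rw [hr, ← hc, Subsingleton.elim i 0]
    simp only [Finset.univ_unique, Fin.default_eq_zero, Finset.sum_singleton]
    rw [twistVal_smul, twistVal_res, twistVal_powSection, mul_assoc, locPow_mul_neg, mul_one]

end TwistSections

/-! ### Sections of kernels. -/

section Kernel
variable {X : Scheme.{u}}

/-- The functor of sections over `U`. -/
def sectionsFunctor (U : X.Opens) : X.Modules ⥤ AddCommGrpCat.{u} :=
  toPresheaf X ⋙ (evaluation _ _).obj (op U)

instance (U : X.Opens) : Limits.PreservesLimits (sectionsFunctor U) :=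
  have : Limits.PreservesLimits ((evaluation (Opens X)ᵒᵖ Ab.{u}).obj (op U)) := inferInstance
  Limits.comp_preservesLimits (toPresheaf X) ((evaluation (Opens X)ᵒᵖ Ab.{u}).obj (op U))

lemma app_injective_of_mono {M N : X.Modules} (φ : M ⟶ N) [Mono φ] (U : X.Opens) :
    Function.Injective (φ.app U) := by
  have : Mono ((sectionsFunctor U).map φ) := inferInstance
  exact (AddCommGrpCat.mono_iff_injective _).mp this

instance (U : X.Opens) : (sectionsFunctor U).PreservesZeroMorphisms where
  map_zero _ _ := rfl

/-- Sections over an open set commute with limits, so exactness at the source of `φ` survives. -/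
lemma exists_kernel_section {M N : X.Modules} (φ : M ⟶ N) (U : X.Opens) (m : Γ(M, U))
    (h : φ.app U m = 0) : ∃ k : Γ(Limits.kernel φ, U), (Limits.kernel.ι φ).app U k = m := by
  let S := ShortComplex.mk (Limits.kernel.ι φ) φ (Limits.kernel.condition φ)
  have hS : S.Exact := ShortComplex.exact_kernel φ
  have : Mono S.f := inferInstanceAs (Mono (Limits.kernel.ι φ))
  have h2 := hS.map_of_mono_of_preservesKernel (sectionsFunctor U) inferInstance inferInstance
  exact (ShortComplex.ab_exact_iff _).mp h2 m h

lemma sum_app {M N : X.Modules} {ι : Type*} (t : Finset ι) (φ : ι → (M ⟶ N)) (U : X.Opens)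
    (m : Γ(M, U)) : (∑ i ∈ t, φ i).app U m = ∑ i ∈ t, (φ i).app U m := by
  classical
  induction t using Finset.induction_on with
  | empty => simp
  | insert i t hi ih =>
    rw [Finset.sum_insert hi, Finset.sum_insert hi, ← ih]
    rfl

end Kernel

/-! ### Syzygy sheaves in components, and their Koszul bases. -/

section SyzSections
variable {A σ : Type u} [CommRing A] [SetLike σ A] [AddSubgroupClass σ A]
variable (𝒜 : ℕ → σ) [GradedRing 𝒜]

section General
variable {ι : Type} [Fintype ι] {c : ℕ} (f : ι → A) (hf : ∀ i, f i ∈ 𝒜 c) (m : ℤ)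
variable {U V : (Proj 𝒜).Opens}

lemma syz_ext {s t : Γ(syz 𝒜 f hf m, U)}
    (h : ∀ i, (syzι 𝒜 f hf m i).app U s = (syzι 𝒜 f hf m i).app U t) : s = t := by
  classical
  refine app_injective_of_mono (Limits.kernel.ι (Limits.biproduct.desc
    (f := fun _ : ι => twist 𝒜 (m - c))
    fun i => twistMul 𝒜 (m := m - c) (n := m) (by ring) (hf i))) U ?_
  have key : ∀ z : Γ((Limits.biproduct fun _ : ι => twist 𝒜 (m - c)), U), z = ∑ i : ι,
      (Limits.biproduct.ι (fun _ : ι => twist 𝒜 (m - c)) i).app U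
        ((Limits.biproduct.π (fun _ : ι => twist 𝒜 (m - c)) i).app U z) := by
    intro z
    have h1 := sum_app Finset.univ (fun i => Limits.biproduct.π (fun _ : ι => twist 𝒜 (m - c)) i ≫
      Limits.biproduct.ι (fun _ : ι => twist 𝒜 (m - c)) i) U z
    rw [Limits.biproduct.total] at h1
    exact h1
  refine (key _).trans (Eq.trans ?_ (key _).symm)
  refine Finset.sum_congr rfl fun i _ => ?_
  congr 1
  exact h i

/-- Together with `syz_ext` and `syzVal_rel` this identifies sections of the abstract kernel with
tuples satisfying the pointwise relation. Later arguments use only this description. -/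
lemma exists_syz (t : ι → Γ(twist 𝒜 (m - c), U))
    (h : ∀ x hx, ∑ i, algebraMap A (LocAt 𝒜 x) (f i) * twistVal (t i) x hx = 0) :
    ∃ s : Γ(syz 𝒜 f hf m, U), ∀ i, (syzι 𝒜 f hf m i).app U s = t i := by
  classical
  let z : Γ((Limits.biproduct fun _ : ι => twist 𝒜 (m - c)), U) := ∑ i : ι,
      (Limits.biproduct.ι (fun _ : ι => twist 𝒜 (m - c)) i).app U (t i)
  obtain ⟨s, hs⟩ := exists_kernel_section (Limits.biproduct.desc
    (f := fun _ : ι => twist 𝒜 (m - c))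
    fun i => twistMul 𝒜 (m := m - c) (n := m) (by ring) (hf i)) U z (by
      rw [map_sum]
      refine twistVal_ext fun x hx => ?_
      rw [twistVal_sum]
      refine Eq.trans (Finset.sum_congr rfl fun i _ => ?_) (h x hx)
      rw [← ConcreteCategory.comp_apply, ← Hom.comp_app, Limits.biproduct.ι_desc]
      rfl)
  refine ⟨s, fun i => ?_⟩
  refine (congrArg (Hom.app (Limits.biproduct.π (fun _ : ι => twist 𝒜 (m - c)) i) U) hs).trans ?_
  rw [map_sum, Finset.sum_eq_single i]
  · rw [← ConcreteCategory.comp_apply, ← Hom.comp_app, Limits.biproduct.ι_π_self]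
    rfl
  · intro j _ hj
    rw [← ConcreteCategory.comp_apply, ← Hom.comp_app, Limits.biproduct.ι_π_ne _ hj]
    rfl
  · simp

/-- The value at a point of the `i`-th component of a section of the syzygy sheaf. -/
def syzVal (s : Γ(syz 𝒜 f hf m, U)) (i : ι) (x : ProjectiveSpectrum 𝒜) (hx : x ∈ U) : LocAt 𝒜 x :=
  twistVal ((syzι 𝒜 f hf m i).app U s) x hx

variable {f hf m} {𝒜}

lemma syzVal_ext {s t : Γ(syz 𝒜 f hf m, U)}
    (h : ∀ i x hx, syzVal 𝒜 f hf m s i x hx = syzVal 𝒜 f hf m t i x hx) : s = t :=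
  syz_ext 𝒜 f hf m fun i => twistVal_ext (h i)

lemma syzVal_rel (s : Γ(syz 𝒜 f hf m, U)) (x : ProjectiveSpectrum 𝒜) (hx : x ∈ U) :
    ∑ i, algebraMap A (LocAt 𝒜 x) (f i) * syzVal 𝒜 f hf m s i x hx = 0 := by
  classical
  have h1 : (Limits.kernel.ι (Limits.biproduct.desc
    (f := fun _ : ι => twist 𝒜 (m - c))
    fun i => twistMul 𝒜 (m := m - c) (n := m) (by ring) (hf i)) ≫ (∑ i,
      Limits.biproduct.π (fun _ : ι => twist 𝒜 (m - c)) i ≫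
        twistMul 𝒜 (m := m - c) (n := m) (by ring) (hf i))).app U s = 0 := by
    rw [← Limits.biproduct.desc_eq, Limits.kernel.condition]
    rfl
  have h2 := congrArg (twistVal · x hx) ((sum_app Finset.univ (fun i =>
    Limits.biproduct.π (fun _ : ι => twist 𝒜 (m - c)) i ≫
      twistMul 𝒜 (m := m - c) (n := m) (by ring) (hf i)) U ((Limits.kernel.ι (Limits.biproduct.desc
    (f := fun _ : ι => twist 𝒜 (m - c))
    fun i => twistMul 𝒜 (m := m - c) (n := m) (by ring) (hf i))).app U s)).symm.trans h1)
  simp only [twistVal_sum] at h2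
  exact h2

lemma syzVal_add (s t : Γ(syz 𝒜 f hf m, U)) (i x hx) :
    syzVal 𝒜 f hf m (s + t) i x hx = syzVal 𝒜 f hf m s i x hx + syzVal 𝒜 f hf m t i x hx := by
  rw [syzVal, map_add]; rfl

lemma syzVal_sum {κ : Type*} (t : Finset κ) (s : κ → Γ(syz 𝒜 f hf m, U)) (i x hx) :
    syzVal 𝒜 f hf m (∑ k ∈ t, s k) i x hx = ∑ k ∈ t, syzVal 𝒜 f hf m (s k) i x hx := by
  rw [syzVal, map_sum, twistVal_sum]; rfl

lemma syzVal_smul (r : Γ(Proj 𝒜, U)) (s : Γ(syz 𝒜 f hf m, U)) (i x hx) :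
    syzVal 𝒜 f hf m (r • s) i x hx = funVal r x hx * syzVal 𝒜 f hf m s i x hx := by
  rw [syzVal, Hom.app_smul]; rfl

lemma syzVal_res (h : V ≤ U) (s : Γ(syz 𝒜 f hf m, U)) (i x hx) :
    syzVal 𝒜 f hf m (res _ h s) i x hx = syzVal 𝒜 f hf m s i x (mem_of_le h hx) := by
  rw [syzVal, app_res]; rfl

end General

section Koszul
variable {c : ℕ} (f : Fin 3 → A) (hf : ∀ i, f i ∈ 𝒜 c) (m : ℤ) (x : Fin 3 → A)
  (hx : ∀ i, x i ∈ 𝒜 1)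
variable {U V : (Proj 𝒜).Opens}

/-- The components of the Koszul syzygies of `f` with respect to `f i = x i ^ c`, divided by a
power of `x i`. -/
def koszulVal (i : Fin 3) (j : Fin 2) (k : Fin 3) (y : ProjectiveSpectrum 𝒜)
    (hy : x i ∉ y.asHomogeneousIdeal.toIdeal) : LocAt 𝒜 y :=
  if k = i then - (algebraMap A _ (f (i.succAbove j)) * locPow y (x i) hy (m - c - c)) else
    if k = i.succAbove j then locPow y (x i) hy (m - c) else 0

variable {x}

include hx in
-- With `l = i.succAbove j`, the Koszul relation `f i * e_l - f l * e_i` is multiplied by `x i ^ (m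
-- - 2c)`. Because `f i = x i ^ c`, the entry at `l` becomes the unit `x i ^ (m - c)`, and the
-- degrees are those of `𝒪(m - c)`.
lemma exists_koszul (hfx : ∀ i, f i = x i ^ c) (i : Fin 3) (j : Fin 2) :
    ∃ s : Γ(syz 𝒜 f hf m, Proj.basicOpen 𝒜 (x i)), ∀ k y hy,
      syzVal 𝒜 f hf m s k y hy = koszulVal 𝒜 (c := c) f m x i j k y (notMem_of_mem_basicOpen hy) := by
  let t : Fin 3 → Γ(twist 𝒜 (m - c), Proj.basicOpen 𝒜 (x i)) := fun k =>
    if k = i then - (twistMul 𝒜 (m := m - c - c) (by ring) (hf (i.succAbove j))).app _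
      (powSection (hx i) (m - c - c)) else
    if k = i.succAbove j then powSection (hx i) (m - c) else 0
  have ht : ∀ k y hy, twistVal (t k) y hy =
      koszulVal 𝒜 (c := c) f m x i j k y (notMem_of_mem_basicOpen hy) := by
    intro k y hy
    simp only [t, koszulVal]
    split_ifs with h1 h2
    · change - twistVal _ y hy = _
      rw [twistVal_twistMul, twistVal_powSection]
    · rw [twistVal_powSection]
    · rfl
  obtain ⟨s, hs⟩ := exists_syz 𝒜 f hf m t (by
    intro y hy
    rw [Fin.sum_univ_succAbove _ i, Finset.sum_eq_single j]
    · rw [ht, ht, koszulVal, koszulVal, if_pos rfl, if_neg (i.succAbove_ne j), if_pos rfl]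
      have h1 : m - c = (c : ℤ) + (m - c - c) := by ring
      have h2 : locPow y (x i) (notMem_of_mem_basicOpen hy) (m - c) = algebraMap A _ (f i) *
          locPow y (x i) (notMem_of_mem_basicOpen hy) (m - c - c) := by
        conv_lhs => rw [h1]
        rw [locPow_add, locPow_natCast, hfx i]
      rw [h2]
      ring
    · intro k _ hk
      rw [ht, koszulVal, if_neg (i.succAbove_ne k),
        if_neg (fun h => hk (Fin.succAbove_right_injective h)), mul_zero]
    · simp)
  refine ⟨s, fun k y hy => ?_⟩
  rw [← ht, ← hs]
  rfl

/-- The Koszul syzygies as sections over `x i ≠ 0`. -/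
def koszul (hfx : ∀ i, f i = x i ^ c) (i : Fin 3) (j : Fin 2) :
    Γ(syz 𝒜 f hf m, Proj.basicOpen 𝒜 (x i)) :=
  (exists_koszul 𝒜 f hf m hx hfx i j).choose

lemma syzVal_koszul (hfx : ∀ i, f i = x i ^ c) (i : Fin 3) (j : Fin 2) (k y hy) :
    syzVal 𝒜 f hf m (koszul 𝒜 f hf m hx hfx i j) k y hy =
      koszulVal 𝒜 (c := c) f m x i j k y (notMem_of_mem_basicOpen hy) :=
  (exists_koszul 𝒜 f hf m hx hfx i j).choose_spec k y hy

lemma koszulVal_self (i : Fin 3) (j : Fin 2) (y hy) :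
    koszulVal 𝒜 (c := c) f m x i j i y hy =
      - (algebraMap A _ (f (i.succAbove j)) * locPow y (x i) hy (m - c - c)) := if_pos rfl

lemma koszulVal_succAbove (i : Fin 3) (j l : Fin 2) (y hy) :
    koszulVal 𝒜 (c := c) f m x i j (i.succAbove l) y hy =
      if l = j then locPow y (x i) hy (m - c) else 0 := by
  rw [koszulVal, if_neg (i.succAbove_ne l)]
  simp only [Fin.succAbove_right_inj]

/-- A syzygy is determined by all components but one. -/
lemma syzVal_eq_of_succAbove {s t : Γ(syz 𝒜 f hf m, U)} (hfx : ∀ i, f i = x i ^ c) (i : Fin 3)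
    (y : ProjectiveSpectrum 𝒜) (hy : y ∈ U) (hi : x i ∉ y.asHomogeneousIdeal.toIdeal)
    (h : ∀ j, syzVal 𝒜 f hf m s (i.succAbove j) y hy = syzVal 𝒜 f hf m t (i.succAbove j) y hy)
    (k : Fin 3) : syzVal 𝒜 f hf m s k y hy = syzVal 𝒜 f hf m t k y hy := by
  rcases Fin.eq_self_or_eq_succAbove i k with rfl | ⟨j, rfl⟩
  · have h1 := syzVal_rel s y hy
    have h2 := syzVal_rel t y hy
    rw [Fin.sum_univ_succAbove _ k, add_eq_zero_iff_eq_neg] at h1 h2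
    have hu : IsUnit (algebraMap A (LocAt 𝒜 y) (f k)) := by
      rw [hfx, ← locPow_natCast hi]
      exact isUnit_locPow hi _
    refine hu.mul_left_cancel ?_
    rw [h1, h2]
    simp only [h]
  · exact h j

/-- The components away from `i` can be prescribed freely, and the component at `i` is forced
because `f i` is invertible. In those free components the Koszul syzygies are the standard basis
times `x i ^ (m - c)`, so the coordinates are components times `x i ^ (c - m)`. -/
lemma isSectionBasis_koszul (hfx : ∀ i, f i = x i ^ c) (i : Fin 3) :
    IsSectionBasis (syz 𝒜 f hf m) (koszul 𝒜 f hf m hx hfx i) := by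
  intro V h s
  have hc : ∀ (d : Fin 2 → Γ(Proj 𝒜, V)) (j : Fin 2) (y : ProjectiveSpectrum 𝒜)
      (hy : y ∈ V),
      syzVal 𝒜 f hf m (∑ l, d l • res _ h (koszul 𝒜 f hf m hx hfx i l)) (i.succAbove j) y hy =
        funVal (d j) y hy * locPow y (x i) (notMem_of_mem_basicOpen (mem_of_le h hy)) (m - c) := by
    intro d j y hy
    rw [syzVal_sum, Finset.sum_eq_single j]
    · rw [syzVal_smul, syzVal_res, syzVal_koszul, koszulVal_succAbove, if_pos rfl]
    · intro l _ hl
      rw [syzVal_smul, syzVal_res, syzVal_koszul, koszulVal_succAbove, if_neg hl.symm, mul_zero]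
    · simp
  choose r hr using fun j => exists_funVal_eq_mul_locPow (hx i) h
    ((syzι 𝒜 f hf m (i.succAbove j)).app V s)
  refine ⟨r, syzVal_ext fun k y hy => ?_, fun d hd => ?_⟩
  · refine syzVal_eq_of_succAbove 𝒜 f hf m hfx i y hy
      (notMem_of_mem_basicOpen (mem_of_le h hy)) (fun j => ?_) k
    rw [hc, hr, mul_assoc, locPow_neg_mul, mul_one]
    rfl
  · funext j
    refine funVal_ext fun y hy => ?_
    rw [hr, ← hd]
    change _ = syzVal 𝒜 f hf m _ _ _ _ * _
    rw [hc, mul_assoc, locPow_mul_neg, mul_one]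

end Koszul
end SyzSections

/-! ### Morphisms given by ring homomorphisms, and pull-back of syzygies. -/

section Induced
variable {A B σ τ : Type u} [CommRing A] [SetLike σ A] [AddSubgroupClass σ A]
  [CommRing B] [SetLike τ B] [AddSubgroupClass τ B]
variable {𝒜 : ℕ → σ} [GradedRing 𝒜] {ℬ : ℕ → τ} [GradedRing ℬ]

variable (𝒜 ℬ) in
/-- The image of a point of `Proj ℬ` as a homogeneous prime ideal. -/
abbrev imagePt (f : Proj ℬ ⟶ Proj 𝒜) (y : ProjectiveSpectrum ℬ) : ProjectiveSpectrum 𝒜 := f y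

lemma imagePt_mem {f : Proj ℬ ⟶ Proj 𝒜} {U : (Proj 𝒜).Opens} {y : ProjectiveSpectrum ℬ}
    (hy : y ∈ f ⁻¹ᵁ U) : imagePt 𝒜 ℬ f y ∈ U := hy

variable (𝒜 ℬ) in
/-- The morphism `f` is given by the ring homomorphism `Φ`, which multiplies degrees by `q`. -/
structure IsInducedBy (f : Proj ℬ ⟶ Proj 𝒜) (Φ : A →+* B) (q : ℕ) : Prop where
  map_mem : ∀ {i : ℕ} {a : A}, a ∈ 𝒜 i → Φ a ∈ ℬ (q * i)
  comap_eq : ∀ y : ProjectiveSpectrum ℬ,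
    (imagePt 𝒜 ℬ f y).asHomogeneousIdeal.toIdeal = y.asHomogeneousIdeal.toIdeal.comap Φ
  val_eq : ∀ (U : (Proj 𝒜).Opens) (r : Γ(Proj 𝒜, U)) (y : ProjectiveSpectrum ℬ) (hy : y ∈ f ⁻¹ᵁ U),
    funVal (f.app U r) y hy = Localization.localRingHom _ _ Φ (comap_eq y)
      (funVal r (imagePt 𝒜 ℬ f y) (imagePt_mem hy))

variable {f : Proj ℬ ⟶ Proj 𝒜} {Φ : A →+* B} {q : ℕ} (h : IsInducedBy 𝒜 ℬ f Φ q)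
include h

namespace IsInducedBy

/-- The induced map on localizations. -/
def loc (y : ProjectiveSpectrum ℬ) : LocAt 𝒜 (imagePt 𝒜 ℬ f y) →+* LocAt ℬ y :=
  Localization.localRingHom _ _ Φ (h.comap_eq y)

lemma loc_algebraMap (y : ProjectiveSpectrum ℬ) (a : A) :
    h.loc y (algebraMap A _ a) = algebraMap B _ (Φ a) :=
  Localization.localRingHom_to_map _ _ _ _ a

lemma funVal_app {U : (Proj 𝒜).Opens} (r : Γ(Proj 𝒜, U)) (y : ProjectiveSpectrum ℬ)
    (hy : y ∈ f ⁻¹ᵁ U) : funVal (f.app U r) y hy = h.loc y (funVal r (imagePt 𝒜 ℬ f y) (imagePt_mem hy)) :=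
  h.val_eq U r y hy

/-- Natural exponents follow from multiplicativity. A negative exponent follows by cancelling the
unit that belongs to the opposite exponent. -/
lemma loc_locPow (y : ProjectiveSpectrum ℬ) {g : A} {g' : B} (hg : Φ g = g' ^ q)
    (hy : g' ∉ y.asHomogeneousIdeal.toIdeal) (hy') (n : ℤ) :
    h.loc y (locPow (imagePt 𝒜 ℬ f y) g hy' n) = locPow y g' hy (q * n) := by
  have h1 : ∀ k : ℕ, h.loc y (locPow (imagePt 𝒜 ℬ f y) g hy' k) = locPow y g' hy (q * k) := by
    intro k
    have h2 : (q : ℤ) * k = ((q * k : ℕ) : ℤ) := by push_cast; rfl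
    rw [h2, locPow_natCast, locPow_natCast, loc_algebraMap, map_pow, hg, pow_mul]
  obtain ⟨k, rfl | rfl⟩ := n.eq_nat_or_neg
  · exact h1 k
  · have h2 := congrArg (h.loc y) (locPow_mul_neg hy' k)
    rw [map_mul, h1, map_one] at h2
    have h3 := locPow_mul_neg hy (q * k)
    rw [mul_neg]
    exact (isUnit_locPow hy (q * k)).mul_left_cancel (h2.trans h3.symm)

/-- Applying `Φ` to a fraction `r / s` of degree `n` gives one of degree `q * n`. The new
denominator does not vanish because the ideal of the image point is the preimage under `Φ`. -/
lemma exists_twistVal_eq_loc {n n' : ℤ} (hn : n' = q * n) {U : (Proj 𝒜).Opens}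
    (t : Γ(twist 𝒜 n, U)) : ∃ t' : Γ(twist ℬ n', f ⁻¹ᵁ U), ∀ y hy,
      twistVal t' y hy = h.loc y (twistVal t (imagePt 𝒜 ℬ f y) (imagePt_mem hy)) := by
  refine exists_twistVal_eq (fun y hy => h.loc y (twistVal t (imagePt 𝒜 ℬ f y) (imagePt_mem hy))) fun y => ?_
  obtain ⟨V, hV, iV, a, b, hab, r, s, hr, hs, hx, ht⟩ :=
    (show twistSections 𝒜 n U from t).2 ⟨f y.1, y.2⟩
  refine ⟨f ⁻¹ᵁ V, hV, homOfLE (f.preimage_mono (leOfHom iV)), q * a, q * b, ?_, Φ r, Φ s,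
    h.map_mem hr, h.map_mem hs, fun z => ?_, fun z => ?_⟩
  · push_cast
    rw [hab, hn]
    ring
  · have h1 := hx ⟨f z.1, z.2⟩
    change s ∉ (imagePt 𝒜 ℬ f z.1).asHomogeneousIdeal.toIdeal at h1
    rw [h.comap_eq] at h1
    exact h1
  · refine (congrArg (h.loc z.1) (ht ⟨f z.1, z.2⟩)).trans ?_
    exact Localization.localRingHom_mk _ _ _ _ _ _

/-- The pull-back of sections of `𝒪(n)`. -/
def pull {n n' : ℤ} (hn : n' = q * n) {U : (Proj 𝒜).Opens} (t : Γ(twist 𝒜 n, U)) :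
    Γ(twist ℬ n', f ⁻¹ᵁ U) :=
  (h.exists_twistVal_eq_loc hn t).choose

lemma twistVal_pull {n n' : ℤ} (hn : n' = q * n) {U : (Proj 𝒜).Opens} (t : Γ(twist 𝒜 n, U))
    (y hy) : twistVal (h.pull hn t) y hy = h.loc y (twistVal t (imagePt 𝒜 ℬ f y) (imagePt_mem hy)) :=
  (h.exists_twistVal_eq_loc hn t).choose_spec y hy

section Syz
variable {c c' : ℕ} {m m' : ℤ} {g : Fin 3 → A} {g' : Fin 3 → B} {hg : ∀ i, g i ∈ 𝒜 c}
  {hg' : ∀ i, g' i ∈ ℬ c'}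

lemma exists_syzVal_eq_loc (hc : c' = q * c) (hm : m' = q * m) (hgg : ∀ i, Φ (g i) = g' i)
    {U : (Proj 𝒜).Opens} (s : Γ(syz 𝒜 g hg m, U)) :
    ∃ s' : Γ(syz ℬ g' hg' m', f ⁻¹ᵁ U), ∀ i y hy,
      syzVal ℬ g' hg' m' s' i y hy = h.loc y (syzVal 𝒜 g hg m s i (imagePt 𝒜 ℬ f y) (imagePt_mem hy)) := by
  have hn : m' - c' = q * (m - c) := by subst hc hm; push_cast; ring
  obtain ⟨s', hs'⟩ := exists_syz ℬ g' hg' m' (fun i => h.pull hn ((syzι 𝒜 g hg m i).app U s)) (by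
    intro y hy
    have h1 := congrArg (h.loc y) (syzVal_rel s (imagePt 𝒜 ℬ f y) (imagePt_mem hy))
    rw [map_sum, map_zero] at h1
    rw [← h1]
    refine Finset.sum_congr rfl fun i _ => ?_
    rw [twistVal_pull, map_mul, loc_algebraMap, hgg]
    rfl)
  refine ⟨s', fun i y hy => ?_⟩
  rw [syzVal, hs', twistVal_pull]
  rfl

/-- The pull-back of syzygies, as a morphism to the push-forward. -/
def syzHom (hc : c' = q * c) (hm : m' = q * m) (hgg : ∀ i, Φ (g i) = g' i) :
    syz 𝒜 g hg m ⟶ (pushforward f).obj (syz ℬ g' hg' m') :=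
  homOfSections (fun U s => (h.exists_syzVal_eq_loc (hg' := hg') hc hm hgg s).choose)
    (fun U s t => syzVal_ext (𝒜 := ℬ) fun i y hy => by
      refine Eq.trans ?_ (syzVal_add _ _ i y hy).symm
      rw [(h.exists_syzVal_eq_loc hc hm hgg _).choose_spec,
        (h.exists_syzVal_eq_loc hc hm hgg _).choose_spec,
        (h.exists_syzVal_eq_loc hc hm hgg _).choose_spec, syzVal_add, map_add])
    (fun U r s => syzVal_ext (𝒜 := ℬ) fun i y hy => by
      refine Eq.trans ?_ (syzVal_smul (f.app U r) _ i y hy).symm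
      rw [(h.exists_syzVal_eq_loc hc hm hgg _).choose_spec,
        (h.exists_syzVal_eq_loc hc hm hgg _).choose_spec, syzVal_smul, map_mul, h.funVal_app])
    (fun U V hUV s => syzVal_ext (𝒜 := ℬ) fun i y hy => by
      refine Eq.trans ?_ (syzVal_res (f.preimage_mono hUV) _ i y hy).symm
      rw [(h.exists_syzVal_eq_loc hc hm hgg _).choose_spec,
        (h.exists_syzVal_eq_loc hc hm hgg _).choose_spec, syzVal_res])

lemma syzVal_syzHom (hc : c' = q * c) (hm : m' = q * m) (hgg : ∀ i, Φ (g i) = g' i)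
    {U : (Proj 𝒜).Opens} (s : Γ(syz 𝒜 g hg m, U)) (i y hy) :
    syzVal ℬ g' hg' m' (pushApp f (h.syzHom (hg' := hg') hc hm hgg) U s) i y hy =
      h.loc y (syzVal 𝒜 g hg m s i (imagePt 𝒜 ℬ f y) (imagePt_mem hy)) :=
  (h.exists_syzVal_eq_loc hc hm hgg s).choose_spec i y hy

lemma preimage_basicOpen {a : A} {b : B} (hab : Φ a = b ^ q) (hq : q ≠ 0) :
    f ⁻¹ᵁ Proj.basicOpen 𝒜 a = Proj.basicOpen ℬ b := by
  have key : ∀ y : ProjectiveSpectrum ℬ, a ∉ (imagePt 𝒜 ℬ f y).asHomogeneousIdeal.toIdeal ↔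
      b ∉ y.asHomogeneousIdeal.toIdeal := fun y => by
    rw [h.comap_eq, Ideal.mem_comap, hab, y.isPrime.pow_mem_iff_mem _ (Nat.pos_of_ne_zero hq)]
  exact TopologicalSpace.Opens.ext (Set.ext key)

/-- Pull-back of syzygy sheaves of powers of linear forms. -/
theorem nonempty_pullback_syz_iso {x : Fin 3 → A} {x' : Fin 3 → B} (hq : q ≠ 0)
    (hx : ∀ i, x i ∈ 𝒜 1) (hx' : ∀ i, x' i ∈ ℬ 1) (hxx : ∀ i, Φ (x i) = x' i ^ q)
    (hcov : ⨆ i, Proj.basicOpen 𝒜 (x i) = ⊤) (hgx : ∀ i, g i = x i ^ c)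
    (hgx' : ∀ i, g' i = x' i ^ c') (hc : c' = q * c) (hm : m' = q * m) :
    Nonempty ((pullback f).obj (syz 𝒜 g hg m) ≅ syz ℬ g' hg' m') := by
  have hgg : ∀ i, Φ (g i) = g' i := fun i => by rw [hgx, hgx', map_pow, hxx, ← pow_mul, hc]
  have := isIso_pullback_of_isSectionBasis f (I := ULift (Fin 3))
    (U := fun i => Proj.basicOpen 𝒜 (x i.down))
    (fun i => koszul 𝒜 g hg m hx hgx i.down) (by rw [← hcov]; exact Equiv.ulift.iSup_congr fun _ => rfl)
    (fun i => isSectionBasis_koszul 𝒜 g hg m hx hgx i.down) (h.syzHom (hg' := hg') hc hm hgg)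
    (by
      rintro ⟨i⟩
      have hU := h.preimage_basicOpen (hxx i) hq
      -- The exponents `m - c` and `m - 2c` of the Koszul entries are multiplied by `q` and become
      -- those for `m'` and `c'`. So the Koszul basis upstairs is the image of the one downstairs,
      -- over the same open set.
      have hE : (fun j => pushApp f (h.syzHom (hg' := hg') hc hm hgg) _
          (koszul 𝒜 g hg m hx hgx i j)) =
          fun j => res _ hU.le (koszul ℬ g' hg' m' hx' hgx' i j) := by
        funext j
        refine syzVal_ext fun k y hy => ?_
        rw [syzVal_syzHom, syzVal_res, syzVal_koszul, syzVal_koszul]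
        have hy' : x' i ∉ y.asHomogeneousIdeal.toIdeal :=
          notMem_of_mem_basicOpen (mem_of_le hU.le hy)
        have e1 : (q : ℤ) * (m - c - c) = m' - c' - c' := by subst hc hm; push_cast; ring
        have e2 : (q : ℤ) * (m - c) = m' - c' := by subst hc hm; push_cast; ring
        simp only [koszulVal]
        split_ifs
        · rw [map_neg, map_mul, loc_algebraMap, h.loc_locPow y (hxx i) hy', hgg, e1]
        · rw [h.loc_locPow y (hxx i) hy', e2]
        · exact map_zero _
      change IsSectionBasis _ (fun j => pushApp f (h.syzHom (hg' := hg') hc hm hgg) _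
          (koszul 𝒜 g hg m hx hgx i j))
      rw [hE]
      intro V hV s
      have := isSectionBasis_koszul ℬ g' hg' m' hx' hgx' i (hV.trans hU.le) s
      simpa only [res_res] using this)
  exact ⟨asIso (((pullbackPushforwardAdjunction f).homEquiv _ _).symm
    (h.syzHom (hg' := hg') hc hm hgg))⟩

end Syz
end IsInducedBy

end Induced

/-! ### Frobenius and restriction to a curve as induced morphisms. -/

section Frobenius
variable {K A : Type u} [Field K] [CommRing A] [Algebra K A] (p : ℕ) [Fact p.Prime] [CharP K p]
variable (𝒜 : ℕ → Submodule K A) [GradedAlgebra 𝒜] (e : ℕ) (f : Proj 𝒜 ⟶ Spec (.of K))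

/-- A prime contains `a ^ (p ^ e)` exactly when it contains `a`, so the identity on points is
compatible with the power map. On each localization the induced homomorphism is again the power map.
-/
lemma isInducedBy_frob :
    IsInducedBy 𝒜 𝒜 (frob p f e) (ringFrob p e A (algebraMap K A)) (p ^ e) := by
  have hmem : ∀ (y : ProjectiveSpectrum 𝒜) (a : A), a ^ p ^ e ∈ y.asHomogeneousIdeal.toIdeal ↔
      a ∈ y.asHomogeneousIdeal.toIdeal := fun y a =>
    y.isPrime.pow_mem_iff_mem _ (pow_pos (Fact.out : p.Prime).pos e)
  have hcomap : ∀ y : ProjectiveSpectrum 𝒜,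
      (imagePt 𝒜 𝒜 (frob p f e) y).asHomogeneousIdeal.toIdeal =
        y.asHomogeneousIdeal.toIdeal.comap (ringFrob p e A (algebraMap K A)) := fun y =>
    Ideal.ext fun a => (hmem y a).symm
  refine ⟨fun {i a} ha => ?_, hcomap, fun U r y hy => ?_⟩
  · exact SetLike.pow_mem_graded (p ^ e) ha
  · have h1 : funVal ((frob p f e).app U r) y hy = funVal r y hy ^ p ^ e :=
      HomogeneousLocalization.val_pow ..
    have h2 : ∀ z : LocAt 𝒜 y, Localization.localRingHom _ _ _ (hcomap y) z = z ^ p ^ e := by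
      intro z
      induction z using Localization.induction_on with
      | H z =>
        refine (Localization.localRingHom_mk _ _ _ (hcomap y) z.1 z.2).trans ?_
        rw [Localization.mk_pow]
        rfl
    exact h1.trans (h2 _).symm

end Frobenius

section Quot
variable {K A : Type u} [CommRing K] [CommRing A] [Algebra K A]
variable {𝒜 : ℕ → Submodule K A} [GradedAlgebra 𝒜] (I : HomogeneousIdeal 𝒜)

lemma isInducedBy_quotIncl :
    IsInducedBy 𝒜 (quotGrading I) (quotIncl I) (Ideal.Quotient.mk I.toIdeal) 1 := by
  refine ⟨fun {i a} ha => ?_, fun y => rfl, fun U r y hy => ?_⟩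
  · rw [one_mul]
    exact ⟨a, ha, rfl⟩
  · exact HomogeneousLocalization.val_localRingHom ..

end Quot

/-! ### Pull-backs of the syzygy bundles on the plane and on plane curves. -/

section Plane
variable {K : Type u} [Field K]

variable (K) in
lemma plane_cover : ⨆ i, Proj.basicOpen (planeGrading K) (MvPolynomial.X i) = ⊤ := by
  refine Proj.iSup_basicOpen_eq_top' _ _
    (fun i => ⟨1, MvPolynomial.isHomogeneous_X K i⟩) (top_le_iff.mp fun a _ => ?_)
  induction a using MvPolynomial.induction_on with
  | C r => exact Subalgebra.algebraMap_mem _ (⟨_, MvPolynomial.isHomogeneous_C (Fin 3) r⟩ :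
      planeGrading K 0)
  | add a b ha hb => exact add_mem (ha trivial) (hb trivial)
  | mul_X a i ha => exact mul_mem (ha trivial) (Algebra.subset_adjoin ⟨i, rfl⟩)

variable (p : ℕ) [Fact p.Prime] [CharP K p]

lemma nonempty_frob_planeSyz_iso (a e : ℕ) :
    Nonempty ((pullback (frob p (planeToSpec K) e)).obj (planeSyz K a 0) ≅
      planeSyz K (a * p ^ e) 0) :=
  (isInducedBy_frob p (planeGrading K) e (planeToSpec K)).nonempty_pullback_syz_iso
    (x := MvPolynomial.X) (x' := MvPolynomial.X) (pow_ne_zero _ (Fact.out : p.Prime).ne_zero)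
    (MvPolynomial.isHomogeneous_X K) (MvPolynomial.isHomogeneous_X K) (fun _ => rfl)
    (plane_cover K) (fun _ => rfl) (fun _ => rfl) (mul_comm _ _) (by simp)

variable {d : ℕ} (F : MvPolynomial (Fin 3) K) (hF : F.IsHomogeneous d)

/-- The class of a variable in `K[X, Y, Z] / (F)`. -/
def curveVar (i : Fin 3) : MvPolynomial (Fin 3) K ⧸ (curveIdeal F hF).toIdeal :=
  Ideal.Quotient.mk _ (MvPolynomial.X i)

lemma curveVar_mem (i : Fin 3) : curveVar F hF i ∈ curveGrading F hF 1 :=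
  ⟨_, MvPolynomial.isHomogeneous_X K i, rfl⟩

lemma curvePow_eq (c : ℕ) (i : Fin 3) : curvePow F hF c i = curveVar F hF i ^ c :=
  map_pow _ _ _

lemma curve_cover : ⨆ i, Proj.basicOpen (curveGrading F hF) (curveVar F hF i) = ⊤ := by
  have h := congrArg (fun U => curveIncl F hF ⁻¹ᵁ U) (plane_cover K)
  simp only [Scheme.Hom.preimage_iSup, Scheme.Hom.preimage_top] at h
  exact h

lemma nonempty_restrictedSyz_iso (a : ℕ) :
    Nonempty (restrictedSyz F hF a ≅ curveSyz F hF a 0) :=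
  (isInducedBy_quotIncl (curveIdeal F hF)).nonempty_pullback_syz_iso
    (x := MvPolynomial.X) (x' := curveVar F hF) one_ne_zero
    (MvPolynomial.isHomogeneous_X K) (curveVar_mem F hF) (fun _ => (pow_one _).symm)
    (plane_cover K) (fun _ => rfl) (curvePow_eq F hF a) (one_mul _).symm (by simp)

lemma nonempty_frob_restrictedSyz_iso (a e : ℕ) :
    Nonempty ((pullback (frob p (curveToSpec F hF) e)).obj (restrictedSyz F hF a) ≅
      curveSyz F hF (a * p ^ e) 0) := by
  obtain ⟨i⟩ := nonempty_restrictedSyz_iso F hF a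
  obtain ⟨j⟩ := (isInducedBy_frob p (curveGrading F hF) e
    (curveToSpec F hF)).nonempty_pullback_syz_iso
    (x := curveVar F hF) (x' := curveVar F hF) (g := curvePow F hF a)
    (g' := curvePow F hF (a * p ^ e)) (hg := curvePow_mem F hF a)
    (hg' := curvePow_mem F hF (a * p ^ e)) (pow_ne_zero _ (Fact.out : p.Prime).ne_zero)
    (curveVar_mem F hF) (curveVar_mem F hF) (fun _ => rfl)
    (curve_cover F hF) (curvePow_eq F hF a) (curvePow_eq F hF _) (mul_comm _ _)
    (m := 0) (m' := 0) (by simp)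
  exact ⟨(pullback (frob p (curveToSpec F hF) e)).mapIso i ≪≫ j⟩

end Plane

/-! ### Stalks, generic stalks, rank and degree under isomorphism. -/

section Stalks
variable {X : Scheme.{u}}

/-- The germ at `x` of a section of a sheaf of modules. -/
def germ (M : X.Modules) {U : X.Opens} (x : X) (hx : x ∈ U) (m : Γ(M, U)) : M.presheaf.stalk x :=
  TopCat.Presheaf.germ M.presheaf U x hx m

/-- The germ at `x` of a function. -/
def fgerm {U : X.Opens} (x : X) (hx : x ∈ U) (m : Γ(X, U)) : X.presheaf.stalk x :=
  X.presheaf.germ U x hx m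

lemma germ_add (M : X.Modules) {U : X.Opens} (x : X) (hx : x ∈ U) (m n : Γ(M, U)) :
    germ M x hx (m + n) = germ M x hx m + germ M x hx n := map_add _ _ _

lemma germ_sum (M : X.Modules) {U : X.Opens} (x : X) (hx : x ∈ U) {ι : Type*} (t : Finset ι)
    (m : ι → Γ(M, U)) : germ M x hx (∑ i ∈ t, m i) = ∑ i ∈ t, germ M x hx (m i) := map_sum _ _ _

lemma germ_smul (M : X.Modules) {U : X.Opens} (x : X) (hx : x ∈ U) (r : Γ(X, U)) (m : Γ(M, U)) :
    germ M x hx (r • m) = fgerm x hx r • germ M x hx m :=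
  PresheafOfModules.germ_smul (R := X.presheaf) M.val x U hx r m

lemma germ_res (M : X.Modules) {U V : X.Opens} (h : V ≤ U) (x : X) (hx : x ∈ V) (m : Γ(M, U)) :
    germ M x hx (res M h m) = germ M x (h hx) m :=
  TopCat.Presheaf.germ_res_apply M.presheaf (homOfLE h) x hx m

lemma fgerm_fres {U V : X.Opens} (h : V ≤ U) (x : X) (hx : x ∈ V) (m : Γ(X, U)) :
    fgerm x hx (fres h m) = fgerm x (h hx) m :=
  TopCat.Presheaf.germ_res_apply X.presheaf (homOfLE h) x hx m

lemma exists_germ_eq (M : X.Modules) (x : X) (m : M.presheaf.stalk x) :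
    ∃ (U : X.Opens) (hx : x ∈ U) (s : Γ(M, U)), germ M x hx s = m :=
  TopCat.Presheaf.exists_germ_eq M.presheaf m

lemma exists_fgerm_eq (x : X) (m : X.presheaf.stalk x) :
    ∃ (U : X.Opens) (hx : x ∈ U) (s : Γ(X, U)), fgerm x hx s = m :=
  TopCat.Presheaf.exists_germ_eq X.presheaf m

/-- Finitely many germs of functions live on a common neighbourhood. -/
lemma exists_fgerm_eq_pi {x : X} {V : X.Opens} (hx : x ∈ V) {ι : Type*} [Finite ι]
    (c : ι → X.presheaf.stalk x) :
    ∃ (W : X.Opens) (_ : W ≤ V) (hx : x ∈ W) (r : ι → Γ(X, W)), ∀ i, fgerm x hx (r i) = c i := by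
  choose U hU s hs using fun i => exists_fgerm_eq x (c i)
  have := Fintype.ofFinite ι
  have hW : x ∈ V ⊓ Finset.univ.inf U := by
    refine ⟨hx, ?_⟩
    simpa using hU
  refine ⟨V ⊓ Finset.univ.inf U, inf_le_left, hW,
    fun i => fres (inf_le_right.trans (Finset.inf_le (Finset.mem_univ i))) (s i), fun i => ?_⟩
  exact (fgerm_fres _ x hW _).trans (hs i)

lemma exists_res_eq_of_germ_eq (M : X.Modules) {U : X.Opens} (x : X) (hx : x ∈ U)
    (s t : Γ(M, U)) (h : germ M x hx s = germ M x hx t) :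
    ∃ (W : X.Opens) (hW : W ≤ U) (_ : x ∈ W), res M hW s = res M hW t := by
  obtain ⟨W, hxW, i, j, e⟩ := TopCat.Presheaf.germ_eq M.presheaf x hx hx s t h
  exact ⟨W, i.le, hxW, e⟩

/-- The map on stalks induced by a morphism of sheaves of modules. -/
def stalkHom {M N : X.Modules} (φ : M ⟶ N) (x : X) :
    M.presheaf.stalk x →ₗ[X.presheaf.stalk x] N.presheaf.stalk x where
  toFun := ((TopCat.Presheaf.stalkFunctor _ x).map φ.mapPresheaf).hom
  map_add' := map_add _
  map_smul' r m := by
    obtain ⟨U, hx, s, rfl⟩ := exists_germ_eq M x m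
    obtain ⟨W, hW, hxW, t, ht⟩ := exists_fgerm_eq_pi hx fun _ : Unit => r
    obtain rfl := ht ()
    have key : ∀ z : Γ(M, W), ((TopCat.Presheaf.stalkFunctor _ x).map φ.mapPresheaf).hom
        (germ M x hxW z) = germ N x hxW (φ.app W z) := fun z =>
      TopCat.Presheaf.stalkFunctor_map_germ_apply W x hxW φ.mapPresheaf z
    rw [← germ_res M hW x hxW, ← germ_smul]
    rw [RingHom.id_apply, key, key, Hom.app_smul, germ_smul]

lemma stalkHom_germ {M N : X.Modules} (φ : M ⟶ N) {U : X.Opens} (x : X) (hx : x ∈ U)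
    (m : Γ(M, U)) : stalkHom φ x (germ M x hx m) = germ N x hx (φ.app U m) :=
  TopCat.Presheaf.stalkFunctor_map_germ_apply U x hx φ.mapPresheaf m

lemma stalkHom_injective {M N : X.Modules} (φ : M ⟶ N) [Mono φ] (x : X) :
    Function.Injective (stalkHom φ x) := by
  rw [injective_iff_map_eq_zero]
  intro m hm
  obtain ⟨U, hx, s, rfl⟩ := exists_germ_eq M x m
  rw [stalkHom_germ] at hm
  obtain ⟨W, hW, hxW, e⟩ := exists_res_eq_of_germ_eq N x hx (φ.app U s) 0
    (hm.trans (map_zero _).symm)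
  rw [← app_res, show res N hW 0 = 0 from map_zero _] at e
  have : res M hW s = 0 := app_injective_of_mono φ W (e.trans (map_zero _).symm)
  rw [← germ_res M hW x hxW, this]
  exact map_zero _

lemma stalkHom_comp {M N P : X.Modules} (φ : M ⟶ N) (ψ : N ⟶ P) (x : X) (m : M.presheaf.stalk x) :
    stalkHom (φ ≫ ψ) x m = stalkHom ψ x (stalkHom φ x m) := by
  obtain ⟨U, hx, s, rfl⟩ := exists_germ_eq M x m
  rw [stalkHom_germ, stalkHom_germ, stalkHom_germ]
  rfl

lemma stalkHom_id {M : X.Modules} (x : X) (m : M.presheaf.stalk x) :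
    stalkHom (𝟙 M) x m = m := by
  obtain ⟨U, hx, s, rfl⟩ := exists_germ_eq M x m
  rw [stalkHom_germ]
  rfl

/-- Isomorphic sheaves have isomorphic stalks. -/
def stalkEquiv {M N : X.Modules} (φ : M ≅ N) (x : X) :
    M.presheaf.stalk x ≃ₗ[X.presheaf.stalk x] N.presheaf.stalk x where
  __ := stalkHom φ.hom x
  invFun := stalkHom φ.inv x
  left_inv m := by
    change stalkHom φ.inv x (stalkHom φ.hom x m) = m
    rw [← stalkHom_comp, φ.hom_inv_id, stalkHom_id]
  right_inv m := by
    change stalkHom φ.hom x (stalkHom φ.inv x m) = m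
    rw [← stalkHom_comp, φ.inv_hom_id, stalkHom_id]

section Integral
variable [IsIntegral X]

/-- The linear map on generic stalks induced by a morphism of sheaves of modules. -/
def genHom {M N : X.Modules} (φ : M ⟶ N) : genStalk M →ₗ[X.functionField] genStalk N :=
  stalkHom φ (genericPoint X)

/-- Isomorphic sheaves have isomorphic generic stalks. -/
def genEquiv {M N : X.Modules} (φ : M ≅ N) : genStalk M ≃ₗ[X.functionField] genStalk N :=
  stalkEquiv φ (genericPoint X)

lemma toGenStalk_germ (M : X.Modules) {U : X.Opens} (x : X) (hx : x ∈ U) (m : Γ(M, U)) :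
    toGenStalk M x (germ M x hx m) = germ M (genericPoint X)
      (((genericPoint_spec X).specializes trivial).mem_open U.2 hx) m :=
  TopCat.Presheaf.germ_stalkSpecializes_apply M.presheaf hx _ m

lemma algebraMap_fgerm {U : X.Opens} (x : X) (hx : x ∈ U) (m : Γ(X, U)) :
    algebraMap (X.presheaf.stalk x) X.functionField (fgerm x hx m) = fgerm (genericPoint X)
      (((genericPoint_spec X).specializes trivial).mem_open U.2 hx) m :=
  TopCat.Presheaf.germ_stalkSpecializes_apply X.presheaf hx _ m

lemma genHom_toGenStalk {M N : X.Modules} (φ : M ⟶ N) (x : X) (m : M.presheaf.stalk x) :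
    genHom φ (toGenStalk M x m) = toGenStalk N x (stalkHom φ x m) := by
  obtain ⟨U, hx, s, rfl⟩ := exists_germ_eq M x m
  rw [stalkHom_germ, toGenStalk_germ, toGenStalk_germ, genHom, stalkHom_germ]

lemma genHom_mem_range {M N : X.Modules} (φ : M ⟶ N) (x : X) {m : genStalk M}
    (hm : m ∈ (toGenStalk M x).range) : genHom φ m ∈ (toGenStalk N x).range := by
  obtain ⟨m, rfl⟩ := hm
  exact ⟨_, (genHom_toGenStalk φ x m).symm⟩

lemma genericPoint_mem {U : X.Opens} {x : X} (hx : x ∈ U) : genericPoint X ∈ U :=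
  ((genericPoint_spec X).specializes trivial).mem_open U.2 hx

section Basis
variable {M : X.Modules} {U : X.Opens} {n : ℕ} {s : Fin n → Γ(M, U)}

omit [IsIntegral X] in
lemma IsSectionBasis.exists_germ (hs : IsSectionBasis M s) {x : X} (hx : x ∈ U)
    (m : M.presheaf.stalk x) :
    ∃ c : Fin n → X.presheaf.stalk x, m = ∑ j, c j • germ M x hx (s j) := by
  obtain ⟨V, hV, t, rfl⟩ := exists_germ_eq M x m
  obtain ⟨c, hc, -⟩ := hs (inf_le_left : U ⊓ V ≤ U) (res M inf_le_right t)
  have hW : x ∈ U ⊓ V := ⟨hx, hV⟩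
  refine ⟨fun j => fgerm x hW (c j), ?_⟩
  rw [← germ_res M (inf_le_right : U ⊓ V ≤ V) x hW, ← hc, germ_sum]
  simp only [germ_smul, germ_res]

/-- The basis of the generic stalk given by a basis of sections. -/
def IsSectionBasis.genBasis (hs : IsSectionBasis M s) (hU : genericPoint X ∈ U) :
    Module.Basis (Fin n) X.functionField (genStalk M) :=
  Module.Basis.mk (v := fun j => germ M (genericPoint X) hU (s j)) (by
    rw [Fintype.linearIndependent_iff]
    intro g hg
    -- A linear relation over the function field spreads out to a neighbourhood of the generic
    -- point, where uniqueness of coordinates applies.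
    obtain ⟨W, hW, hxW, r, hr⟩ := exists_fgerm_eq_pi hU g
    have h1 : germ M (genericPoint X) hxW (∑ j, r j • res M hW (s j)) =
        germ M (genericPoint X) hxW 0 := by
      rw [germ_sum]
      simp only [germ_smul, germ_res, hr]
      exact hg.trans (map_zero _).symm
    obtain ⟨W', hW', hxW', e⟩ := exists_res_eq_of_germ_eq M _ hxW _ _ h1
    rw [res_sum_smul, show res M hW' 0 = 0 from map_zero _] at e
    have h2 := hs.eq (hW'.trans hW) (c := fun j => fres hW' (r j)) (d := 0) (by simpa using e)
    intro i
    rw [← hr i, ← fgerm_fres hW' _ hxW', show fres hW' (r i) = 0 from congrFun h2 i]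
    exact map_zero _) (by
    rintro m -
    obtain ⟨c, rfl⟩ := hs.exists_germ hU m
    exact sum_mem fun j _ => Submodule.smul_mem _ (c j : X.functionField)
      (Submodule.subset_span ⟨j, rfl⟩))

lemma IsSectionBasis.genBasis_apply (hs : IsSectionBasis M s) (hU : genericPoint X ∈ U)
    (j : Fin n) : hs.genBasis hU j = germ M (genericPoint X) hU (s j) :=
  Module.Basis.mk_apply ..

/-- Coordinates of a germ at `x` are germs of functions at `x`, and specialization to the generic
point keeps them. One basis of sections thus supplies the local bases demanded by `HasDegree` at all
points of `U`. -/
lemma IsSectionBasis.isLocalBasis (hs : IsSectionBasis M s) (hU : genericPoint X ∈ U) {x : X}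
    (hx : x ∈ U) : IsLocalBasis M x (hs.genBasis hU) := by
  have key : ∀ {W : X.Opens} (hW : W ≤ U) (hxW : x ∈ W) (r : Fin n → Γ(X, W)),
      toGenStalk M x (germ M x hxW (∑ j, r j • res M hW (s j))) =
        ∑ j, (algebraMap (X.presheaf.stalk x) X.functionField (fgerm x hxW (r j))) •
          hs.genBasis hU j := by
    intro W hW hxW r
    rw [toGenStalk_germ, germ_sum]
    refine Finset.sum_congr rfl fun j _ => ?_
    rw [germ_smul, germ_res, algebraMap_fgerm, hs.genBasis_apply]
  intro m
  refine ⟨?_, fun h => ?_⟩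
  · rintro ⟨m, rfl⟩ i
    obtain ⟨V, hV, t, rfl⟩ := exists_germ_eq M x m
    obtain ⟨c, hc, -⟩ := hs (inf_le_left : U ⊓ V ≤ U) (res M inf_le_right t)
    have hW : x ∈ U ⊓ V := ⟨hx, hV⟩
    rw [← germ_res M (inf_le_right : U ⊓ V ≤ V) x hW, ← hc, key]
    refine ⟨fgerm x hW (c i), ?_⟩
    rw [Module.Basis.repr_sum_self]
  · choose c hc using h
    obtain ⟨W, hW, hxW, r, hr⟩ := exists_fgerm_eq_pi hx c
    refine ⟨germ M x hxW (∑ j, r j • res M hW (s j)), ?_⟩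
    rw [key]
    simp only [hr, hc]
    exact Module.Basis.sum_repr _ _

lemma IsSectionBasis.rank_eq (hs : IsSectionBasis M s) (hU : genericPoint X ∈ U) : rank M = n := by
  rw [rank, Module.finrank_eq_card_basis (hs.genBasis hU), Fintype.card_fin]

end Basis

lemma rank_eq_of_iso {M N : X.Modules} (φ : M ≅ N) : rank M = rank N :=
  (genEquiv φ).finrank_eq

lemma IsLocalBasis.of_iso {M N : X.Modules} (φ : M ≅ N) {x : X} {n : ℕ}
    {b : Module.Basis (Fin n) X.functionField (genStalk M)} (hb : IsLocalBasis M x b) :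
    IsLocalBasis N x (b.map (genEquiv φ)) := by
  intro m
  rw [Module.Basis.map_repr]
  refine Iff.trans ⟨fun h => ?_, fun h => ?_⟩ (hb ((genEquiv φ).symm m))
  · exact genHom_mem_range φ.inv x h
  · have := genHom_mem_range φ.hom x h
    rwa [show genHom φ.hom ((genEquiv φ).symm m) = m from (genEquiv φ).apply_symm_apply m] at this

variable [IsLocallyNoetherian X]

lemma HasDegree.of_iso {M N : X.Modules} (φ : M ≅ N) {w : X → ℕ} {δ : ℤ} (h : HasDegree w M δ) :
    HasDegree w N δ := by
  obtain ⟨n, e, D, h0, h1, h2⟩ := h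
  refine ⟨n, e.map (genEquiv φ), D, h0, fun x hx => ?_, h2⟩
  obtain ⟨b, hb, hD⟩ := h1 x hx
  refine ⟨b.map (genEquiv φ), hb.of_iso φ, ?_⟩
  rw [hD, Module.Basis.det_map]
  congr 2
  funext i
  simp

lemma IsSemistable.of_iso {M N : X.Modules} (φ : M ≅ N) {w : X → ℕ} (h : IsSemistable w M) :
    IsSemistable w N := by
  intro T j hj hT hr t s ht hs
  rw [← rank_eq_of_iso φ]
  exact h T (j ≫ φ.inv) inferInstance hT hr t s ht (hs.of_iso φ.symm)

end Integral
end Stalks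

/-! ### Finite presentation of sheaves that are locally free of rank one. -/

section FinitePresentation

section Site
variable {C : Type u} [Category.{u} C] {J : GrothendieckTopology C}
  {R : Sheaf J RingCat.{u}}

/-- Isomorphisms of sheaves of modules are detected on the underlying presheaves of groups, where
the map is `r ↦ r • s`. -/
lemma isIso_unitHomEquiv_symm {M : SheafOfModules.{u} R} (s : M.sections)
    (h : ∀ X : Cᵒᵖ, Function.Bijective fun r : R.obj.obj X => r • (show M.val.obj X from s.1 X)) :
    IsIso (M.unitHomEquiv.symm s) := by
  have : IsIso ((SheafOfModules.forget R).map (M.unitHomEquiv.symm s)) := by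
    rw [← isIso_iff_of_reflects_iso _ (PresheafOfModules.toPresheaf R.obj),
      NatTrans.isIso_iff_isIso_app]
    intro X
    rw [ConcreteCategory.isIso_iff_bijective]
    exact h X
  exact isIso_of_reflects_iso _ (SheafOfModules.forget R)

lemma isIso_freeHomEquiv_symm [HasWeakSheafify J AddCommGrpCat.{u}]
    [J.WEqualsLocallyBijective AddCommGrpCat.{u}] {M : SheafOfModules.{u} R} (s : M.sections)
    (h : ∀ X : Cᵒᵖ, Function.Bijective fun r : R.obj.obj X => r • (show M.val.obj X from s.1 X)) :
    IsIso (M.freeHomEquiv.symm fun _ : PUnit.{u + 1} => s) := by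
  have h1 := isIso_unitHomEquiv_symm s h
  have h2 : SheafOfModules.ιFree PUnit.unit ≫ (M.freeHomEquiv.symm fun _ : PUnit.{u + 1} => s) =
      M.unitHomEquiv.symm s := by
    rw [← SheafOfModules.unitHomEquiv_symm_freeHomEquiv_apply, Equiv.apply_symm_apply]
  have h3 : IsIso (SheafOfModules.ιFree (R := R) PUnit.unit.{u + 1}) := by
    let e : SheafOfModules.free PUnit.{u + 1} ≅ SheafOfModules.unit R :=
      Limits.coproductUniqueIso _
    have : SheafOfModules.ιFree (R := R) PUnit.unit.{u + 1} = e.inv := rfl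
    rw [this]
    infer_instance
  rw [← h2] at h1
  exact IsIso.of_isIso_comp_left (SheafOfModules.ιFree PUnit.unit) _

end Site

variable {X : Scheme.{u}} {M : X.Modules}

/-- The restrictions of a section. -/
def overSection {U : X.Opens} (s : Γ(M, U)) :
    (SheafOfModules.over (R := X.ringCatSheaf) M U).sections :=
  PresheafOfModules.sectionsMk (fun V => res M V.unop.hom.le s) (by
    intro V W f
    exact res_res M _ _ _)

/-- A sheaf of modules which is locally free of rank one is finitely presented. -/
lemma isFinitePresentation_of_isSectionBasis {ι : Type u} (U : ι → X.Opens) (hU : ⨆ i, U i = ⊤)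
    (s : ∀ i, Γ(M, U i)) (hs : ∀ i, IsSectionBasis M fun _ : Fin 1 => s i) :
    SheafOfModules.IsFinitePresentation (R := X.ringCatSheaf) M := by
  have h0 : ∀ i, IsIso ((SheafOfModules.over (R := X.ringCatSheaf) M (U i)).freeHomEquiv.symm
      fun _ : PUnit.{u + 1} => overSection (s i)) := fun i => by
    refine isIso_freeHomEquiv_symm _ fun V => ?_
    have h := hs i V.unop.hom.le
    refine ⟨fun a b hab => ?_, fun m => ?_⟩
    · have := (hs i).eq V.unop.hom.le (c := fun _ => a) (d := fun _ => b) (by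
        rw [Fin.sum_univ_one, Fin.sum_univ_one]
        exact hab)
      exact congrFun this 0
    · obtain ⟨c, hc, -⟩ := hs i V.unop.hom.le m
      exact ⟨c 0, (Fin.sum_univ_one _).symm.trans hc⟩
  let q : SheafOfModules.LocalGeneratorsData.{u} (R := X.ringCatSheaf) M :=
    { I := ι
      X := U
      coversTop := fun V x hx => by
        have hx' : x ∈ ⨆ i, U i := by rw [hU]; trivial
        obtain ⟨i, hi⟩ := Opens.mem_iSup.mp hx'
        exact ⟨V ⊓ U i, homOfLE inf_le_left, ⟨i, ⟨homOfLE inf_le_right⟩⟩, ⟨hx, hi⟩⟩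
      generators := fun i =>
        { I := PUnit
          s := fun _ => overSection (s i)
          epi := by have := h0 i; infer_instance } }
  have hq : q.IsLocallyFreeData := by
    constructor
    exact h0
  constructor
  -- Locally there is one generator and an empty family of relations.
  refine Exists.intro q.quasiCoherentData ?_
  constructor
  intro i
  constructor
  · constructor
    exact inferInstanceAs (Finite PUnit.{u + 1})
  · constructor
    exact inferInstanceAs (Finite (ULift.{u} Empty))

end FinitePresentation

/-! ### Points of codimension one and orders of rational functions. -/

section Order
variable {X : Scheme.{u}} [IsIntegral X]

/-- In the specialization order the generic point is the largest element. A proper intermediate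
point `z` would give a chain of length two above `x`. -/
lemma eq_of_le_of_coheight_eq_one {x z : X} (hx : Order.coheight x = 1) (hxz : x ≤ z)
    (hlt : z < genericPoint X) : x = z := by
  by_cases hzx : z ≤ x
  · exact ((show x ⤳ z from hzx).antisymm (show z ⤳ x from hxz)).eq
  · have h1 := Order.coheight_add_one_le hlt
    have h2 := Order.coheight_add_one_le (lt_of_le_not_ge hxz hzx)
    rw [hx] at h2
    have h3 : (1 : ℕ∞) + 1 ≤ 1 := by
      refine le_trans ?_ h2
      gcongr
      exact le_trans le_add_self h1
    exact absurd h3 (by decide)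

/-- The complement of `U` is a finite union of irreducible closed sets. A point of codimension one
in the complement has to be the generic point of one of them. This yields finite supports for
divisors. -/
lemma finite_coheight_eq_one [NoetherianSpace X] {U : X.Opens} (hU : genericPoint X ∈ U) :
    {x : X | Order.coheight x = 1 ∧ x ∉ U}.Finite := by
  obtain ⟨S, hS, hc, hi, hu⟩ :=
    NoetherianSpace.exists_finite_set_isClosed_irreducible (U.2.isClosed_compl)
  refine (hS.biUnion fun t ht => Set.Subsingleton.finite
    (s := {x : X | IsGenericPoint x t}) fun x hx y hy => hx.eq hy).subset ?_
  rintro x ⟨hx, hxU⟩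
  have hxS : x ∈ (⋃₀ S) := hu ▸ hxU
  obtain ⟨t, ht, hxt⟩ := hxS
  refine Set.mem_biUnion ht ?_
  obtain ⟨z, hz⟩ := QuasiSober.sober (hi t ht) (hc t ht)
  have hzU : z ∉ U := by
    have : z ∈ ⋃₀ S := ⟨t, ht, hz.mem⟩
    rw [← hu] at this
    exact this
  have hxz : x ≤ z := hz.specializes hxt
  have hzη : z ≤ genericPoint X := (genericPoint_spec X).specializes trivial
  have hlt : z < genericPoint X := lt_of_le_not_ge hzη fun h => hzU (h.mem_open U.2 hU)
  rw [eq_of_le_of_coheight_eq_one hx hxz hlt]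
  exact hz

variable [IsLocallyNoetherian X]

lemma ord_algebraMap {x : X} (hx : Order.coheight x = 1) {r : X.presheaf.stalk x} (hr : r ≠ 0)
    {n : ℕ} (hn : Ring.ord (X.presheaf.stalk x) r = n) :
    Scheme.ord (algebraMap _ X.functionField r) x = n := by
  have : Ring.KrullDimLE 1 (X.presheaf.stalk x) := krullDimLE_of_coheight_le hx.le
  have h0 : algebraMap _ X.functionField r ≠ 0 :=
    (map_ne_zero_iff _ (FaithfulSMul.algebraMap_injective _ _)).mpr hr
  rw [Scheme.ord_eq_iff hx h0]
  refine (Ring.ordFrac_eq_ord _ hr).trans ?_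
  rw [Ring.ordMonoidWithZeroHom_eq_ord (mem_nonZeroDivisors_iff_ne_zero.mpr hr)]
  simp [hn]

lemma exists_ord_eq {x : X} (hx : Order.coheight x = 1) {r : X.presheaf.stalk x} (hr : r ≠ 0) :
    ∃ n : ℕ, Ring.ord (X.presheaf.stalk x) r = n := by
  have : Ring.KrullDimLE 1 (X.presheaf.stalk x) := krullDimLE_of_coheight_le hx.le
  obtain ⟨n, hn⟩ := ENat.ne_top_iff_exists.mp
    (Ring.ord_ne_top (R := X.presheaf.stalk x) (mem_nonZeroDivisors_iff_ne_zero.mpr hr))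
  exact ⟨n, hn.symm⟩

lemma ord_nonneg {x : X} {z : X.functionField}
    (hz : z ∈ (algebraMap (X.presheaf.stalk x) X.functionField).range) :
    0 ≤ Scheme.ord z x := by
  by_cases hx : Order.coheight x = 1
  · obtain ⟨r, rfl⟩ := hz
    by_cases hr : r = 0
    · simp [hr]
    obtain ⟨n, hn⟩ := exists_ord_eq hx hr
    rw [ord_algebraMap hx hr hn]
    positivity
  · rw [Scheme.ord_eq_zero_of_coheight_neq_one hx]

lemma ord_pos {x : X} (hx : Order.coheight x = 1) {r : X.presheaf.stalk x} (hr : r ≠ 0)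
    (hu : ¬ IsUnit r) : 0 < Scheme.ord (algebraMap _ X.functionField r) x := by
  obtain ⟨n, hn⟩ := exists_ord_eq hx hr
  rw [ord_algebraMap hx hr hn]
  rcases Nat.eq_zero_or_pos n with rfl | h
  · exfalso
    rw [Ring.ord, Nat.cast_zero, Module.length_eq_zero_iff] at hn
    exact hu (by rwa [Ideal.Quotient.subsingleton_iff, Ideal.span_singleton_eq_top] at hn)
  · exact_mod_cast h

lemma ord_eq_zero {x : X} {r : X.presheaf.stalk x} (hu : IsUnit r) :
    Scheme.ord (algebraMap _ X.functionField r) x = 0 := by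
  by_cases hx : Order.coheight x = 1
  · exact ord_algebraMap hx hu.ne_zero (n := 0) (Ring.ord_of_isUnit hu)
  · rw [Scheme.ord_eq_zero_of_coheight_neq_one hx]

/-- The order of `r` is the length of the local ring modulo `r`, which here is the residue field and
hence simple. -/
lemma ord_eq_one {x : X} (hx : Order.coheight x = 1) {r : X.presheaf.stalk x} (hr : r ≠ 0)
    (hm : IsLocalRing.maximalIdeal (X.presheaf.stalk x) = Ideal.span {r}) :
    Scheme.ord (algebraMap _ X.functionField r) x = 1 := by
  refine ord_algebraMap hx hr (n := 1) ?_
  rw [Ring.ord, Nat.cast_one, Module.length_eq_one_iff, ← hm]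
  rw [isSimpleModule_iff_isSimpleModule_of_algebraMap_surjective
    (S := X.presheaf.stalk x ⧸ IsLocalRing.maximalIdeal (X.presheaf.stalk x))
    Ideal.Quotient.mk_surjective]
  let := Ideal.Quotient.field (IsLocalRing.maximalIdeal (X.presheaf.stalk x))
  infer_instance

lemma ord_inv (x : X) (z : X.functionField) : Scheme.ord z⁻¹ x = - Scheme.ord z x := by
  by_cases hz : z = 0
  · simp [hz]
  have h := Scheme.ord_mul (x := x) hz (inv_ne_zero hz)
  rw [mul_inv_cancel₀ hz] at h
  have h1 : Scheme.ord (1 : X.functionField) x = 0 := by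
    rw [← map_one (algebraMap (X.presheaf.stalk x) X.functionField)]
    exact ord_eq_zero isUnit_one
  rw [h1] at h
  omega

lemma ord_pow (x : X) (z : X.functionField) (n : ℕ) :
    Scheme.ord (z ^ n) x = n * Scheme.ord z x := by
  by_cases hz : z = 0
  · rcases Nat.eq_zero_or_pos n with rfl | h
    · rw [pow_zero, ← map_one (algebraMap (X.presheaf.stalk x) X.functionField),
        ord_eq_zero isUnit_one]
      simp
    · simp [hz, h.ne']
  induction n with
  | zero =>
    rw [pow_zero, ← map_one (algebraMap (X.presheaf.stalk x) X.functionField),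
        ord_eq_zero isUnit_one]
    simp
  | succ n ih =>
    rw [pow_succ, Scheme.ord_mul (pow_ne_zero _ hz) hz, ih]
    push_cast
    ring

lemma ord_zpow (x : X) (z : X.functionField) (n : ℤ) :
    Scheme.ord (z ^ n) x = n * Scheme.ord z x := by
  obtain ⟨k, rfl | rfl⟩ := n.eq_nat_or_neg
  · rw [zpow_natCast, ord_pow]
  · rw [zpow_neg, ord_inv, zpow_natCast, ord_pow]
    ring

lemma ord_neg (x : X) (z : X.functionField) : Scheme.ord (-z) x = Scheme.ord z x := by
  by_cases hz : z = 0
  · simp [hz]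
  rw [neg_eq_neg_one_mul, Scheme.ord_mul (neg_ne_zero.mpr one_ne_zero) hz,
    ← map_one (algebraMap (X.presheaf.stalk x) X.functionField), ← map_neg,
    ord_eq_zero isUnit_one.neg, zero_add]

end Order

/-! ### Monotonicity of the degree under injections of equal rank. -/

section Comparison
variable {X : Scheme.{u}} [IsIntegral X]

lemma IsLocalBasis.mem_range {M : X.Modules} {x : X} {n : ℕ}
    {b : Module.Basis (Fin n) X.functionField (genStalk M)} (hb : IsLocalBasis M x b) (i : Fin n) :
    b i ∈ (toGenStalk M x).range := by
  rw [hb]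
  intro j
  rw [b.repr_self, Finsupp.single_apply]
  split_ifs
  exacts [⟨1, map_one _⟩, ⟨0, map_zero _⟩]

/-- All entries of the coordinate matrix lie in `𝒪_x`. This integrality is the source of the
inequality between degrees. -/
lemma IsLocalBasis.det_mem_range {M : X.Modules} {x : X} {n : ℕ}
    {b : Module.Basis (Fin n) X.functionField (genStalk M)} (hb : IsLocalBasis M x b)
    {v : Fin n → genStalk M} (hv : ∀ i, v i ∈ (toGenStalk M x).range) :
    b.det v ∈ (algebraMap (X.presheaf.stalk x) X.functionField).range := by
  choose c hc using fun i j => (hb (v j)).mp (hv j) i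
  refine ⟨Matrix.det (Matrix.of c), ?_⟩
  rw [RingHom.map_det, Module.Basis.det_apply]
  congr 1
  ext i j
  exact hc i j

variable [IsLocallyNoetherian X]

lemma det_mul_det {V ι F : Type*} [Field F] [AddCommGroup V] [Module F V] [Fintype ι]
    [DecidableEq ι] (b c : Module.Basis ι F V) (v : ι → V) :
    b.det v = b.det c * c.det v := by
  rw [Module.Basis.det_apply, Module.Basis.det_apply, Module.Basis.det_apply, ← Matrix.det_mul,
    Module.Basis.toMatrix_mul_toMatrix]

omit [IsIntegral X] [IsLocallyNoetherian X] in
lemma sum_mul_le_add (w : X → ℕ) {D D' P : X →₀ ℤ} (h : ∀ x, D x ≤ D' x + P x) :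
    D.sum (fun x k => k * (w x : ℤ)) ≤
      D'.sum (fun x k => k * (w x : ℤ)) + P.sum (fun x k => k * (w x : ℤ)) := by
  classical
  have h1 : ∀ Q : X →₀ ℤ, Q.support ⊆ D.support ∪ D'.support ∪ P.support →
      Q.sum (fun x k => k * (w x : ℤ)) = ∑ x ∈ D.support ∪ D'.support ∪ P.support, Q x * (w x : ℤ) :=
    fun Q hQ => Finsupp.sum_of_support_subset _ hQ _ (by simp)
  rw [h1 D (fun x hx => by simp only [Finset.mem_union]; tauto),
    h1 D' (fun x hx => by simp only [Finset.mem_union]; tauto),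
    h1 P (fun x hx => by simp only [Finset.mem_union]; tauto), ← Finset.sum_add_distrib]
  refine Finset.sum_le_sum fun x _ => ?_
  rw [← add_mul]
  exact mul_le_mul_of_nonneg_right (h x) (by positivity)

/-- The degree does not decrease along an injection between sheaves of the same rank, provided
principal divisors have degree zero. -/
lemma HasDegree.le_of_injective {w : X → ℕ} (hw : ∀ h : X.functionField, h ≠ 0 →
      ∃ P : X →₀ ℤ, (∀ x, P x = Scheme.ord h x) ∧ P.sum (fun x k => k * (w x : ℤ)) = 0)
    {M N : X.Modules} (φ : M ⟶ N) (hφ : Function.Injective (genHom φ)) (hr : rank M = rank N)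
    {t s : ℤ} (hM : HasDegree w M t) (hN : HasDegree w N s) : t ≤ s := by
  classical
  obtain ⟨n, e, D, hD0, hD, rfl⟩ := hM
  obtain ⟨n', e', D', hD0', hD', rfl⟩ := hN
  obtain rfl : n = n' := by
    rw [rank, rank, Module.finrank_eq_card_basis e, Module.finrank_eq_card_basis e'] at hr
    simpa using hr
  have := Module.Basis.finiteDimensional_of_finite e
  have := Module.Basis.finiteDimensional_of_finite e'
  let ψ : genStalk M ≃ₗ[X.functionField] genStalk N :=
    LinearEquiv.ofInjectiveOfFinrankEq (genHom φ) hφ hr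
  have hψ : ∀ m, ψ m = genHom φ m := fun m => rfl
  have hne : ∀ b c : Module.Basis (Fin n) X.functionField (genStalk N), b.det c ≠ 0 :=
    fun b c => (Module.Basis.isUnit_det b c).ne_zero
  -- The chosen rational bases of the two sheaves differ by a determinant whose divisor `P` has
  -- degree zero, so the choice does not affect the comparison.
  obtain ⟨P, hP, hP0⟩ := hw (e'.det (e.map ψ)) (hne _ _)
  have key : ∀ x, D x ≤ D' x + P x := by
    intro x
    by_cases hx : Order.coheight x = 1
    · obtain ⟨b, hb, h1⟩ := hD x hx
      obtain ⟨b', hb', h1'⟩ := hD' x hx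
      -- The determinant of `ψ e` with respect to `b'` is computed through `e'` and through `ψ b`.
      -- This gives `D' x + P x = ord (det_{b'} ψ b) + D x`, and the first summand on the right is
      -- nonnegative since `φ` maps stalks to stalks.
      rw [h1, h1', hP, ← Scheme.ord_mul (hne _ _) (hne _ _), ← det_mul_det,
        det_mul_det b' (b.map ψ), Scheme.ord_mul (hne _ _) (hne _ _)]
      have h2 : (b.map ψ).det (e.map ψ) = b.det e := by
        rw [Module.Basis.det_map]
        congr 1
        funext i
        simp
      rw [h2]
      have h3 := ord_nonneg (hb'.det_mem_range (v := b.map ψ) fun i => by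
        rw [Module.Basis.map_apply, hψ]
        exact genHom_mem_range φ x (hb.mem_range i))
      omega
    · rw [hD0 x hx, hD0' x hx, hP, Scheme.ord_eq_zero_of_coheight_neq_one hx, add_zero]
  have h2 := sum_mul_le_add w key
  omega

end Comparison

/-! ### Values of sections in the fraction field of the graded ring. -/

section Values
variable {A σ : Type u} [CommRing A] [IsDomain A] [SetLike σ A] [AddSubgroupClass σ A]
variable (𝒜 : ℕ → σ) [GradedRing 𝒜]

variable {𝒜} in
/-- The embedding of the local ring at a point in the fraction field of the graded ring. -/
def locToFrac (x : ProjectiveSpectrum 𝒜) : LocAt 𝒜 x →+* FractionRing A :=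
  IsLocalization.lift (M := x.asHomogeneousIdeal.toIdeal.primeCompl)
    (g := algebraMap A (FractionRing A)) fun y => IsUnit.mk0 _ fun h => y.2 (by
      rw [map_eq_zero_iff _ (IsFractionRing.injective A (FractionRing A))] at h
      rw [h]
      exact zero_mem _)

variable {𝒜}
variable {n m : ℤ} {U V : (Proj 𝒜).Opens}

lemma locToFrac_algebraMap (x : ProjectiveSpectrum 𝒜) (a : A) :
    locToFrac x (algebraMap A _ a) = algebraMap A (FractionRing A) a :=
  IsLocalization.lift_eq _ _

lemma locToFrac_mk (x : ProjectiveSpectrum 𝒜) (a : A)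
    (s : x.asHomogeneousIdeal.toIdeal.primeCompl) : locToFrac x (Localization.mk a s) =
      algebraMap A (FractionRing A) a / algebraMap A (FractionRing A) s := by
  have hs : algebraMap A (FractionRing A) s ≠ 0 := fun h => s.2 (by
      rw [map_eq_zero_iff _ (IsFractionRing.injective A (FractionRing A))] at h
      rw [h]
      exact zero_mem _)
  rw [eq_div_iff hs, ← locToFrac_algebraMap x, ← locToFrac_algebraMap x, ← map_mul,
    Localization.mk_eq_mk', IsLocalization.mk'_spec]

lemma locToFrac_injective (x : ProjectiveSpectrum 𝒜) : Function.Injective (locToFrac x) := by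
  refine IsLocalization.lift_injective_iff _ |>.mpr fun a b => ?_
  rw [(IsFractionRing.injective A (FractionRing A)).eq_iff,
    (IsLocalization.injective (LocAt 𝒜 x)
      x.asHomogeneousIdeal.toIdeal.primeCompl_le_nonZeroDivisors).eq_iff]

lemma locToFrac_locPow (x : ProjectiveSpectrum 𝒜) (g : A)
    (hg : g ∉ x.asHomogeneousIdeal.toIdeal) (n : ℤ) :
    locToFrac x (locPow x g hg n) = algebraMap A (FractionRing A) g ^ n := by
  obtain ⟨k, rfl | rfl⟩ := n.eq_nat_or_neg
  · rw [locPow_natCast, locToFrac_algebraMap, map_pow, zpow_natCast]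
  · have h := congrArg (locToFrac x) (locPow_neg_mul hg (k : ℤ))
    rw [map_mul, map_one, locPow_natCast, locToFrac_algebraMap, map_pow] at h
    rw [zpow_neg, zpow_natCast]
    exact eq_inv_of_mul_eq_one_left h

omit [IsDomain A] in
lemma exists_twistVal_eq_mk (f : Γ(twist 𝒜 n, U)) (x : ProjectiveSpectrum 𝒜) (hx : x ∈ U) :
    ∃ (V : (Proj 𝒜).Opens) (hV : V ≤ U) (_ : x ∈ V) (i j : ℕ) (_ : (i : ℤ) = j + n) (r s : A)
      (_ : r ∈ 𝒜 i) (_ : s ∈ 𝒜 j)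
      (hs : ∀ y : ProjectiveSpectrum 𝒜, y ∈ V → s ∈ y.asHomogeneousIdeal.toIdeal.primeCompl),
      ∀ (y : ProjectiveSpectrum 𝒜) (hy : y ∈ V), twistVal f y (mem_of_le hV hy) =
        Localization.mk r ⟨s, hs y hy⟩ := by
  obtain ⟨V, hV, iV, i, j, hij, r, s, hr, hs, hx, h⟩ :=
    (show twistSections 𝒜 n U from f).2 ⟨x, hx⟩
  exact ⟨V, iV.le, hV, i, j, hij, r, s, hr, hs, fun y hy => hx ⟨y, hy⟩, fun y hy => h ⟨y, hy⟩⟩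

omit [IsDomain A] in
lemma exists_funVal_eq_mk (f : Γ(Proj 𝒜, U)) (x : ProjectiveSpectrum 𝒜) (hx : x ∈ U) :
    ∃ (V : (Proj 𝒜).Opens) (hV : V ≤ U) (_ : x ∈ V) (r s : A)
      (hs : ∀ y : ProjectiveSpectrum 𝒜, y ∈ V → s ∈ y.asHomogeneousIdeal.toIdeal.primeCompl),
      ∀ (y : ProjectiveSpectrum 𝒜) (hy : y ∈ V), funVal f y (mem_of_le hV hy) =
        Localization.mk r ⟨s, hs y hy⟩ := by
  obtain ⟨V, hV, iV, i, ⟨r, hr⟩, ⟨s, hs⟩, hx, h⟩ :=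
    (show (ProjectiveSpectrum.Proj.structureSheaf 𝒜).1.obj (op U) from f).2 ⟨x, hx⟩
  exact ⟨V, iV.le, hV, r, s, fun y hy => hx ⟨y, hy⟩,
    fun y hy => congrArg HomogeneousLocalization.val (h ⟨y, hy⟩)⟩

/-- The value of a germ of functions. -/
def stalkVal (x : ProjectiveSpectrum 𝒜) : (Proj 𝒜).presheaf.stalk x →+* FractionRing A :=
  (locToFrac x).comp ((algebraMap (HomogeneousLocalization.AtPrime 𝒜 x.asHomogeneousIdeal.toIdeal)
    (LocAt 𝒜 x)).comp (Proj.stalkIso' 𝒜 x).toRingHom)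

lemma stalkVal_fgerm (x : ProjectiveSpectrum 𝒜) (hx : x ∈ U) (f : Γ(Proj 𝒜, U)) :
    stalkVal x (fgerm (X := Proj 𝒜) x hx f) = locToFrac x (funVal f x hx) :=
  congrArg (fun z => locToFrac x (HomogeneousLocalization.val z)) (Proj.stalkIso'_germ 𝒜 U x hx f)

lemma stalkVal_injective (x : ProjectiveSpectrum 𝒜) : Function.Injective (stalkVal x) :=
  (locToFrac_injective x).comp ((HomogeneousLocalization.val_injective _).comp
    (Proj.stalkIso' 𝒜 x).injective)

/-- Homogeneous fractions of degree zero are germs of functions. -/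
lemma exists_stalkVal_eq (x : ProjectiveSpectrum 𝒜) {k : ℕ} {a b : A} (ha : a ∈ 𝒜 k) (hb : b ∈ 𝒜 k)
    (hbx : b ∉ x.asHomogeneousIdeal.toIdeal) : ∃ t : (Proj 𝒜).presheaf.stalk x,
      stalkVal x t = algebraMap A (FractionRing A) a / algebraMap A (FractionRing A) b ∧
      (IsUnit t ↔ a ∉ x.asHomogeneousIdeal.toIdeal) := by
  let z : HomogeneousLocalization.AtPrime 𝒜 x.asHomogeneousIdeal.toIdeal :=
    .mk ⟨k, ⟨a, ha⟩, ⟨b, hb⟩, hbx⟩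
  have hz : z.val = Localization.mk a ⟨b, hbx⟩ := rfl
  refine ⟨(Proj.stalkIso' 𝒜 x).symm z, ?_, ?_⟩
  · refine Eq.trans ?_ (locToFrac_mk x a ⟨b, hbx⟩)
    rw [← hz]
    exact congrArg (fun w => locToFrac x (HomogeneousLocalization.val w))
      ((Proj.stalkIso' 𝒜 x).apply_symm_apply z)
  · refine (MulEquiv.isUnit_map (Proj.stalkIso' 𝒜 x).symm).trans ?_
    rw [← HomogeneousLocalization.isUnit_iff_isUnit_val, hz, Localization.mk_eq_mk',
      IsLocalization.AtPrime.isUnit_mk'_iff (LocAt 𝒜 x) x.asHomogeneousIdeal.toIdeal]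
    rfl

lemma exists_stalkVal_eq_div (x : ProjectiveSpectrum 𝒜) (r : (Proj 𝒜).presheaf.stalk x) :
    ∃ (k : ℕ) (a b : A) (_ : a ∈ 𝒜 k) (_ : b ∈ 𝒜 k) (_ : b ∉ x.asHomogeneousIdeal.toIdeal),
      stalkVal x r = algebraMap A (FractionRing A) a / algebraMap A (FractionRing A) b ∧
      (IsUnit r ↔ a ∉ x.asHomogeneousIdeal.toIdeal) := by
  obtain ⟨⟨k, ⟨a, ha⟩, ⟨b, hb⟩, hbx⟩, hz⟩ := HomogeneousLocalization.mk_surjective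
    (Proj.stalkIso' 𝒜 x r)
  obtain ⟨r', h1, h2⟩ := exists_stalkVal_eq x ha hb hbx
  have hv : (Proj.stalkIso' 𝒜 x r).val = Localization.mk a ⟨b, hbx⟩ :=
    (congrArg HomogeneousLocalization.val hz).symm.trans (HomogeneousLocalization.val_mk _)
  have h3 : stalkVal x r = algebraMap A (FractionRing A) a / algebraMap A (FractionRing A) b :=
    (congrArg (locToFrac x) hv).trans (locToFrac_mk x a ⟨b, hbx⟩)
  obtain rfl : r = r' := stalkVal_injective x (h3.trans h1.symm)
  exact ⟨k, a, b, ha, hb, hbx, h3, h2⟩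

section Generic
variable [IsIntegral (Proj 𝒜)]

variable (𝒜) in
/-- The generic point as a homogeneous prime ideal. -/
def genPt : ProjectiveSpectrum 𝒜 := genericPoint (Proj 𝒜)

omit [IsDomain A] in
lemma genPt_mem {x : ProjectiveSpectrum 𝒜} (hx : x ∈ U) : genPt 𝒜 ∈ U :=
  genericPoint_mem (X := Proj 𝒜) hx

/-- Near `x` the section is a single fraction `r / s`, and this neighbourhood contains the generic
point. Hence local sections at different points can be compared inside one field. -/
lemma locToFrac_twistVal (f : Γ(twist 𝒜 n, U)) (x : ProjectiveSpectrum 𝒜) (hx : x ∈ U) :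
    locToFrac (genPt 𝒜) (twistVal f (genPt 𝒜) (genPt_mem hx)) = locToFrac x (twistVal f x hx) := by
  obtain ⟨V, hV, hxV, i, j, hij, r, s, hr, hs, hs', h⟩ := exists_twistVal_eq_mk f x hx
  rw [h x hxV, h _ (genPt_mem hxV), locToFrac_mk, locToFrac_mk]

lemma locToFrac_funVal (f : Γ(Proj 𝒜, U)) (x : ProjectiveSpectrum 𝒜) (hx : x ∈ U) :
    locToFrac (genPt 𝒜) (funVal f (genPt 𝒜) (genPt_mem hx)) = locToFrac x (funVal f x hx) := by
  obtain ⟨V, hV, hxV, r, s, hs', h⟩ := exists_funVal_eq_mk f x hx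
  rw [h x hxV, h _ (genPt_mem hxV), locToFrac_mk, locToFrac_mk]

variable (𝒜) in
/-- The embedding of the function field of `Proj 𝒜` in the fraction field of the graded ring. -/
def fieldVal : (Proj 𝒜).functionField →+* FractionRing A := stalkVal (genPt 𝒜)

lemma fieldVal_fgerm {x : ProjectiveSpectrum 𝒜} (hx : x ∈ U) (f : Γ(Proj 𝒜, U)) :
    fieldVal 𝒜 (fgerm (X := Proj 𝒜) (genericPoint (Proj 𝒜)) (genPt_mem hx) f) =
      locToFrac x (funVal f x hx) :=
  (stalkVal_fgerm (genPt 𝒜) (genPt_mem hx) f).trans (locToFrac_funVal f x hx)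

lemma fieldVal_injective : Function.Injective (fieldVal 𝒜) := (fieldVal 𝒜).injective

lemma fieldVal_algebraMap (x : Proj 𝒜) (t : (Proj 𝒜).presheaf.stalk x) :
    fieldVal 𝒜 (algebraMap ((Proj 𝒜).presheaf.stalk x) (Proj 𝒜).functionField t) = stalkVal (𝒜 := 𝒜) x t := by
  obtain ⟨U, hx, f, rfl⟩ := exists_fgerm_eq (X := Proj 𝒜) x t
  refine (congrArg (fieldVal 𝒜) (algebraMap_fgerm (X := Proj 𝒜) x hx f)).trans ?_
  exact (fieldVal_fgerm hx f).trans (stalkVal_fgerm x hx f).symm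

/-- The element `g` shows that the zero ideal does not contain the irrelevant ideal, so it is a
point of `Proj 𝒜`. The generic point specializes to it, and so its ideal is contained in zero. -/
lemma genPt_eq_bot {g : A} {k : ℕ} (hk : 0 < k) (hg : g ∈ 𝒜 k) (h0 : g ≠ 0) :
    (genPt 𝒜).asHomogeneousIdeal = ⊥ := by
  let η : ProjectiveSpectrum 𝒜 :=
    ⟨⊥, by simpa using Ideal.isPrime_bot, fun h => h0
      (h (HomogeneousIdeal.mem_irrelevant_of_mem _ hk hg) : g ∈ (⊥ : Ideal A))⟩
  have h : η ∈ closure {genPt 𝒜} :=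
    specializes_iff_mem_closure.mp ((genericPoint_spec (Proj 𝒜)).specializes trivial)
  rw [← ProjectiveSpectrum.le_iff_mem_closure] at h
  exact le_bot_iff.mp h

/-- Homogeneous fractions of degree zero are rational functions. -/
lemma exists_fieldVal_eq {k : ℕ} (hk : 0 < k) {a b : A} (ha : a ∈ 𝒜 k) (hb : b ∈ 𝒜 k)
    (hb0 : b ≠ 0) : ∃ z : (Proj 𝒜).functionField,
      fieldVal 𝒜 z = algebraMap A (FractionRing A) a / algebraMap A (FractionRing A) b := by
  obtain ⟨t, ht, -⟩ := exists_stalkVal_eq (genPt 𝒜) ha hb (by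
    rw [genPt_eq_bot hk hb hb0]
    exact hb0)
  exact ⟨t, ht⟩

end Generic

end Values

/-! ### Rational sections of `𝒪(n)` and of syzygy sheaves. -/

section GenericValues
variable {A σ : Type u} [CommRing A] [IsDomain A] [SetLike σ A] [AddSubgroupClass σ A]
variable {𝒜 : ℕ → σ} [GradedRing 𝒜] [IsIntegral (Proj 𝒜)]
variable {n m : ℤ} {U V : (Proj 𝒜).Opens}

omit [IsDomain A] in
lemma eq_of_germ_eq (f : Γ(twist 𝒜 n, U)) (g : Γ(twist 𝒜 n, V)) (hU : genPt 𝒜 ∈ U)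
    (hV : genPt 𝒜 ∈ V) (h : germ (twist 𝒜 n) (genericPoint (Proj 𝒜)) hU f =
      germ (twist 𝒜 n) (genericPoint (Proj 𝒜)) hV g) :
    twistVal f (genPt 𝒜) hU = twistVal g (genPt 𝒜) hV := by
  have hUV : genericPoint (Proj 𝒜) ∈ U ⊓ V := ⟨hU, hV⟩
  obtain ⟨W, hW, hxW, e⟩ := exists_res_eq_of_germ_eq (twist 𝒜 n) (genericPoint (Proj 𝒜)) hUV
    (res _ inf_le_left f) (res _ inf_le_right g) (by rw [germ_res, germ_res, h])
  exact congrArg (fun z => twistVal z (genPt 𝒜) hxW) e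

/-- The value at the generic point of a rational section of `𝒪(n)`. -/
def twistGen (m : genStalk (twist 𝒜 n)) : FractionRing A :=
  locToFrac (genPt 𝒜) (twistVal (exists_germ_eq (twist 𝒜 n) _ m).choose_spec.choose_spec.choose
    (genPt 𝒜) (exists_germ_eq (twist 𝒜 n) _ m).choose_spec.choose)

lemma twistGen_germ {x : ProjectiveSpectrum 𝒜} (hx : x ∈ U) (f : Γ(twist 𝒜 n, U)) :
    twistGen (germ (twist 𝒜 n) (genericPoint (Proj 𝒜)) (genPt_mem hx) f) =
      locToFrac x (twistVal f x hx) := by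
  refine Eq.trans ?_ (locToFrac_twistVal f x hx)
  exact congrArg (locToFrac (genPt 𝒜)) (eq_of_germ_eq _ _ _ _
    (exists_germ_eq (twist 𝒜 n) _ _).choose_spec.choose_spec.choose_spec)

lemma twistGen_add (a b : genStalk (twist 𝒜 n)) : twistGen (a + b) = twistGen a + twistGen b := by
  obtain ⟨U, hU, f, rfl⟩ := exists_germ_eq (twist 𝒜 n) _ a
  obtain ⟨V, hV, g, rfl⟩ := exists_germ_eq (twist 𝒜 n) _ b
  have hUV : genPt 𝒜 ∈ U ⊓ V := ⟨hU, hV⟩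
  have hUV' : genericPoint (Proj 𝒜) ∈ U ⊓ V := hUV
  rw [← germ_res _ (inf_le_left : U ⊓ V ≤ U) _ hUV', ← germ_res _ (inf_le_right : U ⊓ V ≤ V) _ hUV',
    ← germ_add]
  have h := fun f => twistGen_germ (n := n) hUV f
  refine (h _).trans ?_
  refine Eq.trans ?_ (congrArg₂ (· + ·) (h _) (h _)).symm
  exact map_add (locToFrac (genPt 𝒜)) _ _

lemma twistGen_smul (r : (Proj 𝒜).functionField) (b : genStalk (twist 𝒜 n)) :
    twistGen (r • b) = fieldVal 𝒜 r * twistGen b := by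
  obtain ⟨U, hU, f, rfl⟩ := exists_germ_eq (twist 𝒜 n) _ b
  obtain ⟨V, hV, hxV, g, hg⟩ := exists_fgerm_eq_pi hU fun _ : Unit => r
  obtain rfl := hg ()
  rw [← germ_res _ hV _ hxV]
  refine (congrArg twistGen (germ_smul (twist 𝒜 n) _ hxV (g ()) (res _ hV f)).symm).trans ?_
  have h := fun f => twistGen_germ (n := n) (show genPt 𝒜 ∈ V from hxV) f
  refine (h _).trans ?_
  refine Eq.trans ?_ (congrArg₂ (· * ·) (fieldVal_fgerm (show genPt 𝒜 ∈ V from hxV) _) (h _)).symm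
  exact map_mul (locToFrac (genPt 𝒜)) _ _

lemma twistGen_sum {ι : Type*} (t : Finset ι) (b : ι → genStalk (twist 𝒜 n)) :
    twistGen (∑ i ∈ t, b i) = ∑ i ∈ t, twistGen (b i) :=
  map_sum (AddMonoidHom.mk' twistGen twistGen_add) b t

/-- Elements of the stalk of `𝒪(n)` at `x` are homogeneous fractions of degree `n` with
denominator not vanishing at `x`. -/
lemma exists_twistGen_eq {x : Proj 𝒜} {b : genStalk (twist 𝒜 n)}
    (hb : b ∈ (toGenStalk (twist 𝒜 n) x).range) :
    ∃ (i j : ℕ) (_ : (i : ℤ) = j + n) (r s : A) (_ : r ∈ 𝒜 i) (_ : s ∈ 𝒜 j)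
      (_ : s ∉ (show ProjectiveSpectrum 𝒜 from x).asHomogeneousIdeal.toIdeal),
      twistGen b = algebraMap A (FractionRing A) r / algebraMap A (FractionRing A) s := by
  obtain ⟨b, rfl⟩ := hb
  obtain ⟨U, hx, f, rfl⟩ := exists_germ_eq (twist 𝒜 n) _ b
  obtain ⟨V, hV, hxV, i, j, hij, r, s, hr, hs, hs', h⟩ := exists_twistVal_eq_mk f x hx
  refine ⟨i, j, hij, r, s, hr, hs, hs' x hxV, ?_⟩
  refine (congrArg twistGen (toGenStalk_germ (twist 𝒜 n) x hx f)).trans ?_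
  refine (twistGen_germ (show (show ProjectiveSpectrum 𝒜 from x) ∈ U from hx) f).trans ?_
  exact (congrArg (locToFrac _) (h x hxV)).trans (locToFrac_mk _ _ _)

section Syz
variable {ι : Type} [Fintype ι] {c : ℕ} {f : ι → A} {hf : ∀ i, f i ∈ 𝒜 c}

/-- The components at the generic point of a rational section of the syzygy sheaf. -/
def syzGen (b : genStalk (syz 𝒜 f hf m)) (i : ι) : FractionRing A :=
  twistGen (genHom (syzι 𝒜 f hf m i) b)

lemma syzGen_germ {x : ProjectiveSpectrum 𝒜} (hx : x ∈ U) (s : Γ(syz 𝒜 f hf m, U)) (i : ι) :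
    syzGen (germ (syz 𝒜 f hf m) (genericPoint (Proj 𝒜)) (genPt_mem hx) s) i =
      locToFrac x (syzVal 𝒜 f hf m s i x hx) :=
  (congrArg twistGen (stalkHom_germ (syzι 𝒜 f hf m i) _ _ s)).trans (twistGen_germ hx _)

lemma syzGen_smul (r : (Proj 𝒜).functionField) (b : genStalk (syz 𝒜 f hf m)) (i : ι) :
    syzGen (r • b) i = fieldVal 𝒜 r * syzGen b i := by
  rw [syzGen, LinearMap.map_smul, twistGen_smul, syzGen]

lemma syzGen_sum {κ : Type*} (t : Finset κ) (b : κ → genStalk (syz 𝒜 f hf m)) (i : ι) :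
    syzGen (∑ j ∈ t, b j) i = ∑ j ∈ t, syzGen (b j) i := by
  rw [syzGen, map_sum, twistGen_sum]
  rfl

/-- The components of a section at every point embed in the fraction field and coincide there with
the generic ones, so a representing section vanishes everywhere. -/
lemma eq_zero_of_syzGen_eq_zero (b : genStalk (syz 𝒜 f hf m)) (h : ∀ i, syzGen b i = 0) :
    b = 0 := by
  obtain ⟨U, hU, s, rfl⟩ := exists_germ_eq (syz 𝒜 f hf m) _ b
  have : s = 0 := by
    refine syzVal_ext fun i x hx => ?_
    have h0 : syzVal 𝒜 f hf m 0 i x hx = 0 := by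
      rw [syzVal, map_zero]; rfl
    rw [h0]
    refine locToFrac_injective x ((syzGen_germ hx s i).symm.trans ((h i).trans (map_zero _).symm))
  rw [this]
  exact map_zero _

lemma sum_mul_syzGen (b : genStalk (syz 𝒜 f hf m)) :
    ∑ i, algebraMap A (FractionRing A) (f i) * syzGen b i = 0 := by
  obtain ⟨U, hU, s, rfl⟩ := exists_germ_eq (syz 𝒜 f hf m) _ b
  have h := congrArg (locToFrac (genPt 𝒜)) (syzVal_rel s (genPt 𝒜) hU)
  rw [map_sum, map_zero] at h
  refine Eq.trans (Finset.sum_congr rfl fun i _ => ?_) h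
  rw [map_mul, locToFrac_algebraMap]
  exact congrArg _ (syzGen_germ (show genPt 𝒜 ∈ U from hU) s i)

end Syz
end GenericValues

/-! ### Degrees of `𝒪(n)` and of syzygy sheaves in terms of a hyperplane section. -/

section Degree
variable {A σ : Type u} [CommRing A] [IsDomain A] [SetLike σ A] [AddSubgroupClass σ A]
variable {𝒜 : ℕ → σ} [GradedRing 𝒜] [IsIntegral (Proj 𝒜)]
variable (x : Fin 3 → A) (hx : ∀ i, x i ∈ 𝒜 1) (hx0 : ∀ i, x i ≠ 0)
  (hc : ⨆ i, Proj.basicOpen 𝒜 (x i) = ⊤)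

omit [IsIntegral (Proj 𝒜)] [IsDomain A] in
include hx in
lemma noetherianSpace_proj [IsLocallyNoetherian (Proj 𝒜)]
  (hc : ⨆ i, Proj.basicOpen 𝒜 (x i) = ⊤) : NoetherianSpace (Proj 𝒜) := by
  have : CompactSpace (Proj 𝒜) := by
    refine ⟨?_⟩
    have h := isCompact_iUnion fun i => (Proj.isAffineOpen_basicOpen 𝒜 (x i) (hx i)
      one_pos).isCompact
    rw [← Opens.coe_iSup, hc] at h
    exact h
  have : IsNoetherian (Proj 𝒜) := {}
  infer_instance

include hx in
lemma genericPoint_mem_basicOpen {i : Fin 3} (hx0 : x i ≠ 0) :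
    genericPoint (Proj 𝒜) ∈ Proj.basicOpen 𝒜 (x i) := by
  change x i ∉ (genPt 𝒜).asHomogeneousIdeal
  rw [genPt_eq_bot one_pos (hx i) hx0]
  exact hx0

/-- The rational function `x j / x i`. -/
def ratio (i j : Fin 3) : (Proj 𝒜).functionField :=
  (exists_fieldVal_eq one_pos (hx j) (hx i) (hx0 i)).choose

lemma fieldVal_ratio (i j : Fin 3) : fieldVal 𝒜 (ratio x hx hx0 i j) =
    algebraMap A (FractionRing A) (x j) / algebraMap A (FractionRing A) (x i) :=
  (exists_fieldVal_eq one_pos (hx j) (hx i) (hx0 i)).choose_spec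

omit [IsDomain A] in
lemma algebraMap_ne_zero_of {a : A} (h : a ≠ 0) : algebraMap A (FractionRing A) a ≠ 0 := by
  rwa [Ne, map_eq_zero_iff _ (IsFractionRing.injective A (FractionRing A))]

lemma ratio_ne_zero (i j : Fin 3) : ratio x hx hx0 i j ≠ 0 := by
  intro h
  have h1 := fieldVal_ratio x hx hx0 i j
  rw [h, map_zero, eq_comm, div_eq_zero_iff] at h1
  rcases h1 with h1 | h1
  exacts [algebraMap_ne_zero_of (hx0 _) h1, algebraMap_ne_zero_of (hx0 _) h1]

variable [IsLocallyNoetherian (Proj 𝒜)]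

lemma ord_ratio_eq_zero (i j : Fin 3) {y : Proj 𝒜} (hi : y ∈ Proj.basicOpen 𝒜 (x i))
    (hj : y ∈ Proj.basicOpen 𝒜 (x j)) : Scheme.ord (ratio x hx hx0 i j) y = 0 := by
  obtain ⟨t, ht, hu⟩ := exists_stalkVal_eq (show ProjectiveSpectrum 𝒜 from y) (hx j) (hx i) hi
  have : ratio x hx hx0 i j = algebraMap ((Proj 𝒜).presheaf.stalk y) _ t := by
    refine fieldVal_injective ?_
    rw [fieldVal_ratio, fieldVal_algebraMap]
    exact ht.symm
  rw [this]
  exact ord_eq_zero (hu.mpr hj)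

omit [IsDomain A] [IsIntegral (Proj 𝒜)] [IsLocallyNoetherian (Proj 𝒜)] in
include hc in
lemma exists_mem_basicOpen (y : Proj 𝒜) : ∃ i, y ∈ Proj.basicOpen 𝒜 (x i) := by
  have : y ∈ ⨆ i, Proj.basicOpen 𝒜 (x i) := by rw [hc]; trivial
  exact Opens.mem_iSup.mp this

/-- An index with `x i ≠ 0` at a point. -/
def chartIdx (y : Proj 𝒜) : Fin 3 := (exists_mem_basicOpen x hc y).choose

omit [IsDomain A] [IsIntegral (Proj 𝒜)] [IsLocallyNoetherian (Proj 𝒜)] in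
lemma mem_chartIdx (y : Proj 𝒜) : y ∈ Proj.basicOpen 𝒜 (x (chartIdx x hc y)) :=
  (exists_mem_basicOpen x hc y).choose_spec

/-- The divisor of the section `x 0` of `𝒪(1)`. -/
def hyperplane : Proj 𝒜 →₀ ℤ :=
  have := noetherianSpace_proj x hx hc
  Finsupp.onFinset (finite_coheight_eq_one (X := Proj 𝒜)
    (genericPoint_mem_basicOpen x hx (hx0 0))).toFinset
    (fun y => Scheme.ord (ratio x hx hx0 (chartIdx x hc y) 0) y) (by
      intro y hy
      rw [Set.Finite.mem_toFinset]
      refine ⟨?_, fun h => hy (ord_ratio_eq_zero x hx hx0 _ _ (mem_chartIdx x hc y) h)⟩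
      by_contra h
      exact hy (Scheme.ord_eq_zero_of_coheight_neq_one h _))

lemma hyperplane_apply (y : Proj 𝒜) : hyperplane x hx hx0 hc y =
    Scheme.ord (ratio x hx hx0 (chartIdx x hc y) 0) y := rfl

/-- The degree of the divisor of the section `x 0` of `𝒪(1)`. -/
def hyperplaneDegree (w : Proj 𝒜 → ℕ) : ℤ :=
  (hyperplane x hx hx0 hc).sum fun y k => k * (w y : ℤ)

/-- The basis over `x 0 ≠ 0` serves as the rational basis, and at each point the basis of a chart
serves as the local one. The orders of the transition determinants are then `N` times those of `x 0
/ x i`. The sign does not matter, since `-1` is a unit. -/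
lemma hasDegree_of_det_eq (w : Proj 𝒜 → ℕ) {M : (Proj 𝒜).Modules} {n : ℕ}
    {s : ∀ i, Fin n → Γ(M, Proj.basicOpen 𝒜 (x i))} (hs : ∀ i, IsSectionBasis M (s i)) (N : ℤ)
    (h : ∀ i, let d := fieldVal 𝒜 (((hs i).genBasis (genericPoint_mem_basicOpen x hx (hx0 i))).det
        ((hs 0).genBasis (genericPoint_mem_basicOpen x hx (hx0 0))))
      d = (algebraMap A (FractionRing A) (x 0) / algebraMap A (FractionRing A) (x i)) ^ N ∨
      d = - (algebraMap A (FractionRing A) (x 0) / algebraMap A (FractionRing A) (x i)) ^ N) :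
    HasDegree w M (N * hyperplaneDegree x hx hx0 hc w) := by
  refine ⟨n, (hs 0).genBasis (genericPoint_mem_basicOpen x hx (hx0 0)),
    N • hyperplane x hx hx0 hc, fun y hy => ?_, fun y hy => ?_, ?_⟩
  · rw [Finsupp.smul_apply, hyperplane_apply, Scheme.ord_eq_zero_of_coheight_neq_one hy, smul_zero]
  · refine ⟨(hs (chartIdx x hc y)).genBasis (genericPoint_mem_basicOpen x hx (hx0 _)),
      (hs _).isLocalBasis _ (mem_chartIdx x hc y), ?_⟩
    rw [Finsupp.smul_apply, hyperplane_apply, smul_eq_mul, ← ord_zpow]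
    have h1 := h (chartIdx x hc y)
    rw [← fieldVal_ratio x hx hx0, ← map_zpow₀, ← map_neg] at h1
    rcases h1 with h1 | h1
    · rw [fieldVal_injective h1]
    · rw [fieldVal_injective h1, ord_neg]
  · rw [hyperplaneDegree, Finsupp.sum_smul_index' (by simp), Finsupp.mul_sum]
    simp [mul_assoc]

lemma hasDegree_twist (w : Proj 𝒜 → ℕ) (n : ℤ) :
    HasDegree w (twist 𝒜 n) (n * hyperplaneDegree x hx hx0 hc w) := by
  refine hasDegree_of_det_eq x hx hx0 hc w (fun i => isSectionBasis_powSection (hx i) n) n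
    fun i => Or.inl ?_
  have hη := fun i => genericPoint_mem_basicOpen x hx (hx0 i)
  have key : ∀ i, twistGen ((isSectionBasis_powSection (hx i) n).genBasis (hη i) 0) =
      algebraMap A (FractionRing A) (x i) ^ n := by
    intro i
    rw [IsSectionBasis.genBasis_apply]
    refine (twistGen_germ (show genPt 𝒜 ∈ _ from hη i) _).trans ?_
    rw [twistVal_powSection, locToFrac_locPow]
  rw [Module.Basis.det_apply, Matrix.det_fin_one, Module.Basis.toMatrix_apply]
  have h := congrArg twistGen (((isSectionBasis_powSection (hx i) n).genBasis (hη i)).sum_repr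
    ((isSectionBasis_powSection (hx 0) n).genBasis (hη 0) 0))
  rw [Fin.sum_univ_one, twistGen_smul, key, key] at h
  rw [div_zpow, eq_div_iff (zpow_ne_zero _ (algebraMap_ne_zero_of (hx0 i)))]
  exact h

lemma hasDegree_syz (w : Proj 𝒜 → ℕ) {c : ℕ} (f : Fin 3 → A) (hf : ∀ i, f i ∈ 𝒜 c)
    (hfx : ∀ i, f i = x i ^ c) (m : ℤ) :
    HasDegree w (syz 𝒜 f hf m) ((2 * m - 3 * c) * hyperplaneDegree x hx hx0 hc w) := by
  refine hasDegree_of_det_eq x hx hx0 hc w (isSectionBasis_koszul 𝒜 f hf m hx hfx) _ fun i => ?_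
  have hη := fun i => genericPoint_mem_basicOpen x hx (hx0 i)
  have hη' : ∀ i, x i ∉ (genPt 𝒜).asHomogeneousIdeal.toIdeal := hη
  set b := fun i => (isSectionBasis_koszul 𝒜 f hf m hx hfx i).genBasis (hη i)
  have key : ∀ i j k, syzGen (b i j) k =
      locToFrac (genPt 𝒜) (koszulVal 𝒜 (c := c) f m x i j k (genPt 𝒜) (hη' i)) := by
    intro i j k
    simp only [b, IsSectionBasis.genBasis_apply]
    refine (syzGen_germ (show genPt 𝒜 ∈ _ from hη i) _ _).trans ?_
    rw [syzVal_koszul]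
  set y := fun i => algebraMap A (FractionRing A) (x i)
  have hy : ∀ i, y i ≠ 0 := fun i => algebraMap_ne_zero_of (hx0 i)
  -- Away from the component `i`, the basis `b i` is the standard one times `x i ^ (m - c)`, so
  -- transition coefficients are read off those components.
  have h1 : ∀ j l, fieldVal 𝒜 ((b i).repr (b 0 j) l) = syzGen (b 0 j) (i.succAbove l) /
      y i ^ (m - c) := by
    intro j l
    rw [eq_div_iff (zpow_ne_zero _ (hy i))]
    conv_rhs => rw [← (b i).sum_repr (b 0 j)]
    rw [syzGen_sum, Finset.sum_eq_single l]
    · rw [syzGen_smul, key, koszulVal_succAbove, if_pos rfl, locToFrac_locPow]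
    · intro l' _ hl
      rw [syzGen_smul, key, koszulVal_succAbove, if_neg hl.symm, map_zero, mul_zero]
    · simp
  have h2 : ∀ j l : Fin 2, syzGen (b 0 j) ((0 : Fin 3).succAbove l) =
      if l = j then y 0 ^ (m - c) else 0 := by
    intro j l
    rw [key, koszulVal_succAbove]
    split_ifs
    · rw [locToFrac_locPow]
    · rw [map_zero]
  have h3 : ∀ j : Fin 2, syzGen (b 0 j) 0 =
      - (y ((0 : Fin 3).succAbove j) ^ c * y 0 ^ (m - c - c)) := by
    intro j
    rw [key, koszulVal_self, map_neg, map_mul, locToFrac_locPow, locToFrac_algebraMap, hfx, map_pow]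
  -- For `i ≠ 0` the determinant is, up to sign, the entry `-(y i ^ c * y 0 ^ (m - 2c))` of one
  -- Koszul syzygy times the entry `y 0 ^ (m - c)` of the other, over `y i ^ (2m - 2c)`. The
  -- exponent `2m - 3c` appears here.
  have h4 : ∀ i, y i ^ c * (y 0 ^ (m - c - c) * y 0 ^ (m - c)) / (y i ^ (m - c) * y i ^ (m - c)) =
      (y 0 / y i) ^ (2 * m - 3 * c) := by
    intro i
    rw [div_zpow, ← zpow_add₀ (hy 0), ← zpow_add₀ (hy i), div_eq_div_iff
      (zpow_ne_zero _ (hy i)) (zpow_ne_zero _ (hy i)), ← zpow_natCast, mul_right_comm,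
      ← zpow_add₀ (hy i), mul_comm]
    ring_nf
  change (let d := fieldVal 𝒜 ((b i).det (b 0)); _)
  rw [Module.Basis.det_apply, Matrix.det_fin_two]
  simp only [Module.Basis.toMatrix_apply, map_sub, map_mul, h1]
  have c00 : syzGen (b 0 0) 0 = - (y 1 ^ c * y 0 ^ (m - c - c)) := h3 0
  have c10 : syzGen (b 0 1) 0 = - (y 2 ^ c * y 0 ^ (m - c - c)) := h3 1
  have c01 : syzGen (b 0 0) 1 = y 0 ^ (m - c) := (h2 0 0).trans (if_pos rfl)
  have c12 : syzGen (b 0 1) 2 = y 0 ^ (m - c) := (h2 1 1).trans (if_pos rfl)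
  have c02 : syzGen (b 0 0) 2 = 0 := (h2 0 1).trans (if_neg (by decide))
  have c11 : syzGen (b 0 1) 1 = 0 := (h2 1 0).trans (if_neg (by decide))
  fin_cases i
  · left
    change syzGen (b 0 0) 1 / y 0 ^ (m - c) * (syzGen (b 0 1) 2 / y 0 ^ (m - c)) -
      syzGen (b 0 1) 1 / y 0 ^ (m - c) * (syzGen (b 0 0) 2 / y 0 ^ (m - c)) = (y 0 / y 0) ^ _
    rw [c01, c12, c02, c11, div_self (hy 0), one_zpow, div_self (zpow_ne_zero _ (hy 0))]
    ring
  · right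
    change syzGen (b 0 0) 0 / y 1 ^ (m - c) * (syzGen (b 0 1) 2 / y 1 ^ (m - c)) -
      syzGen (b 0 1) 0 / y 1 ^ (m - c) * (syzGen (b 0 0) 2 / y 1 ^ (m - c)) = - (y 0 / y 1) ^ _
    rw [c00, c12, c02, ← h4]
    ring
  · left
    change syzGen (b 0 0) 0 / y 2 ^ (m - c) * (syzGen (b 0 1) 1 / y 2 ^ (m - c)) -
      syzGen (b 0 1) 0 / y 2 ^ (m - c) * (syzGen (b 0 0) 1 / y 2 ^ (m - c)) = (y 0 / y 2) ^ _
    rw [c10, c11, c01, ← h4]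
    ring

end Degree

/-! ### Factors of homogeneous polynomials. -/

section HomogeneousFactors
variable {K : Type u} [Field K] {σ : Type*}

/-- The substitution `X i ↦ X i * T`. -/
def homogenizer : MvPolynomial σ K →ₐ[K] Polynomial (MvPolynomial σ K) :=
  MvPolynomial.aeval fun i => Polynomial.C (MvPolynomial.X i) * Polynomial.X

lemma homogenizer_monomial (m : σ →₀ ℕ) (a : K) :
    homogenizer (MvPolynomial.monomial m a) =
      Polynomial.C (MvPolynomial.monomial m a) * Polynomial.X ^ m.degree := by
  rw [homogenizer, MvPolynomial.aeval_monomial]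
  simp only [mul_pow, Finsupp.prod_mul]
  have h : (m.prod fun _ k => (Polynomial.X : Polynomial (MvPolynomial σ K)) ^ k) =
      Polynomial.X ^ m.degree := Finset.prod_pow_eq_pow_sum _ _ _
  have h' : (m.prod fun i k => (Polynomial.C (MvPolynomial.X i : MvPolynomial σ K)) ^ k) =
      Polynomial.C (m.prod fun i k => (MvPolynomial.X i : MvPolynomial σ K) ^ k) := by
    simp only [Finsupp.prod, map_prod, map_pow]
  rw [MvPolynomial.monomial_eq, map_mul, h, h', mul_assoc]
  rfl

lemma homogenizer_of_isHomogeneous {f : MvPolynomial σ K} {n : ℕ} (hf : f.IsHomogeneous n) :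
    homogenizer f = Polynomial.C f * Polynomial.X ^ n := by
  conv_lhs => rw [f.as_sum]
  conv_rhs => rw [f.as_sum]
  rw [map_sum, map_sum, Finset.sum_mul]
  refine Finset.sum_congr rfl fun m hm => ?_
  rw [homogenizer_monomial]
  congr 2
  have := hf (MvPolynomial.mem_support_iff.mp hm)
  rwa [Finsupp.degree_eq_weight_one]

/-- The exponent of the new variable `T` records the degree, so homogeneity of `f` means that
`homogenizer f` is a single term in `T`. -/
lemma coeff_homogenizer (f : MvPolynomial σ K) (n : ℕ) :
    (homogenizer f).coeff n = MvPolynomial.homogeneousComponent n f := by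
  conv_lhs => rw [← MvPolynomial.sum_homogeneousComponent f, map_sum, Polynomial.finsetSum_coeff]
  simp only [homogenizer_of_isHomogeneous (MvPolynomial.homogeneousComponent_isHomogeneous _ f),
    Polynomial.coeff_C_mul_X_pow]
  rw [Finset.sum_ite_eq]
  split_ifs with h
  · rfl
  · rw [MvPolynomial.homogeneousComponent_eq_zero]
    simpa using h

lemma homogenizer_injective : Function.Injective (homogenizer (K := K) (σ := σ)) := by
  rw [injective_iff_map_eq_zero]
  intro f hf
  rw [← MvPolynomial.sum_homogeneousComponent f]
  refine Finset.sum_eq_zero fun i _ => ?_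
  rw [← coeff_homogenizer, hf, Polynomial.coeff_zero]

/-- A factor of a homogeneous polynomial is homogeneous. -/
lemma exists_isHomogeneous_of_mul {f g : MvPolynomial σ K} {n : ℕ} (h : (f * g).IsHomogeneous n)
    (h0 : f * g ≠ 0) : ∃ m, f.IsHomogeneous m := by
  have hf : f ≠ 0 := left_ne_zero_of_mul h0
  have hg : g ≠ 0 := right_ne_zero_of_mul h0
  have hf' : homogenizer f ≠ 0 := (map_ne_zero_iff _ homogenizer_injective).mpr hf
  have hg' : homogenizer g ≠ 0 := (map_ne_zero_iff _ homogenizer_injective).mpr hg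
  have h1 := homogenizer_of_isHomogeneous h
  rw [map_mul] at h1
  -- Over a domain the largest and the smallest exponent of `T` are both additive. They agree for
  -- the product, hence for each factor.
  have h2 := congrArg Polynomial.natDegree h1
  have h3 := congrArg Polynomial.natTrailingDegree h1
  rw [Polynomial.natDegree_mul hf' hg', Polynomial.natDegree_C_mul_X_pow _ _ h0] at h2
  rw [Polynomial.natTrailingDegree_mul hf' hg', Polynomial.C_mul_X_pow_eq_monomial,
    Polynomial.natTrailingDegree_monomial h0] at h3
  have h4 := Polynomial.natTrailingDegree_le_natDegree (homogenizer f)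
  have h5 := Polynomial.natTrailingDegree_le_natDegree (homogenizer g)
  refine ⟨(homogenizer f).natDegree, ?_⟩
  have h6 : f = MvPolynomial.homogeneousComponent (homogenizer f).natDegree f := by
    conv_lhs => rw [← MvPolynomial.sum_homogeneousComponent f]
    have h7 : ∀ i, i ≠ (homogenizer f).natDegree → MvPolynomial.homogeneousComponent i f = 0 := by
      intro i hi
      rw [← coeff_homogenizer]
      rcases lt_or_gt_of_ne hi with h | h
      · exact Polynomial.coeff_eq_zero_of_lt_natTrailingDegree (by omega)
      · exact Polynomial.coeff_eq_zero_of_natDegree_lt h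
    refine Finset.sum_eq_single_of_mem _ ?_ fun i _ => h7 i
    by_contra h8
    have h9 : MvPolynomial.homogeneousComponent (homogenizer f).natDegree f = 0 :=
      MvPolynomial.homogeneousComponent_eq_zero _ _ (by simpa using h8)
    rw [← coeff_homogenizer, Polynomial.coeff_natDegree, Polynomial.leadingCoeff_eq_zero] at h9
    exact hf' h9
  have h10 := MvPolynomial.homogeneousComponent_isHomogeneous (homogenizer f).natDegree f
  rwa [← h6] at h10

end HomogeneousFactors

/-! ### Points of codimension one in the plane. -/

section PlanePoints
variable {K : Type u} [Field K]

/-- The homogeneous prime ideal of a point of the plane. -/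
def planeIdeal (x : Plane K) : Ideal (MvPolynomial (Fin 3) K) :=
  (show ProjectiveSpectrum (planeGrading K) from x).asHomogeneousIdeal.toIdeal

lemma planeIdeal_isPrime (x : Plane K) : (planeIdeal x).IsPrime :=
  (show ProjectiveSpectrum (planeGrading K) from x).isPrime

lemma plane_le_iff {x y : Plane K} : x ≤ y ↔ planeIdeal y ≤ planeIdeal x := by
  have h := ProjectiveSpectrum.le_iff_mem_closure (𝒜 := planeGrading K) y x
  exact (specializes_iff_mem_closure (x := y) (y := x)).trans h.symm

lemma planeIdeal_injective : Function.Injective (planeIdeal (K := K)) := fun x y h =>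
  ((show y ⤳ x from plane_le_iff.mpr h.ge).antisymm (show x ⤳ y from plane_le_iff.mpr h.le)).eq.symm

lemma planeIdeal_genericPoint : planeIdeal (genericPoint (Plane K)) = ⊥ := by
  have h := genPt_eq_bot (𝒜 := planeGrading K) one_pos (MvPolynomial.isHomogeneous_X K (0 : Fin 3))
    (MvPolynomial.X_ne_zero 0)
  exact congrArg HomogeneousIdeal.toIdeal h

lemma lt_genericPoint_iff {x : Plane K} : x < genericPoint (Plane K) ↔ planeIdeal x ≠ ⊥ := by
  rw [lt_iff_le_not_ge, plane_le_iff, plane_le_iff, planeIdeal_genericPoint]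
  simp

/-- If `f` divided every variable it would be associated to `X 0`, and `X 0` would divide `X 1`. So
`(f)` does not contain the irrelevant ideal. -/
lemma exists_X_notMem_span {f : MvPolynomial (Fin 3) K} (hf : Irreducible f) :
    ∃ i, (MvPolynomial.X i : MvPolynomial (Fin 3) K) ∉ Ideal.span {f} := by
  by_contra! h
  have h0 := Ideal.mem_span_singleton.mp (h 0)
  have h1 := Ideal.mem_span_singleton.mp (h 1)
  have h2 := hf.associated_of_dvd (MvPolynomial.X_prime (i := (0 : Fin 3)) (R := K)).irreducible h0
  have h3 := h2.symm.dvd.trans h1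
  rw [MvPolynomial.X_dvd_X] at h3
  simp at h3

lemma exists_planeIdeal_eq {f : MvPolynomial (Fin 3) K} (hf : Irreducible f) {n : ℕ}
    (hn : f.IsHomogeneous n) : ∃ x : Plane K, planeIdeal x = Ideal.span {f} := by
  refine ⟨(⟨curveIdeal f hn, ?_, ?_⟩ : ProjectiveSpectrum (planeGrading K)), rfl⟩
  · exact (Ideal.span_singleton_prime hf.ne_zero).mpr hf.prime
  · intro h
    obtain ⟨i, hi⟩ := exists_X_notMem_span hf
    exact hi (h (HomogeneousIdeal.mem_irrelevant_of_mem _ one_pos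
      (MvPolynomial.isHomogeneous_X K i)))

/-- A homogeneous component of a nonzero element lies in the homogeneous prime ideal. Primality
passes to one of its irreducible factors, and factors of homogeneous polynomials are homogeneous. -/
lemma exists_irreducible_mem {x : Plane K} (hx : planeIdeal x ≠ ⊥) :
    ∃ (f : MvPolynomial (Fin 3) K) (n : ℕ), Irreducible f ∧ f.IsHomogeneous n ∧
      f ∈ planeIdeal x := by
  obtain ⟨a, ha, ha0⟩ := Submodule.exists_mem_ne_zero_of_ne_bot hx
  obtain ⟨n, hn⟩ : ∃ n, MvPolynomial.homogeneousComponent n a ≠ 0 := by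
    by_contra! h
    refine ha0 ?_
    rw [← MvPolynomial.sum_homogeneousComponent a]
    exact Finset.sum_eq_zero fun i _ => h i
  set b := MvPolynomial.homogeneousComponent n a
  have hb : b ∈ planeIdeal x := by
    have := (show ProjectiveSpectrum (planeGrading K) from x).asHomogeneousIdeal.isHomogeneous n ha
    have e : ((DirectSum.decompose (planeGrading K) a) n : MvPolynomial (Fin 3) K) = b :=
      MvPolynomial.decomposition.decompose'_apply a n
    rw [← e]
    exact this
  obtain ⟨u, hu⟩ := UniqueFactorizationMonoid.factors_prod hn
  have hp := planeIdeal_isPrime x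
  have h1 : (UniqueFactorizationMonoid.factors b).prod ∈ planeIdeal x := by
    rw [← hu] at hb
    rcases hp.mem_or_mem hb with h | h
    · exact h
    · exact absurd (Ideal.eq_top_of_isUnit_mem _ h u.isUnit) hp.ne_top
  obtain ⟨f, hf, hfx⟩ := hp.multiset_prod_mem_iff_exists_mem _ |>.mp h1
  have hfb : f ∣ b := UniqueFactorizationMonoid.dvd_of_mem_factors hf
  obtain ⟨g, hg⟩ := hfb
  obtain ⟨m, hm⟩ := exists_isHomogeneous_of_mul (f := f) (g := g) (n := n)
    (hg ▸ MvPolynomial.homogeneousComponent_isHomogeneous n a) (hg ▸ hn)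
  exact ⟨f, m, UniqueFactorizationMonoid.irreducible_of_factor _ hf, hm, hfx⟩

/-- The point with ideal `(f)` lies between `x` and the generic point and differs from the latter,
so codimension one forces it to be `x`. -/
lemma planeIdeal_eq_span_of_mem {x : Plane K} (hx : Order.coheight x = 1)
    {f : MvPolynomial (Fin 3) K} (hf : Irreducible f) {n : ℕ} (hn : f.IsHomogeneous n)
    (hfx : f ∈ planeIdeal x) : planeIdeal x = Ideal.span {f} := by
  obtain ⟨z, hz⟩ := exists_planeIdeal_eq hf hn
  have : x = z := eq_of_le_of_coheight_eq_one hx (by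
    rw [plane_le_iff, hz, Ideal.span_le]
    simpa using hfx) (by
    rw [lt_genericPoint_iff, hz, Ne, Ideal.span_singleton_eq_bot]
    exact hf.ne_zero)
  rw [this, hz]

lemma exists_planeIdeal_eq_span {x : Plane K} (hx : Order.coheight x = 1) :
    ∃ (f : MvPolynomial (Fin 3) K) (n : ℕ), Irreducible f ∧ f.IsHomogeneous n ∧
      planeIdeal x = Ideal.span {f} := by
  have h0 : planeIdeal x ≠ ⊥ := by
    intro h
    have : x = genericPoint (Plane K) :=
      planeIdeal_injective (h.trans planeIdeal_genericPoint.symm)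
    have h1 : IsMax x := fun y _ => by
      rw [plane_le_iff, h]
      exact bot_le
    rw [Order.coheight_eq_zero.mpr h1] at hx
    exact zero_ne_one hx
  obtain ⟨f, n, hf, hn, hfx⟩ := exists_irreducible_mem h0
  exact ⟨f, n, hf, hn, planeIdeal_eq_span_of_mem hx hf hn hfx⟩

/-- A nonzero homogeneous prime inside `(f)` contains an irreducible multiple of `f`, which is
associated to `f`. So only the zero ideal lies strictly below. -/
lemma coheight_eq_one {x : Plane K} {f : MvPolynomial (Fin 3) K} (hf : Irreducible f)
    (hx : planeIdeal x = Ideal.span {f}) : Order.coheight x = 1 := by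
  have hlt : x < genericPoint (Plane K) := by
    rw [lt_genericPoint_iff, hx, Ne, Ideal.span_singleton_eq_bot]
    exact hf.ne_zero
  refine le_antisymm ?_ ?_
  · rw [← Nat.cast_one, Order.coheight_le_coe_iff]
    intro y hy
    have h0 : planeIdeal y = ⊥ := by
      by_contra h
      obtain ⟨g, n, hg, hn, hgy⟩ := exists_irreducible_mem h
      have h1 := plane_le_iff.mp hy.le
      have h2 := h1 hgy
      rw [hx, Ideal.mem_span_singleton] at h2
      have h3 := (hf.associated_of_dvd hg h2)
      refine hy.not_ge ?_
      rw [plane_le_iff, hx, Ideal.span_le, Set.singleton_subset_iff]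
      exact Ideal.mem_of_dvd _ h3.symm.dvd hgy
    have h1 : IsMax y := fun z _ => by
      rw [plane_le_iff, h0]
      exact bot_le
    rw [Order.coheight_eq_zero.mpr h1]
    exact_mod_cast one_pos
  · exact le_trans le_add_self (Order.coheight_add_one_le hlt)

/-- Two generators differ by a unit, which has degree zero, so the infimum in the definition runs
over a single value. -/
lemma planeDivisorDegree_eq {x : Plane K} {f : MvPolynomial (Fin 3) K} (hf : Irreducible f)
    {n : ℕ} (hn : f.IsHomogeneous n) (hx : planeIdeal x = Ideal.span {f}) :
    planeDivisorDegree x = n := by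
  have : {n | ∃ f : MvPolynomial (Fin 3) K, f.IsHomogeneous n ∧
      (show ProjectiveSpectrum (planeGrading K) from x).asHomogeneousIdeal.toIdeal =
        Ideal.span {f}} = {n} := by
    ext m
    refine ⟨?_, ?_⟩
    · rintro ⟨g, hg, h⟩
      have h1 : Ideal.span {f} = Ideal.span {g} := hx.symm.trans h
      rw [Ideal.span_singleton_eq_span_singleton] at h1
      have hg0 : g ≠ 0 := h1.ne_zero_iff.mp hf.ne_zero
      obtain ⟨u, rfl⟩ := h1
      have h2 := MvPolynomial.isUnit_iff_totalDegree_of_isReduced.mp u.isUnit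
      have h3 := MvPolynomial.totalDegree_mul_of_isDomain hf.ne_zero u.isUnit.ne_zero
      rw [hg.totalDegree hg0, hn.totalDegree hf.ne_zero, h2.2] at h3
      simpa using h3
    · rintro rfl
      exact ⟨f, hn, hx⟩
  rw [planeDivisorDegree, this, csInf_singleton]

end PlanePoints

/-! ### Divisors of homogeneous polynomials and of rational functions on the plane. -/

section PlaneDivisors
variable {K : Type u} [Field K]

/-- The embedding of the polynomial ring in its fraction field. -/
abbrev toFrac : MvPolynomial (Fin 3) K →+* FractionRing (MvPolynomial (Fin 3) K) :=
  algebraMap _ _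

lemma toFrac_ne_zero {a : MvPolynomial (Fin 3) K} (ha : a ≠ 0) : toFrac a ≠ 0 :=
  algebraMap_ne_zero_of ha

/-- An index `i` with `X i ≠ 0` at a point of the plane. -/
def planeIdx (x : Plane K) : Fin 3 := chartIdx (𝒜 := planeGrading K) MvPolynomial.X (plane_cover K) x

lemma X_planeIdx_notMem (x : Plane K) : MvPolynomial.X (planeIdx x) ∉ planeIdeal x :=
  mem_chartIdx (𝒜 := planeGrading K) MvPolynomial.X (plane_cover K) x

lemma exists_planeFieldVal {n : ℕ} {a b : MvPolynomial (Fin 3) K} (ha : a.IsHomogeneous n)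
    (hb : b.IsHomogeneous n) (hb0 : b ≠ 0) :
    ∃ z : (Plane K).functionField, fieldVal (planeGrading K) z = toFrac a / toFrac b := by
  obtain ⟨t, ht, -⟩ := exists_stalkVal_eq (genPt (planeGrading K)) ha hb fun h => hb0 (by
    have h' : b ∈ planeIdeal (genericPoint (Plane K)) := h
    rwa [planeIdeal_genericPoint] at h')
  exact ⟨t, ht⟩

/-- The rational function `a / X i ^ n`, with `X i ≠ 0` at `x`. -/
def dehomogenize (x : Plane K) (n : ℕ) (a : MvPolynomial (Fin 3) K) : (Plane K).functionField :=
  Function.invFun (fieldVal (planeGrading K)) (toFrac a / toFrac (MvPolynomial.X (planeIdx x) ^ n))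

lemma fieldVal_dehomogenize (x : Plane K) {n : ℕ} {a : MvPolynomial (Fin 3) K}
    (ha : a.IsHomogeneous n) : fieldVal (planeGrading K) (dehomogenize x n a) =
      toFrac a / toFrac (MvPolynomial.X (planeIdx x) ^ n) :=
  Function.invFun_eq (exists_planeFieldVal ha (MvPolynomial.isHomogeneous_X_pow _ n)
    (pow_ne_zero _ (MvPolynomial.X_ne_zero _)))

lemma dehomogenize_ne_zero (x : Plane K) {n : ℕ} {a : MvPolynomial (Fin 3) K}
    (ha : a.IsHomogeneous n) (ha0 : a ≠ 0) : dehomogenize x n a ≠ 0 := by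
  intro h
  have h1 := fieldVal_dehomogenize x ha
  rw [h, map_zero, eq_comm, div_eq_zero_iff] at h1
  exact h1.elim (toFrac_ne_zero ha0) (toFrac_ne_zero (pow_ne_zero _ (MvPolynomial.X_ne_zero _)))

/-- The order at `x` of a homogeneous polynomial of degree `n`. -/
def homOrd (x : Plane K) (n : ℕ) (a : MvPolynomial (Fin 3) K) : ℤ :=
  Scheme.ord (dehomogenize x n a) x

lemma homOrd_of_coheight_ne_one {x : Plane K} (hx : Order.coheight x ≠ 1) (n : ℕ)
    (a : MvPolynomial (Fin 3) K) : homOrd x n a = 0 :=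
  Scheme.ord_eq_zero_of_coheight_neq_one hx _

lemma homOrd_mul (x : Plane K) {n m : ℕ} {a b : MvPolynomial (Fin 3) K} (ha : a.IsHomogeneous n)
    (hb : b.IsHomogeneous m) (ha0 : a ≠ 0) (hb0 : b ≠ 0) :
    homOrd x (n + m) (a * b) = homOrd x n a + homOrd x m b := by
  rw [homOrd, homOrd, homOrd, ← Scheme.ord_mul (dehomogenize_ne_zero x ha ha0)
    (dehomogenize_ne_zero x hb hb0)]
  congr 1
  refine fieldVal_injective (𝒜 := planeGrading K) ?_
  rw [map_mul, fieldVal_dehomogenize x (ha.mul hb), fieldVal_dehomogenize x ha,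
    fieldVal_dehomogenize x hb, pow_add, map_mul, map_mul, mul_div_mul_comm]

lemma homOrd_eq_add (x : Plane K) {n : ℕ} {a b : MvPolynomial (Fin 3) K} (ha : a.IsHomogeneous n)
    (hb : b.IsHomogeneous n) (ha0 : a ≠ 0) (hb0 : b ≠ 0) {z : (Plane K).functionField}
    (h : fieldVal (planeGrading K) z * toFrac b = toFrac a) :
    homOrd x n a = Scheme.ord z x + homOrd x n b := by
  have hz : z ≠ 0 := by
    rintro rfl
    rw [map_zero, zero_mul] at h
    exact toFrac_ne_zero ha0 h.symm
  rw [homOrd, homOrd, ← Scheme.ord_mul hz (dehomogenize_ne_zero x hb hb0)]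
  congr 1
  refine fieldVal_injective (𝒜 := planeGrading K) ?_
  rw [map_mul, fieldVal_dehomogenize x ha, fieldVal_dehomogenize x hb, ← h, mul_div_assoc]

lemma exists_dehomogenize_eq (x : Plane K) {n : ℕ} {a : MvPolynomial (Fin 3) K}
    (ha : a.IsHomogeneous n) : ∃ t : (Plane K).presheaf.stalk x,
      stalkVal (𝒜 := planeGrading K) x t = toFrac a / toFrac (MvPolynomial.X (planeIdx x) ^ n) ∧
      dehomogenize x n a = algebraMap ((Plane K).presheaf.stalk x) (Plane K).functionField t ∧
      (IsUnit t ↔ a ∉ planeIdeal x) := by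
  obtain ⟨t, ht, hu⟩ := exists_stalkVal_eq (𝒜 := planeGrading K) x ha
    (MvPolynomial.isHomogeneous_X_pow (planeIdx x) n)
    (fun h => X_planeIdx_notMem x ((planeIdeal_isPrime x).mem_of_pow_mem _ h))
  refine ⟨t, ht, fieldVal_injective (𝒜 := planeGrading K) ?_, hu⟩
  rw [fieldVal_dehomogenize x ha, fieldVal_algebraMap, ht]

lemma homOrd_nonneg (x : Plane K) {n : ℕ} {a : MvPolynomial (Fin 3) K} (ha : a.IsHomogeneous n) :
    0 ≤ homOrd x n a := by
  obtain ⟨t, -, ht, -⟩ := exists_dehomogenize_eq x ha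
  rw [homOrd, ht]
  exact ord_nonneg ⟨t, rfl⟩

lemma homOrd_eq_zero {x : Plane K} {n : ℕ} {a : MvPolynomial (Fin 3) K} (ha : a.IsHomogeneous n)
    (hax : a ∉ planeIdeal x) : homOrd x n a = 0 := by
  obtain ⟨t, -, ht, hu⟩ := exists_dehomogenize_eq x ha
  rw [homOrd, ht]
  exact ord_eq_zero (hu.mpr hax)

/-- The germ `f / X i ^ n` generates the maximal ideal: a non-unit is a fraction `a / b` with `a` in
`(f)`, and the cofactor of `f` in `a` is again homogeneous. -/
lemma homOrd_eq_one {x : Plane K} {n : ℕ} {f : MvPolynomial (Fin 3) K} (hf : Irreducible f)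
    (hn : f.IsHomogeneous n) (hx : planeIdeal x = Ideal.span {f}) : homOrd x n f = 1 := by
  have hX : ∀ k : ℕ, toFrac (MvPolynomial.X (planeIdx x) ^ k : MvPolynomial (Fin 3) K) ≠ 0 :=
    fun k => toFrac_ne_zero (pow_ne_zero _ (MvPolynomial.X_ne_zero _))
  obtain ⟨t, htv, ht, hu⟩ := exists_dehomogenize_eq x hn
  rw [homOrd, ht]
  have hfx : f ∈ planeIdeal x := hx ▸ Ideal.mem_span_singleton_self f
  have hu' : ¬ IsUnit t := fun h => hu.mp h hfx
  have ht0 : t ≠ 0 := by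
    rintro rfl
    rw [map_zero] at ht
    exact dehomogenize_ne_zero x hn hf.ne_zero ht
  refine ord_eq_one (coheight_eq_one hf hx) ht0 (le_antisymm (fun r hr => ?_) ?_)
  · obtain ⟨k, a, b, ha, hb, hbx, hr', hru⟩ : ∃ (k : ℕ) (a b : MvPolynomial (Fin 3) K)
        (_ : a.IsHomogeneous k) (_ : b.IsHomogeneous k) (_ : b ∉ planeIdeal x),
        stalkVal (𝒜 := planeGrading K) x r = toFrac a / toFrac b ∧
          (IsUnit r ↔ a ∉ planeIdeal x) := exists_stalkVal_eq_div (𝒜 := planeGrading K) x r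
    have hax : a ∈ planeIdeal x := by
      by_contra h
      exact (IsLocalRing.mem_maximalIdeal _).mp hr (hru.mpr h)
    rw [Ideal.mem_span_singleton]
    by_cases ha0 : a = 0
    · have : r = 0 := stalkVal_injective (𝒜 := planeGrading K) x (by
        rw [hr', ha0, map_zero, zero_div, map_zero])
      rw [this]
      exact dvd_zero _
    rw [hx, Ideal.mem_span_singleton] at hax
    obtain ⟨g, rfl⟩ := hax
    obtain ⟨l, hl⟩ := exists_isHomogeneous_of_mul (mul_comm f g ▸ ha) (mul_comm f g ▸ ha0)
    have hk : k = n + l := ha.inj_right (hn.mul hl) ha0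
    -- The factor `X i ^ n` restores degree zero in the quotient `g * X i ^ n / b`.
    have h1 : (g * MvPolynomial.X (planeIdx x) ^ n).IsHomogeneous k := by
      rw [hk, add_comm]
      exact hl.mul (MvPolynomial.isHomogeneous_X_pow _ n)
    obtain ⟨s, hs, -⟩ := exists_stalkVal_eq (𝒜 := planeGrading K) x h1 hb hbx
    refine ⟨s, stalkVal_injective (𝒜 := planeGrading K) x ?_⟩
    have hb0 : toFrac b ≠ 0 := toFrac_ne_zero fun h => hbx (h ▸ zero_mem _)
    rw [map_mul, hr', htv, hs, map_mul, map_mul]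
    have := hX n
    field_simp
  · rw [Ideal.span_le, Set.singleton_subset_iff]
    exact (IsLocalRing.mem_maximalIdeal _).mpr hu'

lemma pos_degree_of_irreducible {f : MvPolynomial (Fin 3) K} (hf : Irreducible f) {m : ℕ}
    (hm : f.IsHomogeneous m) : 0 < m := by
  rcases Nat.eq_zero_or_pos m with rfl | h
  · refine absurd ?_ hf.not_isUnit
    have h1 := hm.totalDegree hf.ne_zero
    rw [MvPolynomial.totalDegree_eq_zero_iff_eq_C] at h1
    rw [h1]
    refine (IsUnit.mk0 _ fun h => hf.ne_zero ?_).map MvPolynomial.C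
    rw [h1, h, map_zero]
  · exact h

/-- The divisor of a homogeneous polynomial. -/
lemma exists_divisor {n : ℕ} {a : MvPolynomial (Fin 3) K} (ha : a.IsHomogeneous n) (ha0 : a ≠ 0) :
    ∃ P : Plane K →₀ ℤ, (∀ x, P x = homOrd x n a) ∧
      P.sum (fun x k => k * (planeDivisorDegree x : ℤ)) = n := by
  classical
  induction n using Nat.strong_induction_on generalizing a with
  | _ n ih =>
  by_cases hu : IsUnit a
  · refine ⟨0, fun x => ?_, ?_⟩
    · rw [homOrd_eq_zero ha fun h => (planeIdeal_isPrime x).ne_top (Ideal.eq_top_of_isUnit_mem _ h hu)]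
      rfl
    · have := (MvPolynomial.isUnit_iff_totalDegree_of_isReduced.mp hu).2
      rw [ha.totalDegree ha0] at this
      simp [this]
  -- Splitting off an irreducible factor `f` of degree `m` adds the point of `(f)` with multiplicity
  -- one. This point has degree `m`, and the cofactor has smaller degree.
  · obtain ⟨f, hf, g, rfl⟩ := WfDvdMonoid.exists_irreducible_factor hu ha0
    obtain ⟨m, hm⟩ := exists_isHomogeneous_of_mul ha ha0
    obtain ⟨l, hl⟩ := exists_isHomogeneous_of_mul (mul_comm f g ▸ ha) (mul_comm f g ▸ ha0)
    obtain rfl : n = m + l := ha.inj_right (hm.mul hl) ha0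
    have hm0 : 0 < m := pos_degree_of_irreducible hf hm
    have hg0 := right_ne_zero_of_mul ha0
    obtain ⟨P, hP, hP'⟩ := ih l (by omega) hl hg0
    obtain ⟨y, hy⟩ := exists_planeIdeal_eq hf hm
    refine ⟨Finsupp.single y 1 + P, fun x => ?_, ?_⟩
    · rw [homOrd_mul x hm hl hf.ne_zero hg0, Finsupp.add_apply, hP, Finsupp.single_apply]
      congr 1
      split_ifs with h
      · subst h
        rw [homOrd_eq_one hf hm hy]
      · symm
        by_cases hx : Order.coheight x = 1
        · refine homOrd_eq_zero hm fun hfx => h (planeIdeal_injective ?_)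
          rw [hy, planeIdeal_eq_span_of_mem hx hf hm hfx]
        · exact homOrd_of_coheight_ne_one hx _ _
    · rw [Finsupp.sum_add_index' (by simp) (by intros; ring), hP', Finsupp.sum_single_index (by simp),
        planeDivisorDegree_eq hf hm hy]
      push_cast
      ring

/-- Every rational function on the plane is a quotient of homogeneous polynomials of the same
degree. -/
lemma exists_planeFieldVal_eq (z : (Plane K).functionField) :
    ∃ (n : ℕ) (a b : MvPolynomial (Fin 3) K) (_ : a.IsHomogeneous n) (_ : b.IsHomogeneous n),
      b ≠ 0 ∧ fieldVal (planeGrading K) z = toFrac a / toFrac b := by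
  obtain ⟨k, a, b, ha, hb, hbx, h, -⟩ := exists_stalkVal_eq_div (genPt (planeGrading K)) z
  exact ⟨k, a, b, ha, hb, fun h => hbx (h ▸ zero_mem _), h⟩

/-- Principal divisors on the plane have degree zero. -/
lemma exists_principal_divisor (z : (Plane K).functionField) (hz : z ≠ 0) :
    ∃ P : Plane K →₀ ℤ, (∀ x, P x = Scheme.ord z x) ∧
      P.sum (fun x k => k * (planeDivisorDegree x : ℤ)) = 0 := by
  obtain ⟨n, a, b, ha, hb, hb0, h⟩ := exists_planeFieldVal_eq z
  rw [eq_div_iff (toFrac_ne_zero hb0)] at h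
  have ha0 : a ≠ 0 := by
    rintro rfl
    rw [map_zero, mul_eq_zero] at h
    rcases h with h | h
    · exact hz (fieldVal_injective (𝒜 := planeGrading K) (h.trans (map_zero _).symm))
    · exact toFrac_ne_zero hb0 h
  obtain ⟨P, hP, hP'⟩ := exists_divisor ha ha0
  obtain ⟨Q, hQ, hQ'⟩ := exists_divisor hb hb0
  refine ⟨P - Q, fun x => ?_, ?_⟩
  · rw [Finsupp.sub_apply, hP, hQ, homOrd_eq_add x ha hb ha0 hb0 h]
    ring
  · rw [Finsupp.sum_sub_index (by intros; ring), hP', hQ', sub_self]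

lemma planeVar_mem (i : Fin 3) : MvPolynomial.X i ∈ planeGrading K 1 :=
  MvPolynomial.isHomogeneous_X K i

/-- The degree of a line in the plane is one. -/
lemma hyperplaneDegree_plane : hyperplaneDegree (𝒜 := planeGrading K) MvPolynomial.X
    planeVar_mem MvPolynomial.X_ne_zero (plane_cover K) planeDivisorDegree = 1 := by
  obtain ⟨P, hP, hP'⟩ := exists_divisor (planeVar_mem (K := K) 0) (MvPolynomial.X_ne_zero 0)
  have : hyperplane (𝒜 := planeGrading K) MvPolynomial.X
    planeVar_mem MvPolynomial.X_ne_zero (plane_cover K) = P := by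
    ext x
    refine (hyperplane_apply (𝒜 := planeGrading K) _ _ _ _ x).trans ?_
    rw [hP, homOrd]
    congr 1
    refine fieldVal_injective (𝒜 := planeGrading K) ?_
    rw [fieldVal_dehomogenize x (planeVar_mem (K := K) 0), pow_one]
    exact fieldVal_ratio (𝒜 := planeGrading K) _ _ _ _ _
  exact (congrArg (fun P : Plane K →₀ ℤ => P.sum fun x k => k * (planeDivisorDegree x : ℤ))
    this).trans hP'

end PlaneDivisors

/-! ### Semistability of the syzygy bundles on the plane. -/

section PlaneStability
variable {K : Type u} [Field K]

open MvPolynomial in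
/-- Homogeneous syzygies of `X ^ n, Y ^ n, Z ^ n` have degree at least `n`. -/
lemma le_of_sum_X_pow_mul_eq_zero {n m : ℕ} {G : Fin 3 → MvPolynomial (Fin 3) K}
    (hG : ∀ i, (G i).IsHomogeneous m) (hG0 : ∃ i, G i ≠ 0) (h : ∑ i, X i ^ n * G i = 0) :
    n ≤ m := by
  classical
  by_contra! hlt
  obtain ⟨i, hi⟩ := hG0
  obtain ⟨μ, hμ⟩ := ne_zero_iff.mp hi
  have hd : ∀ j, μ j ≤ m := fun j => by
    have h1 : μ.degree = m := by
      rw [Finsupp.degree_eq_weight_one]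
      exact hG i hμ
    exact h1 ▸ Finsupp.le_degree j μ
  -- At the monomial `X i ^ n * X ^ μ` only the term with index `i` contributes: for `j ≠ i` the
  -- exponent of `X j` is `μ j ≤ m < n`, so `X j ^ n` does not divide it.
  have h1 := congrArg (coeff (Finsupp.single i n + μ)) h
  rw [coeff_sum, Finset.sum_eq_single i, X_pow_eq_monomial, coeff_monomial_mul, one_mul,
    coeff_zero] at h1
  · exact hμ h1
  · intro j _ hj
    rw [X_pow_eq_monomial, coeff_monomial_mul', if_neg]
    intro hle
    have h2 := hle j
    rw [Finsupp.single_eq_same, Finsupp.add_apply, Finsupp.single_eq_of_ne hj, zero_add] at h2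
    have := hd j
    omega
  · exact fun h => absurd (Finset.mem_univ i) h

/-- A tuple of homogeneous polynomials of the same degree is a multiple of a tuple without common
factor. -/
lemma exists_coprime_tuple {M : ℕ} {A : Fin 3 → MvPolynomial (Fin 3) K}
    (hA : ∀ i, (A i).IsHomogeneous M) (hA0 : ∃ i, A i ≠ 0) :
    ∃ (l m : ℕ) (g : MvPolynomial (Fin 3) K) (G : Fin 3 → MvPolynomial (Fin 3) K),
      l + m = M ∧ g.IsHomogeneous l ∧ (∀ i, (G i).IsHomogeneous m) ∧ (∀ i, A i = g * G i) ∧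
      ∀ f, Irreducible f → ∃ i, ¬ f ∣ G i := by
  induction M using Nat.strong_induction_on generalizing A with
  | _ M ih =>
  by_cases h : ∀ f, Irreducible f → ∃ i, ¬ f ∣ A i
  · exact ⟨0, M, 1, A, zero_add M, MvPolynomial.isHomogeneous_one _ _, hA,
      fun i => (one_mul _).symm, h⟩
  push Not at h
  obtain ⟨f, hf, hfA⟩ := h
  choose B hB using hfA
  obtain ⟨k, hk⟩ := hA0
  have hk' : f * B k ≠ 0 := hB k ▸ hk
  obtain ⟨d, hd⟩ := exists_isHomogeneous_of_mul (hB k ▸ hA k) hk'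
  have hd0 : 0 < d := pos_degree_of_irreducible hf hd
  -- A zero entry is homogeneous of every degree. The inequality that makes `M - d` an honest
  -- difference comes from a nonzero entry.
  have hBh : ∀ i, (B i).IsHomogeneous (M - d) ∧ (B i ≠ 0 → d ≤ M) := by
    intro i
    by_cases h0 : B i = 0
    · rw [h0]
      exact ⟨MvPolynomial.isHomogeneous_zero _ _ _, fun h => absurd rfl h⟩
    have h1 : f * B i ≠ 0 := mul_ne_zero hf.ne_zero h0
    have h2 := hA i
    rw [hB i] at h2
    obtain ⟨l, hl⟩ := exists_isHomogeneous_of_mul (mul_comm f (B i) ▸ h2) (mul_comm f (B i) ▸ h1)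
    obtain rfl : M = d + l := h2.inj_right (hd.mul hl) h1
    rw [Nat.add_sub_cancel_left]
    exact ⟨hl, fun _ => Nat.le_add_right _ _⟩
  have hdM : d ≤ M := (hBh k).2 (right_ne_zero_of_mul hk')
  obtain ⟨l, m, g, G, hlm, hg, hG, hBG, hc⟩ := ih (M - d) (by omega) (fun i => (hBh i).1)
    ⟨k, right_ne_zero_of_mul hk'⟩
  exact ⟨d + l, m, f * g, G, by omega, hd.mul hg, hG, fun i => by rw [hB, hBG, mul_assoc], hc⟩

lemma mem_range_toGenStalk_genericPoint {X : Scheme.{u}} [IsIntegral X] (M : X.Modules)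
    (b : genStalk M) : b ∈ (toGenStalk M (genericPoint X)).range := by
  obtain ⟨U, hU, f, rfl⟩ := exists_germ_eq M _ b
  exact ⟨_, toGenStalk_germ M _ hU f⟩

/-- Rational sections of the syzygy bundle as tuples of fractions with a common denominator. -/
lemma exists_syzGen_eq {n : ℕ} (b : genStalk (planeSyz K n 0)) :
    ∃ (M N : ℕ) (A : Fin 3 → MvPolynomial (Fin 3) K) (B : MvPolynomial (Fin 3) K),
      M + n = N ∧ (∀ i, (A i).IsHomogeneous M) ∧ B.IsHomogeneous N ∧ B ≠ 0 ∧
      ∀ i, syzGen b i = toFrac (A i) / toFrac B := by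
  have h : ∀ i, ∃ (k j : ℕ) (_ : k + n = j) (r s : MvPolynomial (Fin 3) K)
      (_ : r.IsHomogeneous k) (_ : s.IsHomogeneous j), s ≠ 0 ∧
      syzGen b i = toFrac r / toFrac s := by
    intro i
    obtain ⟨k, j, hkj, r, s, hr, hs, hs0, h⟩ := exists_twistGen_eq (𝒜 := planeGrading K)
      (mem_range_toGenStalk_genericPoint _ (genHom (syzι (planeGrading K) (varPow K n)
        (varPow_mem n) 0 i) b))
    exact ⟨k, j, by omega, r, s, hr, hs, fun h => hs0 (h ▸ zero_mem _), h⟩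
  choose k j hkj r s hr hs hs0 h using h
  -- The product of the three denominators serves for all components. As `k i + n = j i` for each
  -- `i`, the new numerators share one degree.
  refine ⟨k 0 + (j 1 + j 2), j 0 + (j 1 + j 2),
    ![r 0 * (s 1 * s 2), r 1 * (s 0 * s 2), r 2 * (s 0 * s 1)], s 0 * (s 1 * s 2), ?_, ?_,
    (hs 0).mul ((hs 1).mul (hs 2)), mul_ne_zero (hs0 0) (mul_ne_zero (hs0 1) (hs0 2)), ?_⟩
  · have := hkj 0
    omega
  · have h0 := hkj 0
    have h1 := hkj 1
    have h2 := hkj 2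
    intro i
    fin_cases i
    · exact (hr 0).mul ((hs 1).mul (hs 2))
    · rw [show k 0 + (j 1 + j 2) = k 1 + (j 0 + j 2) by omega]
      exact (hr 1).mul ((hs 0).mul (hs 2))
    · rw [show k 0 + (j 1 + j 2) = k 2 + (j 0 + j 1) by omega]
      exact (hr 2).mul ((hs 0).mul (hs 1))
  · have := fun i => toFrac_ne_zero (hs0 i)
    have h0 := this 0
    have h1 := this 1
    have h2 := this 2
    intro i
    rw [h i]
    fin_cases i
    · simp only [map_mul, Fin.zero_eta, Matrix.cons_val_zero]
      field_simp
    · simp only [map_mul, Fin.mk_one, Matrix.cons_val_one, Matrix.cons_val_zero]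
      field_simp
    · simp only [map_mul, Fin.reduceFinMk, Matrix.cons_val]
      field_simp

/-- A line subsheaf of `Syz(X ^ n, Y ^ n, Z ^ n)` has degree at most `- 2 * n`. -/
lemma le_of_rank_one {n : ℕ} {T : (Plane K).Modules} (φ : T ⟶ planeSyz K n 0)
    (hφ : Function.Injective (genHom φ)) (hr : rank T = 1) {t : ℤ}
    (ht : HasDegree planeDivisorDegree T t) : t ≤ - (2 * n) := by
  obtain ⟨k, e, D, hD0, hD, rfl⟩ := ht
  obtain rfl : k = 1 := by
    rw [rank, Module.finrank_eq_card_basis e] at hr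
    simpa using hr
  obtain ⟨M, N, A, B, hMN, hA, hB, hB0, hAB⟩ := exists_syzGen_eq (genHom φ (e 0))
  have hBf : toFrac B ≠ 0 := toFrac_ne_zero hB0
  have hA0 : ∃ i, A i ≠ 0 := by
    by_contra! h
    have h1 : genHom φ (e 0) = 0 := eq_zero_of_syzGen_eq_zero _ fun i => by
      rw [hAB, h, map_zero, zero_div]
    exact e.ne_zero 0 (hφ (h1.trans (map_zero _).symm))
  obtain ⟨l, m, g, G, hlm, hg, hG, hAG, hc⟩ := exists_coprime_tuple hA hA0
  have hg0 : g ≠ 0 := by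
    rintro rfl
    obtain ⟨i, hi⟩ := hA0
    exact hi (by rw [hAG, zero_mul])
  have hG0 : ∃ i, G i ≠ 0 := by
    obtain ⟨i, hi⟩ := hA0
    exact ⟨i, fun h => hi (by rw [hAG, h, mul_zero])⟩
  -- Clearing the denominator `B` and cancelling `g` from the syzygy relation leaves a nonzero
  -- polynomial syzygy of degree `m`.
  have hnm : n ≤ m := by
    refine le_of_sum_X_pow_mul_eq_zero hG hG0 ?_
    have h1 := sum_mul_syzGen (genHom φ (e 0))
    have h2 : toFrac (g * ∑ i, MvPolynomial.X i ^ n * G i) / toFrac B = 0 := by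
      rw [← h1, Finset.mul_sum, map_sum, Finset.sum_div]
      refine Finset.sum_congr rfl fun i _ => ?_
      rw [hAB, hAG, ← mul_div_assoc, ← map_mul]
      congr 2
      rw [varPow]
      ring
    rw [div_eq_zero_iff, or_iff_left hBf] at h2
    by_contra h3
    exact toFrac_ne_zero (mul_ne_zero hg0 h3) h2
  obtain ⟨P, hP, hP'⟩ := exists_divisor hg hg0
  obtain ⟨Q, hQ, hQ'⟩ := exists_divisor hB hB0
  -- At a point with ideal `(f)` some `G i` is prime to `f`, so the component `i` of the rational
  -- generator has order `ord g - ord B`. The same component of a local generator of `T` is `r / s`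
  -- with `s` nonzero at `x`, hence of nonnegative order. The difference bounds the multiplicity `D
  -- x`.
  have key : ∀ x, D x ≤ P x + (-Q) x := by
    intro x
    rw [Finsupp.neg_apply, hP, hQ]
    by_cases hx : Order.coheight x = 1
    · obtain ⟨b, hb, h1⟩ := hD x hx
      rw [h1]
      obtain ⟨f, -, hf, -, hfx⟩ := exists_planeIdeal_eq_span hx
      obtain ⟨i, hi⟩ := hc f hf
      have hGx : G i ∉ planeIdeal x := by
        rwa [hfx, Ideal.mem_span_singleton]
      have hGi : G i ≠ 0 := fun h => hi (h ▸ dvd_zero f)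
      obtain ⟨k, j, hkj, r, s, hr, hs, hsx, h2⟩ := exists_twistGen_eq (𝒜 := planeGrading K)
        (genHom_mem_range (syzι (planeGrading K) (varPow K n) (varPow_mem n) 0 i) x
          (genHom_mem_range φ x (hb.mem_range 0)))
      have hs0 : s ≠ 0 := fun h => hsx (h ▸ zero_mem _)
      have hr' : r.IsHomogeneous k := hr
      have hs' : s.IsHomogeneous j := hs
      have h3 : genHom φ (e 0) = b.det e • genHom φ (b 0) := by
        rw [← LinearMap.map_smul]
        congr 1
        have := b.sum_repr (e 0)
        rw [Fin.sum_univ_one] at this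
        rw [← this, Module.Basis.det_apply, Matrix.det_fin_one, Module.Basis.toMatrix_apply]
      have h4 : fieldVal (planeGrading K) (b.det e) * (toFrac r / toFrac s) =
          toFrac (A i) / toFrac B := by
        rw [← hAB, h3, show toFrac r / toFrac s = syzGen (genHom φ (b 0)) i from h2.symm]
        exact (syzGen_smul (𝒜 := planeGrading K) _ _ _).symm
      rw [mul_div_assoc', div_eq_div_iff (toFrac_ne_zero hs0) hBf, mul_assoc, ← map_mul,
        ← map_mul] at h4
      have hAi : A i ≠ 0 := by
        rw [hAG]
        exact mul_ne_zero hg0 hGi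
      have hAs : A i * s ≠ 0 := mul_ne_zero hAi hs0
      have hr0 : r ≠ 0 := by
        rintro rfl
        rw [zero_mul, map_zero, mul_zero] at h4
        exact toFrac_ne_zero hAs h4.symm
      have hdeg : M + j = k + N := by omega
      have h5 := homOrd_eq_add x ((hA i).mul hs') (hdeg ▸ hr'.mul hB) hAs (mul_ne_zero hr0 hB0) h4
      have h6 : homOrd x (M + j) (A i * s) = homOrd x l g := by
        rw [homOrd_mul x (hA i) hs' hAi hs0, homOrd_eq_zero hs' hsx, add_zero, ← hlm, hAG,
          homOrd_mul x hg (hG i) hg0 hGi, homOrd_eq_zero (hG i) hGx, add_zero]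
      have h7 : homOrd x (M + j) (r * B) = homOrd x k r + homOrd x N B := by
        rw [hdeg, homOrd_mul x hr' hB hr0 hB0]
      have h8 := homOrd_nonneg x hr'
      omega
    · rw [hD0 x hx, homOrd_of_coheight_ne_one hx, homOrd_of_coheight_ne_one hx]
      simp
  have h1 := sum_mul_le_add planeDivisorDegree key
  have h2 : (-Q).sum (fun x k => k * (planeDivisorDegree x : ℤ)) = - N := by
    rw [Finsupp.sum_neg_index (by simp), ← hQ', Finsupp.sum, Finsupp.sum, ← Finset.sum_neg_distrib]
    simp
  -- The bound is `l - N`, and `l + m = M`, `M + n = N`, `n ≤ m` turn it into `-(m + n) ≤ -2n`.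
  omega

lemma genericPoint_mem_planeBasicOpen (i : Fin 3) :
    genericPoint (Plane K) ∈ Proj.basicOpen (planeGrading K) (MvPolynomial.X i) :=
  genericPoint_mem_basicOpen (𝒜 := planeGrading K) MvPolynomial.X planeVar_mem
    (MvPolynomial.X_ne_zero i)

lemma rank_planeSyz (n : ℕ) (m : ℤ) : rank (planeSyz K n m) = 2 :=
  (isSectionBasis_koszul (planeGrading K) (varPow K n) (varPow_mem n) m planeVar_mem
    (fun _ => rfl) 0).rank_eq (genericPoint_mem_planeBasicOpen 0)

lemma hasDegree_planeSyz (n : ℕ) (m : ℤ) :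
    HasDegree planeDivisorDegree (planeSyz K n m) (2 * m - 3 * n) := by
  have h := hasDegree_syz (𝒜 := planeGrading K) MvPolynomial.X planeVar_mem MvPolynomial.X_ne_zero
    (plane_cover K) planeDivisorDegree (varPow K n) (varPow_mem n) (fun _ => rfl) m
  rwa [hyperplaneDegree_plane, mul_one] at h

/-- The bundle `Syz(X ^ n, Y ^ n, Z ^ n)` on the plane is semistable. -/
lemma isSemistable_planeSyz (n : ℕ) : IsSemistable planeDivisorDegree (planeSyz K n 0) := by
  intro T φ _ _ hT t s ht hs
  have hw := exists_principal_divisor (K := K)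
  have hφ : Function.Injective (genHom φ) := stalkHom_injective φ _
  -- Uniqueness of the degree on the plane: the comparison lemma is applied to the identity in both
  -- directions.
  have hs' : s = 2 * 0 - 3 * n := by
    have h1 : Function.Injective (genHom (𝟙 (planeSyz K n 0))) :=
      stalkHom_injective (𝟙 (planeSyz K n 0)) _
    exact le_antisymm (HasDegree.le_of_injective hw _ h1 rfl hs (hasDegree_planeSyz n 0))
      (HasDegree.le_of_injective hw _ h1 rfl (hasDegree_planeSyz n 0) hs)
  have hfin : Module.Finite (Plane K).functionField (genStalk (planeSyz K n 0)) :=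
    Module.finite_of_finrank_pos (by
      have := rank_planeSyz (K := K) n 0
      rw [rank] at this
      omega)
  have hle : rank T ≤ 2 := by
    rw [← rank_planeSyz (K := K) n 0]
    exact LinearMap.finrank_le_finrank_of_injective hφ
  rw [rank_planeSyz]
  -- In rank one `-2n ≤ -3n/2` suffices. In rank two the slopes have equal denominators and the
  -- degrees are compared directly.
  obtain h | h : rank T = 1 ∨ rank T = 2 := by omega
  · have h1 := le_of_rank_one φ hφ h ht
    rw [h, hs']
    have h2 : (t : ℚ) ≤ - (2 * n) := by exact_mod_cast h1
    have h3 : (0 : ℚ) ≤ n := by positivity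
    push_cast
    linarith
  · have h1 := HasDegree.le_of_injective hw φ hφ (h.trans (rank_planeSyz n 0).symm) ht hs
    rw [h]
    gcongr

end PlaneStability

/-- Syzygy bundles of powers of the variables on the plane are strongly semistable. -/
theorem isStronglySemistable_planeSyz {K : Type u} [Field K] (p : ℕ) [Fact p.Prime] [CharP K p]
    (a : ℕ) : IsStronglySemistable p (planeToSpec K) planeDivisorDegree (planeSyz K a 0) := by
  intro e
  obtain ⟨i⟩ := nonempty_frob_planeSyz_iso (K := K) p a e
  exact (isSemistable_planeSyz (a * p ^ e)).of_iso i.symm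

/-! ### Constants in the local rings of `Proj`. -/

section Constants
variable {K A : Type u} [CommRing A]

lemma appTop_of_comp_ι {X : Scheme.{u}} {U : X.Opens} (hU : ⊤ ≤ U) (g : X ⟶ U)
    (h : g ≫ U.ι = 𝟙 X) : U.topIso.inv ≫ g.appTop = X.presheaf.map (homOfLE hU).op := by
  have h1 : U.topIso.inv = U.ι.appLE U ⊤ (by simp) := by
    rw [Scheme.Opens.ι_appLE, Scheme.Opens.topIso_inv]
    rfl
  have h2 : g.appTop = g.appLE ⊤ ⊤ (le_refl (g ⁻¹ᵁ ⊤)) := g.app_eq_appLE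
  rw [h1, h2]
  refine (Scheme.Hom.appLE_comp_appLE g U.ι U ⊤ ⊤ _ _).trans ?_
  have : ∀ f : X ⟶ X, f = 𝟙 X → ∀ e, f.appLE U ⊤ e = X.presheaf.map (homOfLE hU).op := by
    rintro _ rfl e
    rw [Scheme.Hom.appLE, Scheme.Hom.id_app]
    exact Category.id_comp _
  exact this _ h _

lemma toSpecZero_appTop [CommRing K] [Algebra K A] (𝒜 : ℕ → Submodule K A) [GradedAlgebra 𝒜] :
    (Scheme.ΓSpecIso (.of (𝒜 0))).inv ≫ (Proj.toSpecZero 𝒜).appTop =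
      CommRingCat.ofHom (HomogeneousLocalization.fromZeroRingHom 𝒜 (Submonoid.powers 1)) ≫
        Proj.awayToSection 𝒜 1 ≫ (Proj 𝒜).presheaf.map (homOfLE (Proj.basicOpen_one 𝒜).ge).op := by
  rw [Proj.toSpecZero, ← Category.assoc (Proj 𝒜).topIso.inv, Scheme.Hom.comp_appTop,
    Scheme.Hom.comp_appTop (Proj.basicOpenToSpec 𝒜 1)]
  simp only [Category.assoc]
  have h1 := Scheme.ΓSpecIso_inv_naturality
    (CommRingCat.ofHom (HomogeneousLocalization.fromZeroRingHom 𝒜 (Submonoid.powers 1)))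
  rw [← reassoc_of% h1]
  have h2 : (Proj.basicOpenToSpec 𝒜 1).appTop = _ := Proj.basicOpenToSpec_app_top 𝒜 1
  rw [h2, Category.assoc, Category.assoc, appTop_of_comp_ι (Proj.basicOpen_one 𝒜).ge _ (by simp)]
  erw [Iso.inv_hom_id_assoc]

variable [Field K] [Algebra K A] (𝒜 : ℕ → Submodule K A) [GradedAlgebra 𝒜]

/-- Links the scalars entering `residueDegree`, defined through the structure morphism, with the
`K`-algebra structure of the graded ring. -/
lemma funVal_constants (c : K) (x : ProjectiveSpectrum 𝒜) :
    funVal (𝒜 := 𝒜) (U := ⊤) (constants (projToSpec 𝒜) ⊤ c) x trivial =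
      algebraMap A (LocAt 𝒜 x) (algebraMap K A c) := by
  have h1 := Scheme.ΓSpecIso_inv_naturality (CommRingCat.ofHom (algebraMap K (𝒜 0)))
  have h2 : CommRingCat.ofHom (constants (projToSpec 𝒜) ⊤) =
      CommRingCat.ofHom (algebraMap K (𝒜 0)) ≫
        CommRingCat.ofHom (HomogeneousLocalization.fromZeroRingHom 𝒜 (Submonoid.powers 1)) ≫
          Proj.awayToSection 𝒜 1 ≫
            (Proj 𝒜).presheaf.map (homOfLE (Proj.basicOpen_one 𝒜).ge).op := by
    rw [← toSpecZero_appTop, reassoc_of% h1, ← Scheme.Hom.comp_appTop]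
    refine CommRingCat.hom_ext ?_
    change ((Scheme.ΓSpecIso (.of K)).inv ≫ (projToSpec 𝒜).appTop ≫
      (Proj 𝒜).presheaf.map _).hom = _
    have h3 : (homOfLE le_top : (⊤ : (Proj 𝒜).Opens) ⟶ ⊤) = 𝟙 _ := rfl
    rw [h3, op_id, CategoryTheory.Functor.map_id, Category.comp_id]
    rfl
  have h : constants (projToSpec 𝒜) ⊤ c =
      (Proj 𝒜).presheaf.map (homOfLE (Proj.basicOpen_one 𝒜).ge).op
        (Proj.awayToSection 𝒜 1 (HomogeneousLocalization.fromZeroRingHom 𝒜 (Submonoid.powers 1)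
          (algebraMap K (𝒜 0) c))) := congrArg (fun f => f.hom c) h2
  rw [h]
  exact Localization.mk_one_eq_algebraMap _

/-- The ring homomorphism from the constants to the stalk at a point. -/
def stalkConstants (x : ProjectiveSpectrum 𝒜) : K →+* (Proj 𝒜).presheaf.stalk x :=
  ((Proj 𝒜).presheaf.germ ⊤ x trivial).hom.comp (constants (projToSpec 𝒜) ⊤)

lemma stalkVal_stalkConstants [IsDomain A] (x : ProjectiveSpectrum 𝒜) (c : K) :
    stalkVal x (stalkConstants 𝒜 x c) = algebraMap A (FractionRing A) (algebraMap K A c) :=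
  (stalkVal_fgerm (U := ⊤) x trivial _).trans ((congrArg (locToFrac x) (funVal_constants 𝒜 c x)).trans
    (locToFrac_algebraMap x _))

end Constants

/-! ### Irreducibility of the Fermat polynomial. -/

section Fermat
variable (K : Type u) [Field K] (d : ℕ)

open MvPolynomial

/-- The Fermat polynomial of degree `d`. -/
def fermat : MvPolynomial (Fin 3) K := X 0 ^ d + X 1 ^ d + X 2 ^ d

lemma isHomogeneous_fermat : (fermat K d).IsHomogeneous d :=
  ((isHomogeneous_X_pow 0 d).add (isHomogeneous_X_pow 1 d)).add (isHomogeneous_X_pow 2 d)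

variable {K d}

/-- A square factor would divide, once, both partial derivatives `d * X i ^ (d - 1)`. Since `d` is
invertible, the prime `f` would divide both variables. -/
lemma not_sq_dvd_X_pow_add (hd : (d : K) ≠ 0) {f : MvPolynomial (Fin 2) K} (hf : Prime f)
    (h : f ^ 2 ∣ X 0 ^ d + X 1 ^ d) : False := by
  have hd0 : d ≠ 0 := by
    rintro rfl
    simp at hd
  have h1 : ∀ i : Fin 2, f ∣ X i := by
    intro i
    have h2 : f ∣ pderiv i (X 0 ^ d + X 1 ^ d) := by
      obtain ⟨g, hg⟩ := h
      rw [hg, Derivation.leibniz, Derivation.leibniz_pow, smul_eq_mul, smul_eq_mul]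
      refine dvd_add (dvd_mul_of_dvd_left (dvd_pow_self f two_ne_zero) _) ?_
      simp only [Nat.add_one_sub_one, pow_one, nsmul_eq_mul, smul_eq_mul]
      exact dvd_mul_of_dvd_right (dvd_mul_of_dvd_right (dvd_mul_right _ _) _) _
    have h3 : pderiv i (X 0 ^ d + X 1 ^ d : MvPolynomial (Fin 2) K) = C (d : K) * X i ^ (d - 1) := by
      rw [map_add, Derivation.leibniz_pow, Derivation.leibniz_pow]
      fin_cases i <;> simp [pderiv_X]
    rw [h3, IsUnit.dvd_mul_left ((IsUnit.mk0 _ hd).map C)] at h2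
    exact hf.dvd_of_dvd_pow h2
  have h2 := (hf.irreducible.associated_of_dvd (X_prime (i := (0 : Fin 2)) (R := K)).irreducible
    (h1 0)).symm.dvd.trans (h1 1)
  rw [X_dvd_X] at h2
  simp at h2

/-- Eisenstein's criterion for a polynomial in the first variable, at an irreducible factor of the
sum of the other two `d`-th powers. That sum is squarefree by `not_sq_dvd_X_pow_add`. -/
lemma irreducible_fermat (hd : (d : K) ≠ 0) : Irreducible (fermat K d) := by
  have hd0 : d ≠ 0 := by
    rintro rfl
    simp at hd
  have hc : constantCoeff (X 0 ^ d + X 1 ^ d : MvPolynomial (Fin 2) K) = 0 := by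
    simp [hd0]
  have hne : (X 0 ^ d + X 1 ^ d : MvPolynomial (Fin 2) K) ≠ 0 := by
    intro h
    have h1 := congrArg (eval ![1, 0]) h
    simp [hd0] at h1
  have hu : ¬ IsUnit (X 0 ^ d + X 1 ^ d : MvPolynomial (Fin 2) K) := by
    intro h
    have := h.map constantCoeff
    rw [hc] at this
    exact not_isUnit_zero this
  obtain ⟨f, hf, hfd⟩ := WfDvdMonoid.exists_irreducible_factor hu hne
  have e : finSuccEquiv K 2 (fermat K d) =
      Polynomial.X ^ d + Polynomial.C (X 0 ^ d + X 1 ^ d) := by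
    rw [fermat, map_add, map_add, map_pow, map_pow, map_pow, finSuccEquiv_X_zero,
      show (1 : Fin 3) = Fin.succ 0 from rfl, show (2 : Fin 3) = Fin.succ 1 from rfl,
      finSuccEquiv_X_succ, finSuccEquiv_X_succ, map_add, map_pow, map_pow, add_assoc]
  rw [← MulEquiv.irreducible_iff (finSuccEquiv K 2), e]
  have hm := Polynomial.monic_X_pow_add_C (X 0 ^ d + X 1 ^ d : MvPolynomial (Fin 2) K) hd0
  have hp : (Ideal.span {f}).IsPrime := (Ideal.span_singleton_prime hf.ne_zero).mpr hf.prime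
  refine Polynomial.irreducible_of_eisenstein_criterion hp ?_ ?_ ?_ ?_ hm.isPrimitive
  · rw [hm.leadingCoeff]
    exact fun h => hp.ne_top ((Ideal.eq_top_iff_one _).mpr h)
  · intro n hn
    rw [Polynomial.degree_X_pow_add_C (Nat.pos_of_ne_zero hd0), Nat.cast_lt] at hn
    rw [Polynomial.coeff_add, Polynomial.coeff_X_pow, if_neg hn.ne, zero_add, Polynomial.coeff_C]
    split_ifs
    · exact Ideal.mem_span_singleton.mpr hfd
    · exact zero_mem _
  · rw [Polynomial.degree_X_pow_add_C (Nat.pos_of_ne_zero hd0)]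
    exact_mod_cast Nat.pos_of_ne_zero hd0
  · rw [Polynomial.coeff_add, Polynomial.coeff_X_pow, if_neg hd0.symm, zero_add,
      Polynomial.coeff_C_zero, Ideal.span_singleton_pow, Ideal.mem_span_singleton]
    exact not_sq_dvd_X_pow_add hd hf.prime

/-- The homogeneous ideal of the Fermat curve. -/
abbrev fermatIdeal (K : Type u) [Field K] (d : ℕ) : HomogeneousIdeal (planeGrading K) :=
  curveIdeal (fermat K d) (isHomogeneous_fermat K d)

lemma isDomain_fermat (hd : (d : K) ≠ 0) :
    IsDomain (MvPolynomial (Fin 3) K ⧸ (fermatIdeal K d).toIdeal) := by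
  have : (fermatIdeal K d).toIdeal.IsPrime :=
    (Ideal.span_singleton_prime (irreducible_fermat hd).ne_zero).mpr (irreducible_fermat hd).prime
  exact Ideal.Quotient.isDomain _

end Fermat

/-! ### Hypersurface sections and positivity of their degree. -/

section Hyperplane
variable {A σ : Type u} [CommRing A] [SetLike σ A] [AddSubgroupClass σ A]
variable {𝒜 : ℕ → σ} [GradedRing 𝒜]

/-- The homogeneous prime ideal of a point. -/
def pointIdeal (x : Proj 𝒜) : Ideal A :=
  (show ProjectiveSpectrum 𝒜 from x).asHomogeneousIdeal.toIdeal

lemma pointIdeal_isPrime (x : Proj 𝒜) : (pointIdeal x).IsPrime :=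
  (show ProjectiveSpectrum 𝒜 from x).isPrime

lemma proj_le_iff {x y : Proj 𝒜} : x ≤ y ↔ pointIdeal y ≤ pointIdeal x := by
  have h := ProjectiveSpectrum.le_iff_mem_closure (𝒜 := 𝒜) y x
  exact (specializes_iff_mem_closure (x := y) (y := x)).trans h.symm

variable [IsDomain A] [IsIntegral (Proj 𝒜)]

/-- Hypersurface sections have points of codimension one. -/
lemma exists_coheight_eq_one [IsNoetherianRing A] {f g : A} {m n : ℕ} (hf : f ∈ 𝒜 m) (hf0 : f ≠ 0)
    (hn : 0 < n) (hg : g ∈ 𝒜 n) (J : Ideal A) [J.IsPrime] (hfJ : f ∈ J) (hgJ : g ∉ J) :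
    ∃ y : Proj 𝒜, Order.coheight y = 1 ∧ f ∈ pointIdeal y ∧ g ∉ pointIdeal y := by
  obtain ⟨P, hP, hPJ⟩ := Ideal.exists_minimalPrimes_le
    (show Ideal.span {f} ≤ J by rwa [Ideal.span_le, Set.singleton_subset_iff])
  have hprime : P.IsPrime := hP.1.1
  have hfP : f ∈ P := hP.1.2 (Ideal.mem_span_singleton_self f)
  -- `J` need not be homogeneous. The homogeneous core of a minimal prime `P` over `f` is prime and
  -- still contains `f`, so minimality makes `P` itself homogeneous.
  let Q := P.homogeneousCore 𝒜
  have hQP : Q.toIdeal ≤ P := Ideal.toIdeal_homogeneousCore_le 𝒜 P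
  have hfQ : f ∈ Q.toIdeal := Ideal.mem_homogeneousCore_of_homogeneous_of_mem ⟨m, hf⟩ hfP
  have hgQ : g ∉ Q.toIdeal := fun h => hgJ (hPJ (hQP h))
  have hQ : Q.toIdeal.IsPrime := hprime.homogeneousCore
  have hPQ : P = Q.toIdeal := le_antisymm (hP.2 ⟨hQ, by
    rwa [Ideal.span_le, Set.singleton_subset_iff]⟩ hQP) hQP
  let y : Proj 𝒜 := (⟨Q, hQ, fun h => hgQ (h (HomogeneousIdeal.mem_irrelevant_of_mem _ hn hg))⟩ :
    ProjectiveSpectrum 𝒜)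
  have hy : pointIdeal y = P := hPQ.symm
  have hbot : ∀ z : Proj 𝒜, pointIdeal z = ⊥ → IsMax z := fun z hz t _ => by
    rw [proj_le_iff, hz]
    exact bot_le
  have hg0 : g ≠ 0 := fun h => hgQ (h ▸ zero_mem _)
  have hgen : pointIdeal (genericPoint (Proj 𝒜)) = ⊥ :=
    congrArg HomogeneousIdeal.toIdeal (genPt_eq_bot hn hg hg0)
  refine ⟨y, le_antisymm ?_ ?_, hfQ, hgQ⟩
  · rw [← Nat.cast_one, Order.coheight_le_coe_iff]
    intro z hz
    have h1 : pointIdeal z < P := by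
      rw [← hy, lt_iff_le_not_ge, ← proj_le_iff, ← proj_le_iff]
      exact ⟨hz.le, hz.not_ge⟩
    -- Krull's principal ideal theorem bounds the height of `P` by one, so a point strictly above
    -- `y` has ideal zero.
    have h2 := Ideal.height_le_one_of_isPrincipal_of_mem_minimalPrimes _ P hP
    rw [← Nat.cast_one, Ideal.height_le_iff] at h2
    have hz' := pointIdeal_isPrime z
    have h3 := h2 _ hz' h1
    rw [Nat.cast_one, Order.lt_one_iff, Ideal.height_eq_zero_iff_eq_bot] at h3
    rw [Order.coheight_eq_zero.mpr (hbot z h3)]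
    exact_mod_cast one_pos
  · have hlt : y < genericPoint (Proj 𝒜) := by
      rw [lt_iff_le_not_ge, proj_le_iff, proj_le_iff, hgen]
      refine ⟨bot_le, fun h => hf0 ?_⟩
      exact h hfQ
    exact le_trans le_add_self (Order.coheight_add_one_le hlt)

variable [IsLocallyNoetherian (Proj 𝒜)] (x : Fin 3 → A) (hx : ∀ i, x i ∈ 𝒜 1) (hx0 : ∀ i, x i ≠ 0)
  (hc : ⨆ i, Proj.basicOpen 𝒜 (x i) = ⊤)

lemma exists_hyperplane_eq (y : Proj 𝒜) : ∃ t : (Proj 𝒜).presheaf.stalk y, t ≠ 0 ∧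
    hyperplane x hx hx0 hc y = Scheme.ord (algebraMap _ (Proj 𝒜).functionField t) y ∧
    (IsUnit t ↔ x 0 ∉ pointIdeal y) := by
  obtain ⟨t, ht, hu⟩ := exists_stalkVal_eq (show ProjectiveSpectrum 𝒜 from y) (hx 0)
    (hx (chartIdx x hc y)) (mem_chartIdx x hc y)
  have h : ratio x hx hx0 (chartIdx x hc y) 0 = algebraMap ((Proj 𝒜).presheaf.stalk y) _ t := by
    refine fieldVal_injective ?_
    rw [fieldVal_ratio, fieldVal_algebraMap]
    exact ht.symm
  refine ⟨t, ?_, congrArg (fun z => Scheme.ord z y) h, hu⟩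
  rintro rfl
  rw [map_zero] at h
  exact ratio_ne_zero x hx hx0 _ _ h

/-- The divisor of a regular section has nonnegative multiplicities, and `y` contributes a positive
term because `x 0` gives a non-unit there. -/
lemma hyperplaneDegree_pos (w : Proj 𝒜 → ℕ) {y : Proj 𝒜} (hy : Order.coheight y = 1)
    (hy0 : x 0 ∈ pointIdeal y) (hw : w y ≠ 0) : 0 < hyperplaneDegree x hx hx0 hc w := by
  refine Finset.sum_pos' (fun z _ => ?_) ⟨y, ?_, ?_⟩
  · obtain ⟨t, -, h, -⟩ := exists_hyperplane_eq x hx hx0 hc z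
    rw [h]
    exact mul_nonneg (ord_nonneg ⟨t, rfl⟩) (Nat.cast_nonneg _)
  all_goals
    obtain ⟨t, ht, h, hu⟩ := exists_hyperplane_eq x hx hx0 hc y
    have hpos := ord_pos hy ht fun h => hu.mp h hy0
    rw [← h] at hpos
  · exact Finsupp.mem_support_iff.mpr hpos.ne'
  · exact mul_pos hpos (by exact_mod_cast Nat.pos_of_ne_zero hw)

end Hyperplane

/-! ### Residue fields of points on a coordinate line. -/

section Evaluation

/-- Applied with `c` the inverse of a coordinate, to pass from homogeneous to affine coordinates. -/
lemma eval₂_mul_of_isHomogeneous {K R : Type*} [CommRing K] [CommRing R] (φ : K →+* R)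
    (v : Fin 3 → R) (c : R) {n : ℕ} {P : MvPolynomial (Fin 3) K} (hP : P.IsHomogeneous n) :
    P.eval₂ φ (fun i => v i * c) = P.eval₂ φ v * c ^ n := by
  rw [MvPolynomial.eval₂_eq', MvPolynomial.eval₂_eq', Finset.sum_mul]
  refine Finset.sum_congr rfl fun μ hμ => ?_
  have h : ∑ i, μ i = n := by
    have h1 : μ.degree = n := by
      rw [Finsupp.degree_eq_weight_one]
      exact hP (MvPolynomial.mem_support_iff.mp hμ)
    rw [← h1, Finsupp.degree_eq_sum]
  simp only [mul_pow]
  rw [Finset.prod_mul_distrib, Finset.prod_pow_eq_pow_sum, h, mul_assoc]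

end Evaluation

section ResidueDegree
variable {K A : Type u} [Field K] [CommRing A] [IsDomain A] [Algebra K A]
variable {𝒜 : ℕ → Submodule K A} [GradedAlgebra 𝒜] {x : Fin 3 → A} (hx : ∀ i, x i ∈ 𝒜 1)

include hx in
/-- The affine coordinates `x i / x j` as elements of the local ring. -/
lemma exists_affineCoord {y : ProjectiveSpectrum 𝒜} {j : Fin 3}
    (hy : x j ∉ y.asHomogeneousIdeal.toIdeal) :
    ∃ τ : Fin 3 → (Proj 𝒜).presheaf.stalk y, τ j = 1 ∧
      (∀ i, IsUnit (τ i) ↔ x i ∉ y.asHomogeneousIdeal.toIdeal) ∧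
      ∀ (n : ℕ) (P : MvPolynomial (Fin 3) K), P.IsHomogeneous n →
        stalkVal y (P.eval₂ (stalkConstants 𝒜 y) τ) =
          algebraMap A (FractionRing A) (MvPolynomial.aeval x P) /
            algebraMap A (FractionRing A) (x j ^ n) := by
  have h := fun i => exists_stalkVal_eq y (hx i) (hx j) hy
  choose τ hτ hu using h
  have h0 : x j ≠ 0 := fun h => hy (h ▸ zero_mem _)
  refine ⟨τ, ?_, hu, fun n P hP => ?_⟩
  · refine stalkVal_injective y ?_
    rw [hτ, div_self (algebraMap_ne_zero_of h0), map_one]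
  · have h1 := eval₂_mul_of_isHomogeneous ((algebraMap A (FractionRing A)).comp (algebraMap K A))
      (fun i => algebraMap A (FractionRing A) (x i)) (algebraMap A (FractionRing A) (x j))⁻¹ hP
    rw [MvPolynomial.hom_eval₂]
    have h2 : (stalkVal y).comp (stalkConstants 𝒜 y) =
        (algebraMap A (FractionRing A)).comp (algebraMap K A) :=
      RingHom.ext fun c => stalkVal_stalkConstants 𝒜 y c
    have h3 : (fun i => stalkVal y (τ i)) = fun i => algebraMap A (FractionRing A) (x i) *
        (algebraMap A (FractionRing A) (x j))⁻¹ := by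
      funext i
      exact (hτ i).trans (div_eq_mul_inv _ _)
    rw [h2, h3, h1, MvPolynomial.aeval_def, MvPolynomial.hom_eval₂, map_pow, inv_pow, div_eq_mul_inv]

include hx in
/-- Points on the line `x 0 = 0` of a curve `x 0 ^ d + x 1 ^ d + x 2 ^ d = 0` have finite residue
field. -/
lemma residueDegree_ne_zero (hA : ∀ (n : ℕ), ∀ a ∈ 𝒜 n, ∃ P : MvPolynomial (Fin 3) K,
      P.IsHomogeneous n ∧ MvPolynomial.aeval x P = a) {d : ℕ} (hd0 : d ≠ 0)
    (hrel : x 0 ^ d + x 1 ^ d + x 2 ^ d = 0) {y : Proj 𝒜} (hy0 : x 0 ∈ pointIdeal y)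
    (hy : x 1 ∉ pointIdeal y) : residueDegree (projToSpec 𝒜) y ≠ 0 := by
  obtain ⟨τ, hτ1, hτu, hτ⟩ := exists_affineCoord hx hy
  let κ := (Proj 𝒜).residueField y
  let ρ : (Proj 𝒜).presheaf.stalk y →+* κ := ((Proj 𝒜).residue y).hom
  let φ : K →+* κ := ρ.comp (stalkConstants 𝒜 y)
  let : Algebra K κ := φ.toAlgebra
  have hρ0 : ρ (τ 0) = 0 := by
    refine (IsLocalRing.residue_eq_zero_iff (τ 0)).mpr ?_
    exact (IsLocalRing.mem_maximalIdeal _).mpr fun h => (hτu 0).mp h hy0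
  -- Since `x 0 / x 1` vanishes in the residue field, the equation of the curve makes the class of
  -- `x 2 / x 1` a root of `T ^ d + 1`.
  have hint : _root_.IsIntegral K (ρ (τ 2)) := by
    have h1 := hτ d _ (isHomogeneous_fermat K d)
    have h2 : MvPolynomial.aeval x (fermat K d) = 0 := by
      rw [fermat, map_add, map_add, map_pow, map_pow, map_pow, MvPolynomial.aeval_X,
        MvPolynomial.aeval_X, MvPolynomial.aeval_X, hrel]
    rw [h2, map_zero, zero_div] at h1
    have h3 := stalkVal_injective (show ProjectiveSpectrum 𝒜 from y) (h1.trans (map_zero _).symm)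
    have h4 := congrArg ρ h3
    rw [fermat, MvPolynomial.eval₂_add, MvPolynomial.eval₂_add, MvPolynomial.eval₂_pow,
      MvPolynomial.eval₂_pow, MvPolynomial.eval₂_pow, MvPolynomial.eval₂_X, MvPolynomial.eval₂_X,
      MvPolynomial.eval₂_X, map_add, map_add, map_pow, map_pow, map_pow, hρ0, hτ1, map_one,
      map_zero, one_pow, zero_pow hd0, zero_add] at h4
    refine ⟨Polynomial.X ^ d + Polynomial.C 1, Polynomial.monic_X_pow_add_C _ hd0, ?_⟩
    rw [Polynomial.eval₂_add, Polynomial.eval₂_X_pow, Polynomial.eval₂_C, map_one, add_comm]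
    exact h4
  have hfin := IntermediateField.adjoin.finiteDimensional hint
  have hmem : ∀ P : MvPolynomial (Fin 3) K, ρ (P.eval₂ (stalkConstants 𝒜 y) τ) ∈
      IntermediateField.adjoin K {ρ (τ 2)} := by
    intro P
    rw [MvPolynomial.hom_eval₂]
    refine MvPolynomial.eval₂_mem (fun i _ => ?_) fun i => ?_
    · exact (IntermediateField.adjoin K {ρ (τ 2)}).algebraMap_mem _
    · fin_cases i
      · exact hρ0 ▸ zero_mem _
      · exact (congrArg ρ hτ1).trans (map_one ρ) ▸ one_mem _
      · exact IntermediateField.mem_adjoin_simple_self K _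
  -- Every germ is a quotient of homogeneous polynomials in the coordinates, whose affine
  -- coordinates reduce to `0`, `1` and `ρ (τ 2)`.
  have htop : IntermediateField.adjoin K {ρ (τ 2)} = ⊤ := by
    refine eq_top_iff.mpr fun z _ => ?_
    obtain ⟨r, rfl⟩ := Ideal.Quotient.mk_surjective z
    obtain ⟨k, a, b, ha, hb, hby, hr, -⟩ :=
      exists_stalkVal_eq_div (show ProjectiveSpectrum 𝒜 from y) r
    obtain ⟨P, hP, rfl⟩ := hA k a ha
    obtain ⟨Q, hQ, rfl⟩ := hA k b hb
    have hxk : x 1 ^ k ∈ 𝒜 k := by simpa using SetLike.pow_mem_graded k (hx 1)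
    have hyk : x 1 ^ k ∉ (show ProjectiveSpectrum 𝒜 from y).asHomogeneousIdeal.toIdeal :=
      fun h => hy ((pointIdeal_isPrime y).mem_of_pow_mem _ h)
    obtain ⟨t, ht, htu⟩ := exists_stalkVal_eq (show ProjectiveSpectrum 𝒜 from y) hb hxk hyk
    obtain rfl : t = Q.eval₂ (stalkConstants 𝒜 y) τ :=
      stalkVal_injective (show ProjectiveSpectrum 𝒜 from y) (ht.trans (hτ k Q hQ).symm)
    have h1 : r * Q.eval₂ (stalkConstants 𝒜 y) τ = P.eval₂ (stalkConstants 𝒜 y) τ := by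
      refine stalkVal_injective (show ProjectiveSpectrum 𝒜 from y) ?_
      refine (map_mul _ _ _).trans (Eq.trans ?_ (hτ k P hP).symm)
      rw [hr, ht]
      refine div_mul_div_cancel₀ (algebraMap_ne_zero_of fun h => hby ?_)
      rw [h]
      exact zero_mem _
    have h2 : ρ (Q.eval₂ (stalkConstants 𝒜 y) τ) ≠ 0 := ((htu.mpr hby).map ρ).ne_zero
    have h3 : ρ r * ρ (Q.eval₂ (stalkConstants 𝒜 y) τ) = ρ (P.eval₂ (stalkConstants 𝒜 y) τ) :=
      (map_mul ρ _ _).symm.trans (congrArg ρ h1)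
    change ρ r ∈ _
    rw [eq_div_of_mul_eq h2 h3]
    exact div_mem (hmem P) (hmem Q)
  -- Finiteness is essential: `finrank` would be zero for an infinite extension.
  have hfin' : Module.Finite K κ := by
    rw [htop] at hfin
    exact Module.Finite.equiv (IntermediateField.topEquiv (F := K) (E := κ)).toLinearEquiv
  have h := (Module.finrank_pos (R := K) (M := κ)).ne'
  exact h

end ResidueDegree

/-! ### Points on the Fermat curve and the degree of its line section. -/

section FermatPoint
variable {K : Type u} [Field K] {d : ℕ} (hd : (d : K) ≠ 0)

/-- The Fermat curve. -/
abbrev FermatCurve (K : Type u) [Field K] (d : ℕ) : Scheme.{u} :=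
  PlaneCurve (fermat K d) (isHomogeneous_fermat K d)

/-- The coordinates on the Fermat curve. -/
abbrev fermatVar (K : Type u) [Field K] (d : ℕ) (i : Fin 3) :
    MvPolynomial (Fin 3) K ⧸ (fermatIdeal K d).toIdeal :=
  curveVar (fermat K d) (isHomogeneous_fermat K d) i

lemma sum_fermatVar_pow : fermatVar K d 0 ^ d + fermatVar K d 1 ^ d + fermatVar K d 2 ^ d = 0 := by
  refine Eq.trans ?_ (Ideal.Quotient.eq_zero_iff_mem.mpr
    (Ideal.mem_span_singleton_self (fermat K d)))
  rw [fermat, map_add, map_add, map_pow, map_pow, map_pow]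
  rfl

include hd in
lemma pos_of_cast_ne_zero : 0 < d := Nat.pos_of_ne_zero (by rintro rfl; simp at hd)

include hd in
/-- The Fermat curve has points on the coordinate lines. -/
lemma exists_prime_fermat (i : Fin 3) :
    ∃ J : Ideal (MvPolynomial (Fin 3) K ⧸ (fermatIdeal K d).toIdeal),
      J.IsPrime ∧ fermatVar K d (i + 2) ∈ J ∧ fermatVar K d i ∉ J := by
  have hd0 := pos_of_cast_ne_zero hd
  obtain ⟨ζ, hζ⟩ := IsAlgClosed.exists_pow_nat_eq (-1 : AlgebraicClosure K) hd0
  -- The point with coordinates `1`, `ζ`, `0` at the places `i`, `i + 1`, `i + 2`, taken cyclically,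
  -- lies on the curve because `ζ ^ d = -1`. The required prime is the kernel of evaluation there.
  let v : Fin 3 → AlgebraicClosure K := fun j => if j = i then 1 else if j = i + 1 then ζ else 0
  let φ : MvPolynomial (Fin 3) K →+* AlgebraicClosure K := (MvPolynomial.aeval v : _ →ₐ[K] _).toRingHom
  have hφ : ∀ j, φ (MvPolynomial.X j) = v j := fun j => MvPolynomial.aeval_X _ j
  have h : ∀ a ∈ (fermatIdeal K d).toIdeal, φ a = 0 := by
    intro a ha
    obtain ⟨b, rfl⟩ := Ideal.mem_span_singleton.mp ha
    have : φ (fermat K d) = 0 := by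
      rw [fermat, map_add, map_add, map_pow, map_pow, map_pow, hφ, hφ, hφ]
      fin_cases i <;> simp [v, hζ, hd0.ne']
    rw [map_mul, this, zero_mul]
  refine ⟨RingHom.ker (Ideal.Quotient.lift _ φ h), RingHom.ker_isPrime _, ?_, ?_⟩
  · refine (Ideal.Quotient.lift_mk _ φ h).trans ((hφ _).trans ?_)
    fin_cases i <;> simp [v]
  · intro h1
    have h2 : φ (MvPolynomial.X i) = 0 := (Ideal.Quotient.lift_mk _ φ h).symm.trans h1
    rw [hφ] at h2
    exact one_ne_zero ((if_pos rfl).symm.trans h2)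

include hd in
lemma fermatVar_ne_zero (i : Fin 3) : fermatVar K d i ≠ 0 := fun h => by
  obtain ⟨J, -, -, hJ⟩ := exists_prime_fermat hd i
  exact hJ (h ▸ zero_mem J)

lemma exists_aeval_eq {F : MvPolynomial (Fin 3) K} (hF : F.IsHomogeneous d) (n : ℕ)
    {a : MvPolynomial (Fin 3) K ⧸ (curveIdeal F hF).toIdeal} (ha : a ∈ curveGrading F hF n) :
    ∃ P : MvPolynomial (Fin 3) K, P.IsHomogeneous n ∧ MvPolynomial.aeval (curveVar F hF) P = a := by
  obtain ⟨P, hP, rfl⟩ := ha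
  refine ⟨P, hP, ?_⟩
  exact (DFunLike.congr_fun (MvPolynomial.aeval_unique
    (Ideal.Quotient.mkₐ K (curveIdeal F hF).toIdeal)) P).symm

variable [IsDomain (MvPolynomial (Fin 3) K ⧸ (fermatIdeal K d).toIdeal)]

include hd in
lemma isIntegral_fermatCurve : IsIntegral (FermatCurve K d) :=
  isIntegral_proj _ one_pos (curveVar_mem (fermat K d) (isHomogeneous_fermat K d) 0)
    (fermatVar_ne_zero hd 0)

variable [IsIntegral (FermatCurve K d)]

/-- The degree of a line section of the Fermat curve. -/
def fermatDegree : ℤ :=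
  hyperplaneDegree (fermatVar K d) (curveVar_mem (fermat K d) (isHomogeneous_fermat K d))
    (fermatVar_ne_zero hd) (curve_cover (fermat K d) (isHomogeneous_fermat K d))
    (curvePointDegree (fermat K d) (isHomogeneous_fermat K d))

/-- A point with `x 0 = 0` and `x 1 ≠ 0` has codimension one and finite residue degree, so it
contributes to the line section. -/
lemma fermatDegree_pos : 0 < fermatDegree hd := by
  obtain ⟨J, hJ, h0, h1⟩ := exists_prime_fermat hd 1
  obtain ⟨y, hy, hy0, hy1⟩ := exists_coheight_eq_one
    (curveVar_mem (fermat K d) (isHomogeneous_fermat K d) 0) (fermatVar_ne_zero hd 0) one_pos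
    (curveVar_mem (fermat K d) (isHomogeneous_fermat K d) 1) J h0 h1
  refine hyperplaneDegree_pos _ _ _ _ _ hy hy0 ?_
  exact residueDegree_ne_zero (curveVar_mem (fermat K d) (isHomogeneous_fermat K d))
    (fun n a ha => exists_aeval_eq _ n ha) (pos_of_cast_ne_zero hd).ne' sum_fermatVar_pow hy0 hy1

end FermatPoint

/-! ### Smoothness of the Fermat curve. -/

section FormallySmooth

/-- One Newton step in the coordinate `i`: with `E = ∑ j, b j ^ d` and `c` an inverse of `d * b i ^
(d - 1)`, replacing `b i` by `b i - E * c` removes `E`, and the remainder contains `E ^ 2 = 0`. The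
coordinate `b i` is a unit because it is `1` modulo a square-zero ideal. -/
lemma exists_fermat_lift {B : Type*} [CommRing B] {d : ℕ} (hd : IsUnit (d : B)) (i : Fin 3)
    {I : Ideal B} (hI : I ^ 2 = ⊥) {b : Fin 3 → B} (hb : ∑ j, b j ^ d ∈ I) (hbi : b i - 1 ∈ I) :
    ∃ b' : Fin 3 → B, ∑ j, b' j ^ d = 0 ∧ IsUnit (b' i) ∧ ∀ j, b' j - b j ∈ I := by
  have hsq : ∀ x ∈ I, x ^ 2 = 0 := fun x hx => by
    have := Ideal.pow_mem_pow hx 2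
    rwa [hI, Ideal.mem_bot] at this
  have hu : ∀ x, x - 1 ∈ I → IsUnit x := fun x hx =>
    IsUnit.of_mul_eq_one (2 - x) (by linear_combination - hsq _ hx)
  obtain ⟨c, hc⟩ := (hd.mul ((hu _ hbi).pow (d - 1))).exists_right_inv
  obtain ⟨k, hk⟩ := Polynomial.powAddExpansion (b i) (- ((∑ j, b j ^ d) * c)) d
  have hE := hsq _ hb
  have hEc : (∑ j, b j ^ d) * c ∈ I := I.mul_mem_right _ hb
  refine ⟨Function.update b i (b i - (∑ j, b j ^ d) * c), ?_, ?_, fun j => ?_⟩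
  · rw [← Finset.add_sum_erase _ _ (Finset.mem_univ i), Function.update_self, sub_eq_add_neg, hk]
    have h1 : ∑ j ∈ Finset.univ.erase i,
        Function.update b i (b i + -((∑ j, b j ^ d) * c)) j ^ d =
          ∑ j ∈ Finset.univ.erase i, b j ^ d :=
      Finset.sum_congr rfl fun j hj => by rw [Function.update_of_ne (Finset.ne_of_mem_erase hj)]
    have h2 := Finset.add_sum_erase Finset.univ (fun j => b j ^ d) (Finset.mem_univ i)
    rw [h1]
    linear_combination h2 - (∑ j, b j ^ d) * hc + k * c ^ 2 * hE
  · rw [Function.update_self]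
    refine hu _ ?_
    rw [sub_right_comm]
    exact I.sub_mem hbi hEc
  · by_cases h : j = i
    · subst h
      rw [Function.update_self, sub_sub_cancel_left]
      exact I.neg_mem hEc
    · rw [Function.update_of_ne h, sub_self]
      exact I.zero_mem

/-- The infinitesimal lifting property for an affine chart of the Fermat curve. -/
lemma formallySmooth_of_fermat {K S : Type u} [Field K] [CommRing S] [Algebra K S] {d : ℕ}
    (hd : (d : K) ≠ 0) (i : Fin 3) {v : Fin 3 → S} (hvi : v i = 1) (hv : ∑ j, v j ^ d = 0)
    (hsurj : Function.Surjective (MvPolynomial.aeval v : MvPolynomial (Fin 3) K →ₐ[K] S))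
    (hS : ∀ {B : Type u} [CommRing B] [Algebra K B] (b : Fin 3 → B), ∑ j, b j ^ d = 0 →
      IsUnit (b i) → ∃ ψ : S →ₐ[K] B, ∀ j, ψ (v j) * b i = b j) :
    Algebra.FormallySmooth K S := by
  refine Algebra.FormallySmooth.of_comp_surjective fun B _ _ I hI f => ?_
  choose b hb using fun j => Ideal.Quotient.mk_surjective (I := I) (f (v j))
  have hdB : IsUnit (d : B) := by
    have := (IsUnit.mk0 _ hd).map (algebraMap K B)
    rwa [map_natCast] at this
  obtain ⟨b', h0, hu, hb'⟩ := exists_fermat_lift hdB i hI (b := b) (by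
      rw [← Ideal.Quotient.eq_zero_iff_mem, map_sum]
      simp only [map_pow, hb]
      rw [← map_zero f, ← hv, map_sum]
      simp only [map_pow]) (by
      rw [← Ideal.Quotient.eq_zero_iff_mem, map_sub, hb, hvi, map_one, map_one, sub_self])
  -- The corrected `b' i` is a unit but no longer `1`, so `ψ` uses the ratios `b' j / b' i`. These
  -- still reduce to `f (v j)` because `b' i` reduces to `1`.
  obtain ⟨ψ, hψ⟩ := hS b' h0 hu
  have hmk : ∀ j, Ideal.Quotient.mk I (b' j) = f (v j) := fun j => by
    rw [← hb, ← sub_eq_zero, ← map_sub, Ideal.Quotient.eq_zero_iff_mem]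
    exact hb' j
  refine ⟨ψ, ?_⟩
  have h : ((Ideal.Quotient.mkₐ K I).comp ψ).comp (MvPolynomial.aeval v) =
      f.comp (MvPolynomial.aeval v) := by
    refine MvPolynomial.algHom_ext fun j => ?_
    simp only [AlgHom.comp_apply, MvPolynomial.aeval_X]
    have h1 := congrArg (Ideal.Quotient.mk I) (hψ j)
    rw [map_mul, hmk, hmk, hvi, map_one, mul_one] at h1
    exact h1
  refine AlgHom.ext fun s => ?_
  obtain ⟨P, rfl⟩ := hsurj s
  exact DFunLike.congr_fun h P

end FormallySmooth

/-! ### Affine charts. -/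

section Chart
variable {K A : Type u} [Field K] [CommRing A] [Algebra K A]
variable {𝒜 : ℕ → Submodule K A} [GradedAlgebra 𝒜] {x : Fin 3 → A} (hx : ∀ i, x i ∈ 𝒜 1)

variable (𝒜) in
/-- The constants in the coordinate ring of a chart. -/
def awayConstants (f : A) : K →+* HomogeneousLocalization.Away 𝒜 f :=
  (HomogeneousLocalization.fromZeroRingHom 𝒜 (Submonoid.powers f)).comp (algebraMap K (𝒜 0))

include hx in
-- The chart ring is generated by the ratios `x j / x i`, which satisfy the dehomogenized equation.
-- A solution `b` with `b i` a unit defines a map on `A`, which extends to `A[1 / x i]` and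
-- restricts to the chart. This is the input of `formallySmooth_of_fermat`; finite presentation
-- follows from finite type over a field.
lemma smooth_awayConstants (hA : ∀ (n : ℕ), ∀ a ∈ 𝒜 n, ∃ P : MvPolynomial (Fin 3) K,
      P.IsHomogeneous n ∧ MvPolynomial.aeval x P = a) {d : ℕ} (hd : (d : K) ≠ 0)
    (hrel : ∑ j, x j ^ d = 0)
    (hlift : ∀ {B : Type u} [CommRing B] [Algebra K B] (b : Fin 3 → B), ∑ j, b j ^ d = 0 →
      ∃ χ : A →ₐ[K] B, ∀ j, χ (x j) = b j) (i : Fin 3) :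
    (awayConstants 𝒜 (x i)).Smooth := by
  let S := HomogeneousLocalization.Away 𝒜 (x i)
  let L := Localization.Away (x i)
  let : Algebra K S := (awayConstants 𝒜 (x i)).toAlgebra
  let v : Fin 3 → S := fun j => HomogeneousLocalization.Away.mk 𝒜 (hx i) 1 (x j) (hx j)
  let val : S →+* L := algebraMap S L
  have hval : Function.Injective val := HomogeneousLocalization.val_injective _
  have hc : ∀ c : K, val (algebraMap K S c) = algebraMap A L (algebraMap K A c) := fun c =>
    Localization.mk_one_eq_algebraMap _
  let w : L := Localization.mk 1 ⟨x i, Submonoid.mem_powers (x i)⟩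
  have hw : algebraMap A L (x i) * w = 1 := by
    rw [← Localization.mk_one_eq_algebraMap, Localization.mk_mul, mul_one, one_mul]
    exact Localization.mk_self (⟨x i, Submonoid.mem_powers (x i)⟩ : Submonoid.powers (x i))
  have hwn : ∀ (n : ℕ) (a : A) (h : x i ^ n ∈ Submonoid.powers (x i)),
      (Localization.mk a ⟨x i ^ n, h⟩ : L) = algebraMap A L a * w ^ n := by
    intro n a h
    rw [← Localization.mk_one_eq_algebraMap, Localization.mk_pow, Localization.mk_mul, one_pow,
      mul_one, one_mul]
    rfl
  have hv : ∀ j, val (v j) = algebraMap A L (x j) * w := fun j =>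
    (hwn 1 (x j) _).trans (by rw [pow_one])
  have hvi : v i = 1 := hval (by rw [hv, hw, map_one])
  have hvd : ∑ j, v j ^ d = 0 := hval (by
    rw [map_sum, map_zero]
    simp only [map_pow, hv, mul_pow]
    rw [← Finset.sum_mul]
    simp only [← map_pow]
    rw [← map_sum, hrel, map_zero, zero_mul])
  have hsurj : Function.Surjective (MvPolynomial.aeval v : MvPolynomial (Fin 3) K →ₐ[K] S) := by
    intro z
    obtain ⟨n, a, ha, rfl⟩ := HomogeneousLocalization.Away.mk_surjective 𝒜 (hx i) z
    obtain ⟨P, hP, rfl⟩ := hA _ a ha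
    refine ⟨P, hval ?_⟩
    have h1 := eval₂_mul_of_isHomogeneous ((algebraMap A L).comp (algebraMap K A))
      (fun j => algebraMap A L (x j)) w hP
    have h2 : val.comp (algebraMap K S) = (algebraMap A L).comp (algebraMap K A) :=
      RingHom.ext hc
    rw [MvPolynomial.aeval_def, MvPolynomial.hom_eval₂, h2]
    simp only [hv]
    rw [h1]
    exact Eq.symm ((hwn n (MvPolynomial.aeval x P) _).trans (by
      rw [MvPolynomial.aeval_def, MvPolynomial.hom_eval₂, smul_eq_mul, mul_one]))
  have hfs : Algebra.FormallySmooth K S := by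
    refine formallySmooth_of_fermat hd i hvi hvd hsurj fun {B} _ _ b hb hbi => ?_
    obtain ⟨χ, hχ⟩ := hlift b hb
    let ψ : L →+* B := IsLocalization.Away.lift (x i) (g := χ.toRingHom) (by
      change IsUnit (χ (x i))
      rwa [hχ])
    have hψ : ∀ a, ψ (algebraMap A L a) = χ a := fun a => IsLocalization.Away.lift_eq _ _ a
    refine ⟨{ toRingHom := ψ.comp val, commutes' := fun c => ?_ }, fun j => ?_⟩
    · change ψ (val (algebraMap K S c)) = _
      rw [hc, hψ, AlgHom.commutes]
    · change ψ (val (v j)) * b i = b j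
      rw [← hχ, ← hχ j, ← hψ, ← hψ, hv, ← map_mul, mul_assoc, mul_comm w, hw, mul_one]
  have hft : Algebra.FiniteType K S :=
    Algebra.FiniteType.of_surjective (MvPolynomial.aeval v) hsurj
  have hfp : Algebra.FinitePresentation K S := Algebra.FinitePresentation.of_finiteType.mp hft
  exact { formallySmooth := hfs, finitePresentation := hfp }

lemma awayι_projToSpec {f : A} {m : ℕ} (hf : f ∈ 𝒜 m) (hm : 0 < m) :
    Proj.awayι 𝒜 f hf hm ≫ projToSpec 𝒜 = Spec.map (CommRingCat.ofHom (awayConstants 𝒜 f)) := by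
  rw [projToSpec, Proj.awayι_toSpecZero_assoc, ← Spec.map_comp]
  rfl

end Chart

section Fermat
variable {K : Type u} [Field K] {d : ℕ} (hd : (d : K) ≠ 0)

include hd in
lemma smooth_fermatCurve : Smooth (curveToSpec (fermat K d) (isHomogeneous_fermat K d)) := by
  have h : ∀ i, Smooth (Proj.awayι (curveGrading (fermat K d) (isHomogeneous_fermat K d))
      (fermatVar K d i) (curveVar_mem _ _ i) one_pos ≫
        curveToSpec (fermat K d) (isHomogeneous_fermat K d)) := by
    intro i
    rw [curveToSpec, awayι_projToSpec]
    refine (HasRingHomProperty.Spec_iff (P := @Smooth)).mpr ?_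
    refine smooth_awayConstants (curveVar_mem (fermat K d) (isHomogeneous_fermat K d))
      (fun n a ha => exists_aeval_eq _ n ha) hd ?_ (fun {B} _ _ b hb => ?_) i
    · rw [Fin.sum_univ_three]
      exact sum_fermatVar_pow
    · refine ⟨Ideal.Quotient.liftₐ _ (MvPolynomial.aeval b) fun a ha => ?_, fun j => ?_⟩
      · obtain ⟨c, rfl⟩ := Ideal.mem_span_singleton.mp ha
        rw [map_mul, fermat, map_add, map_add, map_pow, map_pow, map_pow, MvPolynomial.aeval_X,
          MvPolynomial.aeval_X, MvPolynomial.aeval_X, ← Fin.sum_univ_three (fun j => b j ^ d), hb,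
          zero_mul]
      · exact (Ideal.Quotient.liftₐ_apply _ _ _ _).trans (MvPolynomial.aeval_X b j)
  have : IsZariskiLocalAtSource @Smooth.{u} :=
    HasRingHomProperty.instIsZariskiLocalAtSource (P := @Smooth.{u})
  rw [IsZariskiLocalAtSource.iff_of_iSup_eq_top (P := @Smooth.{u}) _
    (curve_cover (fermat K d) (isHomogeneous_fermat K d))]
  intro i
  have e : (Proj.basicOpen (curveGrading (fermat K d) (isHomogeneous_fermat K d))
      (fermatVar K d i)).ι = (Proj.basicOpenIsoSpec _ _ (curveVar_mem _ _ i) one_pos).hom ≫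
        Proj.awayι _ _ (curveVar_mem _ _ i) one_pos := by
    rw [← Proj.basicOpenIsoSpec_inv_ι, Iso.hom_inv_id_assoc]
  have h1 := h i
  refine (congrArg (fun g => Smooth (g ≫ curveToSpec (fermat K d) (isHomogeneous_fermat K d)))
    e).mpr ?_
  rw [Category.assoc]
  infer_instance

end Fermat

/-! ### Homomorphisms from twisting sheaves to syzygy sheaves. -/

section TwistToSyz
variable {A σ : Type u} [CommRing A] [SetLike σ A] [AddSubgroupClass σ A]
variable {𝒜 : ℕ → σ} [GradedRing 𝒜]

/-- In the localizations of a domain the nonzero element `g` can be cancelled pointwise. -/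
lemma mono_twistMul [IsDomain A] {m n : ℤ} {k : ℕ} (h : n = m + k) {g : A} (hg : g ∈ 𝒜 k)
    (hg0 : g ≠ 0) : Mono (twistMul 𝒜 h hg) := by
  constructor
  intro Z a b hab
  refine Scheme.Modules.hom_ext _ _ fun U => ?_
  refine ConcreteCategory.hom_ext _ _ fun z => ?_
  refine twistVal_ext fun x hx => ?_
  have h1 := congrArg (fun φ => twistVal (φ.app U z) x hx) hab
  have h2 : algebraMap A (LocAt 𝒜 x) g * twistVal (a.app U z) x hx =
      algebraMap A (LocAt 𝒜 x) g * twistVal (b.app U z) x hx := h1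
  have : IsDomain (LocAt 𝒜 x) :=
    IsLocalization.isDomain_localization x.asHomogeneousIdeal.toIdeal.primeCompl_le_nonZeroDivisors
  refine mul_left_cancel₀ ?_ h2
  rw [Ne, IsLocalization.to_map_eq_zero_iff (LocAt 𝒜 x)
    x.asHomogeneousIdeal.toIdeal.primeCompl_le_nonZeroDivisors]
  exact hg0

/-- A relation `∑ i, g i * f i = 0` gives a homomorphism from a twisting sheaf to the syzygy
sheaf. -/
lemma exists_twist_to_syz {ι : Type} [Fintype ι] {c k : ℕ} {f g : ι → A} (hf : ∀ i, f i ∈ 𝒜 c)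
    (hg : ∀ i, g i ∈ 𝒜 k) {l m : ℤ} (h : m - c = l + k) (hfg : ∑ i, g i * f i = 0) :
    ∃ φ : twist 𝒜 l ⟶ syz 𝒜 f hf m, ∀ i, φ ≫ syzι 𝒜 f hf m i = twistMul 𝒜 h (hg i) := by
  refine ⟨Limits.kernel.lift _ (Limits.biproduct.lift fun i => twistMul 𝒜 h (hg i)) ?_,
    fun i => ?_⟩
  · rw [Limits.biproduct.lift_desc]
    refine Scheme.Modules.hom_ext _ _ fun U => ?_
    refine ConcreteCategory.hom_ext _ _ fun z => ?_
    refine twistVal_ext fun x hx => ?_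
    have h1 := congrArg (twistVal · x hx) ((sum_app Finset.univ (fun i => twistMul 𝒜 h (hg i) ≫
      twistMul 𝒜 (m := m - c) (n := m) (by ring) (hf i)) U z))
    refine h1.trans ((twistVal_sum _ _ x hx).trans ?_)
    have h2 : ∀ i, twistVal ((twistMul 𝒜 h (hg i) ≫
        twistMul 𝒜 (m := m - c) (n := m) (by ring) (hf i)).app U z) x hx =
        algebraMap A (LocAt 𝒜 x) (g i * f i) * twistVal z x hx := fun i => by
      rw [mul_comm (g i), map_mul, mul_assoc]
      rfl
    rw [Finset.sum_congr rfl fun i _ => h2 i, ← Finset.sum_mul, ← map_sum, hfg, map_zero, zero_mul]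
    rfl
  · exact (Category.assoc _ _ _).symm.trans
      ((congrArg (· ≫ Limits.biproduct.π (fun _ : ι => twist 𝒜 (m - c)) i)
        (Limits.kernel.lift_ι _ _ _)).trans (Limits.biproduct.lift_π _ _))

lemma isFinitePresentation_twist {x : Fin 3 → A} (hx : ∀ i, x i ∈ 𝒜 1)
    (hc : ⨆ i, Proj.basicOpen 𝒜 (x i) = ⊤) (n : ℤ) :
    SheafOfModules.IsFinitePresentation (R := (Proj 𝒜).ringCatSheaf) (twist 𝒜 n) :=
  isFinitePresentation_of_isSectionBasis (ι := ULift.{u} (Fin 3))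
    (fun i => Proj.basicOpen 𝒜 (x i.down))
    ((Equiv.ulift.iSup_congr fun _ => rfl).trans hc) _
    fun i => isSectionBasis_powSection (hx i.down) n

end TwistToSyz

/-! ### The destabilizing syzygy on the Fermat curve. -/

section FermatSyz
variable {K : Type u} [Field K] {d : ℕ} (hd : (d : K) ≠ 0)
variable [IsDomain (MvPolynomial (Fin 3) K ⧸ (fermatIdeal K d).toIdeal)]

/-- The sum equals `X^(dp) + Y^(dp) + Z^(dp)`, which in characteristic `p` is the `p`-th power of
the Fermat equation. -/
lemma sum_curvePow_mul (p : ℕ) [Fact p.Prime] [CharP K p] {k c : ℕ} (h : k + c = d * p) :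
    ∑ i, curvePow (fermat K d) (isHomogeneous_fermat K d) k i *
      curvePow (fermat K d) (isHomogeneous_fermat K d) c i = 0 := by
  have := charP_of_injective_algebraMap
    (algebraMap K (MvPolynomial (Fin 3) K ⧸ (fermatIdeal K d).toIdeal)).injective p
  simp only [curvePow_eq, ← pow_add, h, pow_mul]
  rw [Fin.sum_univ_three, ← add_pow_char, ← add_pow_char, sum_fermatVar_pow,
    zero_pow (Fact.out : p.Prime).ne_zero]

variable [IsIntegral (FermatCurve K d)]

include hd in
lemma genericPoint_mem_fermatBasicOpen :
    genericPoint (FermatCurve K d) ∈ Proj.basicOpen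
      (curveGrading (fermat K d) (isHomogeneous_fermat K d)) (fermatVar K d 0) :=
  genericPoint_mem_basicOpen (fermatVar K d)
    (curveVar_mem (fermat K d) (isHomogeneous_fermat K d)) (fermatVar_ne_zero hd 0)

include hd in
lemma rank_fermatSyz (c : ℕ) (m : ℤ) :
    rank (curveSyz (fermat K d) (isHomogeneous_fermat K d) c m) = 2 :=
  (isSectionBasis_koszul (curveGrading (fermat K d) (isHomogeneous_fermat K d)) _ _ m
    (curveVar_mem (fermat K d) (isHomogeneous_fermat K d)) (curvePow_eq _ _ c) 0).rank_eq
    (genericPoint_mem_fermatBasicOpen hd)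

lemma hasDegree_fermatSyz (c : ℕ) (m : ℤ) :
    HasDegree (curvePointDegree (fermat K d) (isHomogeneous_fermat K d))
      (curveSyz (fermat K d) (isHomogeneous_fermat K d) c m) ((2 * m - 3 * c) * fermatDegree hd) :=
  hasDegree_syz (fermatVar K d) _ (fermatVar_ne_zero hd) (curve_cover _ _) _ _ _
    (curvePow_eq _ _ c) m

include hd in
/-- Powers of the variables span a destabilizing line subsheaf. -/
lemma not_isSemistable_fermatSyz (p : ℕ) [Fact p.Prime] [CharP K p] {k c : ℕ} (h : k + c = d * p)
    (hlt : 2 * (d * p) < 3 * c) :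
    ¬ IsSemistable (curvePointDegree (fermat K d) (isHomogeneous_fermat K d))
      (curveSyz (fermat K d) (isHomogeneous_fermat K d) c 0) := by
  intro hss
  let 𝒜 := curveGrading (fermat K d) (isHomogeneous_fermat K d)
  have hx := curveVar_mem (fermat K d) (isHomogeneous_fermat K d)
  -- The twist is `-dp` because multiplication by `X_i^k` must land in `𝒪(-c)`, and `-c = -dp + k`.
  obtain ⟨φ, hφ⟩ := exists_twist_to_syz (𝒜 := 𝒜) (l := - (d * p : ℕ)) (m := 0)
    (curvePow_mem (fermat K d) (isHomogeneous_fermat K d) c)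
    (curvePow_mem (fermat K d) (isHomogeneous_fermat K d) k) (by omega) (sum_curvePow_mul p h)
  have hmono : Mono φ := by
    have h1 := hφ 0
    -- Already the first component, multiplication by `X^k`, is a monomorphism.
    have : Mono (φ ≫ syzι 𝒜 _ _ 0 0) := by
      rw [h1]
      refine mono_twistMul _ _ ?_
      rw [curvePow_eq]
      exact pow_ne_zero _ (fermatVar_ne_zero hd 0)
    exact mono_of_mono φ (syzι 𝒜 _ _ 0 0)
  have hrank : rank (twist 𝒜 (- (d * p : ℕ))) = 1 :=
    (isSectionBasis_powSection (hx 0) _).rank_eq (genericPoint_mem_fermatBasicOpen hd)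
  have h1 := hss (twist 𝒜 (- (d * p : ℕ))) φ hmono
    (isFinitePresentation_twist hx (curve_cover _ _) _) (by rw [hrank]; exact one_pos) _ _
    (hasDegree_twist (fermatVar K d) hx (fermatVar_ne_zero hd) (curve_cover _ _) _ _)
    (hasDegree_fermatSyz hd c 0)
  rw [hrank, rank_fermatSyz hd] at h1
  have hpos : (0 : ℚ) < fermatDegree hd := by exact_mod_cast fermatDegree_pos hd
  have hlt' : (2 : ℚ) * (d * p) < 3 * c := by exact_mod_cast hlt
  change (((-(d * p : ℕ) * fermatDegree hd : ℤ) : ℚ)) / (1 : ℕ) ≤ _ at h1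
  push_cast at h1
  -- Semistability would give `-dp * h ≤ -3c/2 * h` with `h = fermatDegree hd > 0`, contrary to `2dp
  -- < 3c`.
  nlinarith

include hd in
/-- The powers of the variables as a global section of the syzygy sheaf. -/
lemma exists_fermatSection (p : ℕ) [Fact p.Prime] [CharP K p] {k c : ℕ} (h : k + c = d * p)
    (hk : (k : ℤ) = (d * p : ℕ) - (c : ℕ)) :
    ∃ s : Γ(curveSyz (fermat K d) (isHomogeneous_fermat K d) c (d * p : ℕ), ⊤), s ≠ 0 ∧
      ∀ i : Fin 3, (curveSyzι (fermat K d) (isHomogeneous_fermat K d) c (d * p : ℕ) i).app ⊤ s =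
        curveSection (fermat K d) (isHomogeneous_fermat K d) hk i := by
  let 𝒜 := curveGrading (fermat K d) (isHomogeneous_fermat K d)
  obtain ⟨s, hs⟩ := exists_syz 𝒜 (U := ⊤) _
    (curvePow_mem (fermat K d) (isHomogeneous_fermat K d) c) (d * p : ℕ)
    (fun i => curveSection (fermat K d) (isHomogeneous_fermat K d) hk i) (fun x hx => by
      have h1 := congrArg (algebraMap _ (LocAt 𝒜 x)) (sum_curvePow_mul (K := K) p h)
      rw [map_sum, map_zero] at h1
      refine (Finset.sum_congr rfl fun i _ => ?_).trans h1
      rw [map_mul, mul_comm]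
      rfl)
  refine ⟨s, fun h0 => ?_, hs⟩
  -- Any point would do for the nonvanishing: `X^k` is nonzero in a domain and therefore in its
  -- localization at a prime.
  let x : ProjectiveSpectrum 𝒜 := genericPoint (FermatCurve K d)
  have h1 : curveSection (fermat K d) (isHomogeneous_fermat K d) hk 0 = 0 :=
    (hs 0).symm.trans ((congrArg _ h0).trans (map_zero _))
  have h2 : algebraMap _ (LocAt 𝒜 x) (curvePow (fermat K d) (isHomogeneous_fermat K d) k 0) = 0 :=
    congrArg (twistVal · x (U := ⊤) trivial) h1
  rw [IsLocalization.to_map_eq_zero_iff (LocAt 𝒜 x)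
    x.asHomogeneousIdeal.toIdeal.primeCompl_le_nonZeroDivisors, curvePow_eq] at h2
  exact pow_ne_zero _ (fermatVar_ne_zero hd 0) h2

end FermatSyz

end SyzBundle

end

theorem proposition1 {K : Type u} [Field K] (p : ℕ) [Fact p.Prime] [CharP K p]
    (a : ℕ) (ha : 1 ≤ a) :
    SyzBundle.IsStronglySemistable p (SyzBundle.planeToSpec K) SyzBundle.planeDivisorDegree
      (SyzBundle.planeSyz K a 0) ∧
    (¬ ∃ d₁ : ℕ, ∀ d ≥ d₁, ∀ (F : MvPolynomial (Fin 3) K) (hF : F.IsHomogeneous d),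
      F ≠ 0 → ∀ [IsIntegral (SyzBundle.PlaneCurve F hF)], Smooth (SyzBundle.curveToSpec F hF) →
        SyzBundle.IsStronglySemistable p (SyzBundle.curveToSpec F hF)
          (SyzBundle.curvePointDegree F hF) (SyzBundle.restrictedSyz F hF a)) ∧
    ∀ d₀ : ℕ, ∃ d ≥ d₀, ∃ e ≥ 1, ¬ p ∣ d ∧
      a * p ^ (e - 1) < d ∧ 2 * d < 3 * (a * p ^ (e - 1)) ∧
      ∃ (F : MvPolynomial (Fin 3) K) (hF : F.IsHomogeneous d),
        F = MvPolynomial.X 0 ^ d + MvPolynomial.X 1 ^ d + MvPolynomial.X 2 ^ d ∧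
        ∃ _ : IsIntegral (SyzBundle.PlaneCurve F hF),
          Smooth (SyzBundle.curveToSpec F hF) ∧
          Nonempty ((Scheme.Modules.pullback (SyzBundle.frob p (SyzBundle.curveToSpec F hF) e)).obj
            (SyzBundle.restrictedSyz F hF a) ≅ SyzBundle.curveSyz F hF (a * p ^ e) 0) ∧
          (∃ δ < 0, SyzBundle.HasDegree (SyzBundle.curvePointDegree F hF)
            (SyzBundle.curveSyz F hF (a * p ^ e) (d * p : ℕ)) δ) ∧
          (∃ (k : ℕ) (hk : (k : ℤ) = (d * p : ℕ) - (a * p ^ e : ℕ))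
            (s : Γ(SyzBundle.curveSyz F hF (a * p ^ e) (d * p : ℕ), ⊤)), s ≠ 0 ∧
            ∀ i : Fin 3, (SyzBundle.curveSyzι F hF (a * p ^ e) (d * p : ℕ) i).app ⊤ s =
                SyzBundle.curveSection F hF hk i) ∧
          ¬ SyzBundle.IsSemistable (SyzBundle.curvePointDegree F hF)
            ((Scheme.Modules.pullback (SyzBundle.frob p (SyzBundle.curveToSpec F hF) e)).obj
              (SyzBundle.restrictedSyz F hF a)) := by
  have fermat_case : ∀ d₀ : ℕ, ∃ d ≥ d₀, ∃ e ≥ 1, ¬ p ∣ d ∧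
      a * p ^ (e - 1) < d ∧ 2 * d < 3 * (a * p ^ (e - 1)) ∧
      ∃ (F : MvPolynomial (Fin 3) K) (hF : F.IsHomogeneous d),
        F = MvPolynomial.X 0 ^ d + MvPolynomial.X 1 ^ d + MvPolynomial.X 2 ^ d ∧
        ∃ _ : IsIntegral (SyzBundle.PlaneCurve F hF),
          Smooth (SyzBundle.curveToSpec F hF) ∧
          Nonempty ((Scheme.Modules.pullback (SyzBundle.frob p (SyzBundle.curveToSpec F hF) e)).obj
            (SyzBundle.restrictedSyz F hF a) ≅ SyzBundle.curveSyz F hF (a * p ^ e) 0) ∧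
          (∃ δ < 0, SyzBundle.HasDegree (SyzBundle.curvePointDegree F hF)
            (SyzBundle.curveSyz F hF (a * p ^ e) (d * p : ℕ)) δ) ∧
          (∃ (k : ℕ) (hk : (k : ℤ) = (d * p : ℕ) - (a * p ^ e : ℕ))
            (s : Γ(SyzBundle.curveSyz F hF (a * p ^ e) (d * p : ℕ), ⊤)), s ≠ 0 ∧
            ∀ i : Fin 3, (SyzBundle.curveSyzι F hF (a * p ^ e) (d * p : ℕ) i).app ⊤ s =
                SyzBundle.curveSection F hF hk i) ∧
          ¬ SyzBundle.IsSemistable (SyzBundle.curvePointDegree F hF)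
            ((Scheme.Modules.pullback (SyzBundle.frob p (SyzBundle.curveToSpec F hF) e)).obj
              (SyzBundle.restrictedSyz F hF a)) := by
    intro d₀
    have hp : p.Prime := Fact.out
    -- With `e = n + 2` and `d = a * p ^ (n + 1) + 1`, the inequality `2 * d < 3 * (a * p ^ (n +
    -- 1))` amounts to `2 < a * p ^ (n + 1)`. The exponent `n + 1` is positive, so `d` is `1` modulo
    -- `p`.
    obtain ⟨n, hn, hn2⟩ : ∃ n, d₀ ≤ a * p ^ (n + 1) ∧ 2 < a * p ^ (n + 1) := by
      have h1 : d₀ + 2 + 1 < p ^ (d₀ + 2 + 1) := Nat.lt_pow_self hp.one_lt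
      have h2 : p ^ (d₀ + 2 + 1) ≤ a * p ^ (d₀ + 2 + 1) := Nat.le_mul_of_pos_left _ ha
      exact ⟨d₀ + 2, by omega, by omega⟩
    have hpn : p ∣ a * p ^ (n + 1) := (dvd_pow_self p n.succ_ne_zero).mul_left a
    have hpd : ¬ p ∣ a * p ^ (n + 1) + 1 := fun h =>
      hp.one_lt.ne' (Nat.dvd_one.mp ((Nat.dvd_add_right hpn).mp h))
    have hd : ((a * p ^ (n + 1) + 1 : ℕ) : K) ≠ 0 := fun h =>
      hpd ((CharP.cast_eq_zero_iff K p _).mp h)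
    have hq : a * p ^ (n + 2) = a * p ^ (n + 1) * p := by rw [pow_succ p (n + 1), mul_assoc]
    -- For this `d` the exponent `k = dp - a * p ^ e` of the section equals `p`.
    have hk : p + a * p ^ (n + 2) = (a * p ^ (n + 1) + 1) * p := by rw [hq]; ring
    have hlt : 2 * ((a * p ^ (n + 1) + 1) * p) < 3 * (a * p ^ (n + 2)) := by
      rw [hq]
      nlinarith [hp.pos]
    have := SyzBundle.isDomain_fermat hd
    have hint := SyzBundle.isIntegral_fermatCurve hd
    obtain ⟨φ⟩ := SyzBundle.nonempty_frob_restrictedSyz_iso p (SyzBundle.fermat K _)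
      (SyzBundle.isHomogeneous_fermat K (a * p ^ (n + 1) + 1)) a (n + 2)
    have h2d : 2 * (a * p ^ (n + 1) + 1) < 3 * (a * p ^ (n + 1)) := by omega
    have hk' : (p : ℤ) = ((a * p ^ (n + 1) + 1) * p : ℕ) - (a * p ^ (n + 2) : ℕ) := by omega
    obtain ⟨s, hs0, hs⟩ := SyzBundle.exists_fermatSection hd p hk hk'
    exact ⟨_, by omega, n + 2, by omega, hpd, Nat.lt_succ_self _, h2d,
      SyzBundle.fermat K _, SyzBundle.isHomogeneous_fermat K _, rfl, hint,
      SyzBundle.smooth_fermatCurve hd, ⟨φ⟩,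
      ⟨_, mul_neg_of_neg_of_pos (by omega) (SyzBundle.fermatDegree_pos hd),
        SyzBundle.hasDegree_fermatSyz hd _ _⟩,
      ⟨p, hk', s, hs0, hs⟩,
      fun h => SyzBundle.not_isSemistable_fermatSyz hd p hk hlt (h.of_iso φ)⟩
  refine ⟨SyzBundle.isStronglySemistable_planeSyz p a, ?_, fermat_case⟩
  rintro ⟨d₁, h⟩
  -- The supposed bound `d₁` is taken as the lower bound for the degree of the Fermat curve, whose
  -- `e`-th Frobenius pull-back is not semistable.
  obtain ⟨d, hd, e, -, hpd, -, -, F, hF, rfl, _, hsmooth, -, -, -, hss⟩ := fermat_case d₁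
  have hd0 : (d : K) ≠ 0 := fun h0 => hpd ((CharP.cast_eq_zero_iff K p _).mp h0)
  exact hss (h d hd _ hF (SyzBundle.irreducible_fermat hd0).ne_zero hsmooth e)
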